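/- Let $n\ge 0$, $J=\begin{pmatrix}0&1\\-1&0\end{pmatrix}$ and $\mathbb J=\mathrm{diag}(J,\dots,J)\in M(2n+2,\mathbb C)$. For $B=(B_0,\dots,B_n)\in M(2,\mathbb C)^{n+1}$ write $B_i=\begin{pmatrix}z_{2i}&w_{2i}\\z_{2i+1}&w_{2i+1}\end{pmatrix}$, $z=(z_0,\dots,z_{2n+1})$, $w=(w_0,\dots,w_{2n+1})$, $D(B)=\sum_i\det B_i$, $\|B\|^2=\sum_k(|z_k|^2+|w_k|^2)$. Let $$\widetilde{\mathbf E_S}=\{B: z\wedge w\ne0,\ D(B)=0\},\qquad \widetilde{\mathbf E_{\mathbb H}}=\{A\in M(2n+2,\mathbb C):\mathbb J A={}^tA\,\mathbb J,\ \operatorname{rank}A=2,\ A^2=0\},$$ complex submanifolds of the respective matrix spaces, and let $\beta:\widetilde{\mathbf E_S}\to\widetilde{\mathbf E_{\mathbb H}}$ map $B$ to the matrix with $2\times2$ blocks $A_{ij}=-B_iJ\,{}^tB_jJ$. On $M(2,\mathbb C)^{n+1}\setminus\{0\}$ put $$Z=\frac1{\|B\|^2}\sum_{k=0}^{2n+1}\Big(\overline{\tfrac{\partial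 D}{\partial z_k}}\,\tfrac{\partial}{\partial z_k}+\overline{\tfrac{\partial D}{\partial w_k}}\,\tfrac{\partial}{\partial w_k}\Big),\qquad \sigma_S=\frac1{(2\sqrt{-1})^{2n+2}}\,\mathbf i_Z(dz_0\wedge\cdots\wedge dz_{2n+1}\wedge dw_0\wedge\cdots\wedge dw_{2n+1}),$$ and restrict $\sigma_S$ to $\widetilde{\mathbf E_S}$. Let $Y_1,Y_2,Y_3$ be the vector fields on $\widetilde{\mathbf E_S}$ defined, through the right action $(B_i)\mapsto(B_ig)$ of $SL(2,\mathbb C)$, by the elements $\begin{pmatrix}\sqrt{-1}&0\\0&-\sqrt{-1}\end{pmatrix}$, $\begin{pmatrix}0&1\\-1&0\end{pmatrix}$, $\begin{pmatrix}0&\sqrt{-1}\\\sqrt{-1}&0\end{pmatrix}$ of $\mathfrak{sl}(2,\mathbb C)$, and put $\sigma=\mathbf i_{Y_3}\mathbf i_{Y_2}\mathbf i_{Y_1}\sigma_S$, a $4n$-form on $\widetilde{\mathbf E_S}$. Let $\rho:\mathbb H\to M(2,\mathbb C)$ be the embedding $x\mapsto\begin{pmatrix}x_0+\sqrt{-1}x_1&x_2+\sqrt{-1}x_3\\-x_2+\sqrt{-1}x_3&x_0-\sqrt{-1}x_1\end{pmatrix}$,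 applied blockwise to quaternionic matrices, and let $Sp(n+1)$, the group of quaternionic unitary matrices $g$ of size $n+1$, act on $\widetilde{\mathbf E_{\mathbb H}}$ by $A\mapsto\rho(g)A\rho(g)^{-1}$. Let $P^n\mathbb H$ be the set of the matrices $(p_i\theta(p_j))$ with $p\in\mathbb H^{n+1}$, $\sum_i\theta(p_i)p_i=1$, where $\theta$ is quaternionic conjugation, and let $\mathbf E_{\mathbb H}$ be its punctured tangent bundle (identified with the punctured cotangent bundle by the Riemannian metric), realized as the set of pairs $(P,Q)$ with $P\in P^n\mathbb H$, $Q\neq0$ a Hermitian quaternionic matrix, and $\frac12(PQ+QP)=\frac12Q$. It is a complex manifold through the identification $$\tau_{\mathbb H}:\mathbf E_{\mathbb H}\to\widetilde{\mathbf E_{\mathbb H}},\qquad \tau_{\mathbb H}(P,Q)=\|Q\|^2\rho(P)-\rho(Q)^2+\tfrac{\sqrt{-1}}{\sqrt2}\|Q\|\rho(Q),\qquad \|Q\|^2=\sum_{i,j}|Q_{ij}|^2 .$$ The Kähler polarization $\mathcal G$ is the bundle of complexified tangent vectors of type $(0,1)$; its canonical line bundle $K^{\mathcal G}$ is the bundle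 of complex-valued $4n$-forms whose interior product with every vector of $\mathcal G$ is zero. Then there is a nowhere vanishing holomorphic $4n$-form $\sigma_{\mathbb H}$ on $\widetilde{\mathbf E_{\mathbb H}}$, invariant under $Sp(n+1)$, with $$\beta^*\sigma_{\mathbb H}=\sigma=\mathbf i_{Y_3}\mathbf i_{Y_2}\mathbf i_{Y_1}\sigma_S ,$$ and it is unique: every form $\eta$ of type $(4n,0)$ on $\widetilde{\mathbf E_{\mathbb H}}$ with $\beta^*\eta=\sigma$ equals $\sigma_{\mathbb H}$. Moreover the canonical line bundle $K^{\mathcal G}$ is holomorphically trivial, over $\widetilde{\mathbf E_{\mathbb H}}$ and over the punctured cotangent bundle $\mathbf E_{\mathbb H}$ of $P^n\mathbb H$, with $\sigma_{\mathbb H}$ and $\tau_{\mathbb H}^*\sigma_{\mathbb H}$ as trivializing sections: on every open set, multiplying this section by functions identifies the holomorphic functions with the holomorphic sections of $K^{\mathcal G}$. -/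

import Mathlib

open scoped Quaternion TensorProduct Kronecker Matrix

/-! Matrix spaces are normed spaces (the choice of the norm is immaterial in finite dimension). -/

attribute [local instance] Matrix.normedAddCommGroup

noncomputable section

namespace HopfForm

instance instNormedSpaceComplexMatrix {l m : Type*} [Fintype l] [Fintype m] :
    NormedSpace ℂ (Matrix l m ℂ) := Matrix.normedSpace

instance instNormedSpaceQuaternionMatrix {l m : Type*} [Fintype l] [Fintype m] :
    NormedSpace ℝ (Matrix l m ℍ[ℝ]) := Matrix.normedSpace

/-! ## Tangent spaces and holomorphic forms on embedded complex manifolds -/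

section Generic

/-- The tangent space at `x` of a subset `X` of a normed space, as a linear subspace of the ambient
space. For a (real or complex) submanifold the tangent cone is already a subspace, and it is
the usual tangent space. -/
def tangentSpace (𝕜 : Type*) [NontriviallyNormedField 𝕜] {V : Type*} [NormedAddCommGroup V]
    [NormedSpace 𝕜 V] (X : Set V) (x : V) : Submodule 𝕜 V :=
  Submodule.span 𝕜 (tangentConeAt 𝕜 X x)

theorem fderiv_mem_tangentSpace {𝕜 : Type*} [NontriviallyNormedField 𝕜]
    {V W : Type*} [NormedAddCommGroup V] [NormedSpace 𝕜 V]
    [NormedAddCommGroup W] [NormedSpace 𝕜 W] {X : Set V} {Y : Set W} {f : V → W}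
    (hf : Set.MapsTo f X Y) (x : V) {v : V} (hv : v ∈ tangentSpace 𝕜 X x) :
    fderiv 𝕜 f x v ∈ tangentSpace 𝕜 Y (f x) := by
  by_cases hd : DifferentiableAt 𝕜 f x
  · have h1 := (hd.hasFDerivAt.hasFDerivWithinAt (s := X)).mapsTo_tangent_cone
    have h2 : tangentSpace 𝕜 X x ≤
        (tangentSpace 𝕜 Y (f x)).comap (fderiv 𝕜 f x).toLinearMap := by
      refine Submodule.span_le.2 fun w hw => ?_
      exact Submodule.subset_span (tangentConeAt_mono hf.image_subset (h1 hw))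
    exact h2 hv
  · rw [fderiv_zero_of_not_differentiableAt hd]
    exact Submodule.zero_mem _

/-- The tangent map at `x` of the map `X → Y` induced by an ambient map `f`. -/
def tangentMap (𝕜 : Type*) [NontriviallyNormedField 𝕜]
    {V W : Type*} [NormedAddCommGroup V] [NormedSpace 𝕜 V]
    [NormedAddCommGroup W] [NormedSpace 𝕜 W] {X : Set V} {Y : Set W} {f : V → W}
    (hf : Set.MapsTo f X Y) (x : V) : tangentSpace 𝕜 X x →ₗ[𝕜] tangentSpace 𝕜 Y (f x) :=
  (fderiv 𝕜 f x).toLinearMap.restrict fun _ hv => fderiv_mem_tangentSpace hf x hv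

variable {V : Type*} [NormedAddCommGroup V] [NormedSpace ℂ V]
  {W : Type*} [NormedAddCommGroup W] [NormedSpace ℂ W]

/-- A (not necessarily continuous) differential form of type `(k, 0)` on `X`: a family of
complex multilinear alternating forms on the tangent spaces. -/
abbrev DiffForm (X : Set V) (k : ℕ) : Type _ :=
  ∀ x : X, (tangentSpace ℂ X (x : V)) [⋀^Fin k]→ₗ[ℂ] ℂ

/-- A form on a complex submanifold is holomorphic if it is locally the restriction of a
holomorphic form on an open set of the ambient space. -/
def IsHolomorphic {X : Set V} {k : ℕ} (ω : DiffForm X k) : Prop :=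
  ∀ x : X, ∃ (U : Set V) (Ω : V → V [⋀^Fin k]→L[ℂ] ℂ),
    IsOpen U ∧ (x : V) ∈ U ∧ DifferentiableOn ℂ Ω U ∧
    ∀ y : X, (y : V) ∈ U → ∀ v : Fin k → tangentSpace ℂ X (y : V),
      ω y v = Ω y (fun i => (v i : V))

/-- Pullback of a form on `Y` along the map `X → Y` induced by an ambient holomorphic map `f`. -/
def pullback {X : Set V} {Y : Set W} {f : V → W} (hf : Set.MapsTo f X Y) {k : ℕ}
    (ω : DiffForm Y k) : DiffForm X k :=
  fun x => (ω ⟨f x, hf x.2⟩).compLinearMap (tangentMap ℂ hf (x : V))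

end Generic

/-! ## The Kähler polarization and its canonical line bundle

In this section `X` is a real manifold (a subset of the real normed space `E`) which is
regarded as a complex manifold through a map `τ` identifying it with a complex submanifold of the
complex normed space `F`. -/

section Polarization

variable {E : Type*} [NormedAddCommGroup E] [NormedSpace ℝ E]
  {F : Type*} [NormedAddCommGroup F] [NormedSpace ℂ F]

/-- The complexified tangent space `T_x X ⊗ ℂ`. -/
abbrev ComplexTangent (X : Set E) (x : E) : Type _ := ℂ ⊗[ℝ] (tangentSpace ℝ X x)

/-- The differential of `τ`, as a real linear map on `T_x X`. -/
def realDifferential (X : Set E) (τ : E → F) (x : E) : tangentSpace ℝ X x →ₗ[ℝ] F :=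
  (fderiv ℝ τ x).toLinearMap ∘ₗ (tangentSpace ℝ X x).subtype

/-- The complex linear extension of the differential of `τ` to `T_x X ⊗ ℂ`. -/
def complexDifferential (X : Set E) (τ : E → F) (x : E) : ComplexTangent X x →ₗ[ℂ] F :=
  (realDifferential X τ x).liftBaseChange ℂ

/-- The complex structure `J` of `F`, as a real linear map. -/
def complexStructure (F : Type*) [NormedAddCommGroup F] [NormedSpace ℂ F] : F →ₗ[ℝ] F :=
  LinearMap.restrictScalars ℝ (LinearMap.lsmul ℂ F Complex.I)

/-- The polarization `𝒢`: the complexified tangent vectors `ξ` of type `(0,1)`. They are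
characterized by `J ξ = -√-1 ξ`, where `J` is the complex structure of `X` (extended complex
linearly), which corresponds to that of `F` under `dτ`. -/
def polarization (X : Set E) (τ : E → F) (x : E) : Submodule ℂ (ComplexTangent X x) :=
  LinearMap.ker ((complexStructure F ∘ₗ realDifferential X τ x).baseChange ℂ
    + Complex.I • (realDifferential X τ x).baseChange ℂ)

/-- The fibre at `x` of `⋀^k` of the annihilator of `𝒢`, that is: the complex valued `k`-forms
on `T_x X ⊗ ℂ` whose interior product with every vector of `𝒢` vanishes. For `k` the complex
dimension of `X` this is the canonical line bundle of `𝒢`. -/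
def canonicalFiber (X : Set E) (τ : E → F) (k : ℕ) (x : E) :
    Submodule ℂ ((ComplexTangent X x) [⋀^Fin k]→ₗ[ℂ] ℂ) where
  carrier := {η | ∀ v : Fin k → ComplexTangent X x, (∃ i, v i ∈ polarization X τ x) → η v = 0}
  zero_mem' := fun _ _ => rfl
  add_mem' := fun {a b} ha hb v hv => by
    rw [AlternatingMap.add_apply, ha v hv, hb v hv, add_zero]
  smul_mem' := fun c a ha v hv => by
    rw [AlternatingMap.smul_apply, ha v hv, smul_zero]

/-- `f` is a holomorphic function on the open set `U` of `X` (values outside `U` play no role):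
locally it is a holomorphic function of `τ`. -/
def IsHolomorphicFunctionOn (X : Set E) (τ : E → F) (U : Set X) (f : X → ℂ) : Prop :=
  ∀ x ∈ U, ∃ (O : Set F) (g : F → ℂ), IsOpen O ∧ τ x ∈ O ∧ DifferentiableOn ℂ g O ∧
    ∀ y ∈ U, τ y ∈ O → f y = g (τ y)

/-- `s` is a holomorphic section of the canonical bundle on the open set `U` of `X`: locally it is
the pullback under `τ` of a holomorphic form. -/
def IsHolomorphicSectionOn (X : Set E) (τ : E → F) (k : ℕ) (U : Set X)
    (s : ∀ x : X, canonicalFiber X τ k x) : Prop :=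
  ∀ x ∈ U, ∃ (O : Set F) (Ω : F → F [⋀^Fin k]→L[ℂ] ℂ),
    IsOpen O ∧ τ x ∈ O ∧ DifferentiableOn ℂ Ω O ∧
    ∀ y ∈ U, τ y ∈ O → ∀ v : Fin k → ComplexTangent X (y : E),
      (s y : (ComplexTangent X (y : E)) [⋀^Fin k]→ₗ[ℂ] ℂ) v =
        Ω (τ y) (fun i => complexDifferential X τ y (v i))

/-- A holomorphic trivialization of the canonical bundle: complex linear isomorphisms of `ℂ` with
the fibres under which, over every open set, the holomorphic functions are exactly the holomorphic
sections. -/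
def IsHolomorphicTrivialization (X : Set E) (τ : E → F) (k : ℕ)
    (φ : ∀ x : X, ℂ ≃ₗ[ℂ] canonicalFiber X τ k x) : Prop :=
  ∀ U : Set X, IsOpen U → ∀ f : X → ℂ,
    IsHolomorphicFunctionOn X τ U f ↔ IsHolomorphicSectionOn X τ k U (fun x => φ x (f x))

theorem complexDifferential_mem {X : Set E} {Y : Set F} {τ : E → F} (hτ : Set.MapsTo τ X Y)
    (x : E) (v : ComplexTangent X x) :
    complexDifferential X τ x v ∈ tangentSpace ℂ Y (τ x) := by
  induction v using TensorProduct.induction_on with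
  | zero => rw [map_zero]; exact Submodule.zero_mem _
  | add a b ha hb => rw [map_add]; exact Submodule.add_mem _ ha hb
  | tmul c v =>
    have h1 : fderiv ℝ τ x v ∈ tangentSpace ℝ Y (τ x) := fderiv_mem_tangentSpace hτ x v.2
    have h2 : tangentSpace ℝ Y (τ x) ≤ (tangentSpace ℂ Y (τ x)).restrictScalars ℝ :=
      Submodule.span_le.2 fun w hw => Submodule.subset_span (tangentConeAt_mono_field hw)
    have h3 : complexDifferential X τ x (c ⊗ₜ[ℝ] v) = c • fderiv ℝ τ x v := by
      simp [complexDifferential, realDifferential]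
    rw [h3]
    exact Submodule.smul_mem _ c (h2 h1)

/-- Pullback under `τ` of a form of type `(k, 0)` on the complex manifold `Y`, as a complex valued
form on `X`, that is a form on the complexified tangent spaces. -/
def complexPullback {X : Set E} {Y : Set F} {τ : E → F} (hτ : Set.MapsTo τ X Y) {k : ℕ}
    (ω : DiffForm Y k) (x : X) : (ComplexTangent X (x : E)) [⋀^Fin k]→ₗ[ℂ] ℂ :=
  (ω ⟨τ x, hτ x.2⟩).compLinearMap
    (LinearMap.codRestrict (tangentSpace ℂ Y (τ (x : E))) (complexDifferential X τ (x : E))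
      (complexDifferential_mem hτ (x : E)))

end Polarization

/-! ## Quaternions and complex matrices -/

/-- `J = (0 1; -1 0)`. -/
def J : Matrix (Fin 2) (Fin 2) ℂ := !![0, 1; -1, 0]

/-- The block diagonal matrix `𝕁 = diag(J, …, J)`. -/
def JJ (n : ℕ) : Matrix (Fin (n + 1) × Fin 2) (Fin (n + 1) × Fin 2) ℂ :=
  (1 : Matrix (Fin (n + 1)) (Fin (n + 1)) ℂ) ⊗ₖ J

/-- The representation `ρ` of the quaternions by complex `2 × 2` matrices. -/
def rho (x : ℍ[ℝ]) : Matrix (Fin 2) (Fin 2) ℂ :=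
  !![(x.re : ℂ) + Complex.I * x.imI, x.imJ + Complex.I * x.imK;
    -(x.imJ : ℂ) + Complex.I * x.imK, x.re - Complex.I * x.imI]

/-- `ρ` applied blockwise to a quaternionic matrix. -/
def rhoMat {l m : Type*} (X : Matrix l m ℍ[ℝ]) : Matrix (l × Fin 2) (m × Fin 2) ℂ :=
  Matrix.of fun i j => rho (X i.1 j.1) i.2 j.2

/-- Quaternionic square matrices of size `n + 1`. -/
abbrev HMat (n : ℕ) : Type := Matrix (Fin (n + 1)) (Fin (n + 1)) ℍ[ℝ]

/-- Complex square matrices of size `2n + 2`, written in `2 × 2` blocks. -/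
abbrev CMat (n : ℕ) : Type := Matrix (Fin (n + 1) × Fin 2) (Fin (n + 1) × Fin 2) ℂ

/-- The group `Sp(n+1)` of quaternionic unitary matrices. -/
abbrev Sp (n : ℕ) : Submonoid (HMat n) := unitary (HMat n)

/-! ## The spaces and maps -/

/-- The ambient space `M(2,ℂ)^{n+1}`; the `i`-th matrix of `B` is
`B i = (z_{2i} w_{2i}; z_{2i+1} w_{2i+1})`. -/
abbrev BSpace (n : ℕ) : Type := Fin (n + 1) → Matrix (Fin 2) (Fin 2) ℂ

/-- The vector `z = (z_0, …, z_{2n+1})`; its entry `z_{2i+a}` has index `(i, a)`. -/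
def zVec {n : ℕ} (B : BSpace n) : Fin (n + 1) × Fin 2 → ℂ := fun k => B k.1 k.2 0

/-- The vector `w = (w_0, …, w_{2n+1})`; its entry `w_{2i+a}` has index `(i, a)`. -/
def wVec {n : ℕ} (B : BSpace n) : Fin (n + 1) × Fin 2 → ℂ := fun k => B k.1 k.2 1

/-- `D(B) = ∑ det B_i`. -/
def D (n : ℕ) (B : BSpace n) : ℂ := ∑ i, (B i).det

/-- `Ẽ_S`: the families `B` with `z ∧ w ≠ 0` (some component of `z ∧ w` is nonzero)
and `∑ det B_i = 0`. -/
def tildeES (n : ℕ) : Set (BSpace n) :=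
  {B | (∃ k l, zVec B k * wVec B l - zVec B l * wVec B k ≠ 0) ∧ D n B = 0}

/-- `Ẽ_ℍ`: the matrices `A` with `𝕁 A = ᵗA 𝕁`, `rank A = 2` and `A² = 0`. -/
def tildeEH (n : ℕ) : Set (CMat n) :=
  {A | JJ n * A = Aᵀ * JJ n ∧ A.rank = 2 ∧ A ^ 2 = 0}

/-- `β(B)` has the blocks `A_{ij} = - B_i J ᵗB_j J`. -/
def beta (n : ℕ) (B : BSpace n) : CMat n :=
  Matrix.of fun k l => (-(B k.1 * J * (B l.1)ᵀ * J)) k.2 l.2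

/-- The quaternionic projective space, as the set of the matrices `(p_i θ(p_j))` with
`⟨p, p⟩ = 1`. -/
def PH (n : ℕ) : Set (HMat n) :=
  {P | ∃ p : Fin (n + 1) → ℍ[ℝ], ∑ i, star (p i) * p i = 1 ∧
    P = Matrix.of fun i j => p i * star (p j)}

/-- The Jordan product. -/
def jordan {n : ℕ} (X Y : HMat n) : HMat n := (1 / 2 : ℝ) • (X * Y + Y * X)

/-- `E_ℍ`, the punctured tangent bundle of the quaternionic projective space: the pairs `(P, Q)`
with `P` in the projective space, `Q ≠ 0` Hermitian and `P ∘ Q = ½ Q`. -/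
def EH (n : ℕ) : Set (HMat n × HMat n) :=
  {x | x.1 ∈ PH n ∧ x.2ᴴ = x.2 ∧ jordan x.1 x.2 = (1 / 2 : ℝ) • x.2 ∧ x.2 ≠ 0}

/-- The norm `‖Q‖`, with `‖Q‖² = ∑ |Q_{ij}|²` (which is `tr (Q ∘ Q)` for Hermitian `Q`). -/
def hNorm {n : ℕ} (Q : HMat n) : ℝ := Real.sqrt (∑ i, ∑ j, ‖Q i j‖ ^ 2)

/-- `τ_ℍ(P, Q) = ‖Q‖² ρ(P) - ρ(Q)² + (√-1/√2) ‖Q‖ ρ(Q)`. -/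
def tauH (n : ℕ) (x : HMat n × HMat n) : CMat n :=
  ((hNorm x.2 : ℂ) ^ 2) • rhoMat x.1 - rhoMat x.2 ^ 2
    + (Complex.I / (Real.sqrt 2 : ℂ) * (hNorm x.2 : ℂ)) • rhoMat x.2

/-- The left action of `Sp(n+1)` on the matrices `A`: conjugation by `ρ(g)`. -/
def spAct (n : ℕ) (g : HMat n) (A : CMat n) : CMat n := rhoMat g * A * rhoMat (star g)

/-! ### The maps are well defined -/

theorem rho_add (x y : ℍ[ℝ]) : rho (x + y) = rho x + rho y := by
  ext i j
  fin_cases i <;> fin_cases j <;> simp [rho] <;> ring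

theorem rho_mul (x y : ℍ[ℝ]) : rho (x * y) = rho x * rho y := by
  ext i j
  fin_cases i <;> fin_cases j <;>
    simp [rho, Matrix.mul_apply, Fin.sum_univ_two] <;> ring_nf <;> simp <;> ring

theorem rho_real (r : ℝ) : rho (r : ℍ[ℝ]) = (r : ℂ) • 1 := by
  ext i j
  fin_cases i <;> fin_cases j <;> simp [rho]

theorem J_mul_rho (x : ℍ[ℝ]) : J * rho x = (rho (star x))ᵀ * J := by
  ext i j
  fin_cases i <;> fin_cases j <;> simp [rho, J, Matrix.mul_apply, Fin.sum_univ_two] <;> ring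

theorem rho_sum {ι : Type*} (s : Finset ι) (f : ι → ℍ[ℝ]) :
    rho (∑ i ∈ s, f i) = ∑ i ∈ s, rho (f i) :=
  map_sum (AddMonoidHom.mk' rho rho_add) f s

theorem rhoMat_add {l m : Type*} (X Y : Matrix l m ℍ[ℝ]) :
    rhoMat (X + Y) = rhoMat X + rhoMat Y := by
  ext i j
  simp [rhoMat, rho_add]

theorem rhoMat_mul {l m k : Type*} [Fintype m] (X : Matrix l m ℍ[ℝ]) (Y : Matrix m k ℍ[ℝ]) :
    rhoMat (X * Y) = rhoMat X * rhoMat Y := by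
  ext i j
  simp [rhoMat, Matrix.mul_apply, rho_sum, rho_mul, Matrix.sum_apply, Fintype.sum_prod_type]

theorem rhoMat_real {l : Type*} [DecidableEq l] (r : ℝ) :
    rhoMat (r • (1 : Matrix l l ℍ[ℝ])) = (r : ℂ) • 1 := by
  ext ⟨i, a⟩ ⟨j, b⟩
  by_cases h : i = j
  · subst h
    have := congrFun (congrFun (rho_real r) a) b
    simp only [rhoMat, Matrix.of_apply, Matrix.smul_apply, Matrix.one_apply_eq]
    rw [show r • (1 : ℍ[ℝ]) = (r : ℍ[ℝ]) by ext <;> simp, this]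
    simp [Matrix.one_apply]
  · have := congrFun (congrFun (rho_real 0) a) b
    simp only [rhoMat, Matrix.of_apply, Matrix.smul_apply, Matrix.one_apply, h, Prod.mk.injEq,
      false_and, if_false, smul_zero]
    simpa using this

theorem rhoMat_one {l : Type*} [DecidableEq l] : rhoMat (1 : Matrix l l ℍ[ℝ]) = 1 := by
  simpa using rhoMat_real (l := l) 1

theorem rhoMat_zero {l m : Type*} : rhoMat (0 : Matrix l m ℍ[ℝ]) = 0 := by
  ext i j
  have := congrFun (congrFun (rho_real 0) i.2) j.2
  simpa [rhoMat] using this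

theorem JJ_apply (n : ℕ) (i j : Fin (n + 1)) (a b : Fin 2) :
    JJ n (i, a) (j, b) = if i = j then J a b else 0 := by
  simp [JJ, Matrix.one_apply]

theorem JJ_mul_JJ (n : ℕ) : JJ n * JJ n = -1 := by
  have hJ : J * J = -1 := by
    ext i j
    fin_cases i <;> fin_cases j <;> simp [J]
  rw [JJ, ← Matrix.mul_kronecker_mul, hJ, one_mul]
  ext ⟨i, a⟩ ⟨j, b⟩
  by_cases h : i = j <;> by_cases h' : a = b <;> simp [h, h']

theorem JJ_transpose (n : ℕ) : (JJ n)ᵀ = -JJ n := by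
  ext ⟨i, a⟩ ⟨j, b⟩
  rw [Matrix.transpose_apply, Matrix.neg_apply, JJ_apply, JJ_apply]
  by_cases h : i = j
  · subst h
    fin_cases a <;> fin_cases b <;> simp [J]
  · simp [h, Ne.symm h]

theorem JJ_mul_rhoMat {n : ℕ} (X : HMat n) : JJ n * rhoMat X = (rhoMat Xᴴ)ᵀ * JJ n := by
  ext ⟨i, a⟩ ⟨j, b⟩
  have := congrFun (congrFun (J_mul_rho (X i j)) a) b
  simpa [Matrix.mul_apply, Fintype.sum_prod_type, JJ_apply, rhoMat, Fin.sum_univ_two,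
    ite_mul, mul_ite, Finset.sum_add_distrib] using this

theorem rank_eq_two {n : ℕ} {ι : Type*} [Fintype ι] [DecidableEq ι] (hι : Fintype.card ι = 2)
    {A : CMat n} (B : Matrix (Fin (n + 1) × Fin 2) ι ℂ) (C : Matrix ι (Fin (n + 1) × Fin 2) ℂ)
    (hA : A = B * C) (L : Matrix ι (Fin (n + 1) × Fin 2) ℂ)
    (R : Matrix (Fin (n + 1) × Fin 2) ι ℂ) (h : IsUnit (L * A * R)) : A.rank = 2 := by
  refine le_antisymm ?_ ?_
  · rw [hA]
    exact ((Matrix.rank_mul_le_left B C).trans (Matrix.rank_le_card_width B)).trans hι.le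
  · exact (hι.symm.le.trans (Matrix.rank_of_isUnit _ h).symm.le).trans
      ((Matrix.rank_mul_le_left (L * A) R).trans (Matrix.rank_mul_le_right L A))

theorem beta_mapsTo (n : ℕ) : Set.MapsTo (beta n) (tildeES n) (tildeEH n) := by
  rintro B ⟨⟨k, l, hkl⟩, hD⟩
  set M : Matrix (Fin (n + 1) × Fin 2) (Fin 2) ℂ := Matrix.of fun k c => B k.1 k.2 c with hM
  have hβ : beta n B = -(M * J * Mᵀ * JJ n) := by
    ext ⟨i, a⟩ ⟨j, b⟩
    simp [beta, hM, Matrix.mul_apply, Fintype.sum_prod_type, JJ_apply, Fin.sum_univ_two, mul_ite]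
  have hJT : Jᵀ = -J := by
    ext i j
    fin_cases i <;> fin_cases j <;> simp [J]
  have hz : Mᵀ * JJ n * M = 0 := by
    have h0 : ∑ i, (B i 0 0 * B i 1 1 - B i 0 1 * B i 1 0) = 0 := by
      simpa [D, Matrix.det_fin_two] using hD
    ext a b
    fin_cases a <;> fin_cases b <;>
      simp [hM, Matrix.mul_apply, Fintype.sum_prod_type, JJ_apply, Fin.sum_univ_two,
        mul_ite, J]
    · refine Finset.sum_eq_zero fun i _ => by ring
    · rw [← h0]; refine Finset.sum_congr rfl fun i _ => by ring
    · refine Eq.trans ?_ ((congrArg Neg.neg h0).trans neg_zero)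
      rw [← Finset.sum_neg_distrib]
      refine Finset.sum_congr rfl fun i _ => by ring
    · refine Finset.sum_eq_zero fun i _ => by ring
  refine ⟨?_, ?_, ?_⟩
  · rw [hβ]
    simp only [Matrix.transpose_neg, Matrix.transpose_mul, Matrix.transpose_transpose,
      JJ_transpose, hJT]
    simp [Matrix.mul_assoc]
  · set m := zVec B k * wVec B l - zVec B l * wVec B k with hm
    set L : Matrix (Fin 2) (Fin (n + 1) × Fin 2) ℂ := Matrix.of fun c i =>
      (if i = k then ![wVec B l, -zVec B l] c else 0)
        + (if i = l then ![-wVec B k, zVec B k] c else 0) with hL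
    have hLM : L * M = m • 1 := by
      ext a b
      have hs : ∀ f g : Fin (n + 1) × Fin 2 → ℂ, ∀ u v : ℂ,
          ∑ i, ((if i = k then u else 0) + (if i = l then v else 0)) * f i = u * f k + v * f l := by
        intro f g u v
        simp [add_mul, ite_mul, Finset.sum_add_distrib]
      simp only [Matrix.mul_apply, hL, Matrix.of_apply]
      rw [hs _ (fun _ => 0)]
      fin_cases a <;> fin_cases b <;> simp [hM, hm, zVec, wVec] <;> ring
    refine rank_eq_two (by simp) M (-(J * Mᵀ * JJ n)) ?_ L (JJ n * Lᵀ) ?_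
    · rw [hβ]; simp [Matrix.mul_assoc]
    · have h1 : L * beta n B * (JJ n * Lᵀ) = (m ^ 2) • J := by
        have : L * beta n B * (JJ n * Lᵀ) = -((L * M) * J * (Mᵀ * (JJ n * JJ n) * Lᵀ)) := by
          rw [hβ]; simp [Matrix.mul_assoc]
        rw [this, JJ_mul_JJ, hLM]
        have h2 : Mᵀ * Lᵀ = m • 1 := by
          rw [← Matrix.transpose_mul, hLM]; simp
        simp [h2, smul_smul, sq]
      rw [h1, Matrix.isUnit_iff_isUnit_det]
      simp [J, Matrix.det_fin_two, hkl]
  · rw [hβ, sq, neg_mul_neg]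
    have : M * J * Mᵀ * JJ n * (M * J * Mᵀ * JJ n) = M * J * (Mᵀ * JJ n * M) * (J * Mᵀ * JJ n) := by
      simp [Matrix.mul_assoc]
    rw [this, hz]
    simp

theorem spAct_mapsTo (n : ℕ) (g : Sp n) : Set.MapsTo (spAct n g) (tildeEH n) (tildeEH n) := by
  rintro A ⟨h1, h2, h3⟩
  have hg : rhoMat (star (g : HMat n)) * rhoMat (g : HMat n) = 1 := by
    rw [← rhoMat_mul, Unitary.star_mul_self_of_mem g.2, rhoMat_one]
  have hg' : rhoMat (g : HMat n) * rhoMat (star (g : HMat n)) = 1 := by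
    rw [← rhoMat_mul, Unitary.mul_star_self_of_mem g.2, rhoMat_one]
  have e1 := JJ_mul_rhoMat (g : HMat n)
  have e2 := JJ_mul_rhoMat (star (g : HMat n))
  rw [← Matrix.star_eq_conjTranspose] at e1 e2
  rw [star_star] at e2
  refine ⟨?_, ?_, ?_⟩
  · calc JJ n * (rhoMat (g : HMat n) * A * rhoMat (star (g : HMat n)))
        = (JJ n * rhoMat (g : HMat n)) * A * rhoMat (star (g : HMat n)) := by
          simp only [Matrix.mul_assoc]
      _ = (rhoMat (star (g : HMat n)))ᵀ * (JJ n * A) * rhoMat (star (g : HMat n)) := by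
          rw [e1]; simp only [Matrix.mul_assoc]
      _ = (rhoMat (star (g : HMat n)))ᵀ * Aᵀ * (JJ n * rhoMat (star (g : HMat n))) := by
          rw [h1]; simp only [Matrix.mul_assoc]
      _ = (rhoMat (g : HMat n) * A * rhoMat (star (g : HMat n)))ᵀ * JJ n := by
          rw [e2]; simp only [Matrix.transpose_mul, Matrix.mul_assoc]
  · refine le_antisymm ?_ ?_
    · exact ((Matrix.rank_mul_le_left _ _).trans (Matrix.rank_mul_le_right _ _)).trans h2.le
    · have : A = rhoMat (star (g : HMat n)) * spAct n g A * rhoMat (g : HMat n) := by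
        calc A = 1 * A * 1 := by simp
          _ = _ := by rw [← hg]; simp only [spAct, Matrix.mul_assoc]
      refine h2.symm.le.trans ((congrArg Matrix.rank this).le.trans ?_)
      exact (Matrix.rank_mul_le_left _ _).trans (Matrix.rank_mul_le_right _ _)
  · calc (rhoMat (g : HMat n) * A * rhoMat (star (g : HMat n))) ^ 2
        = rhoMat (g : HMat n) * A * (rhoMat (star (g : HMat n)) * rhoMat (g : HMat n)) * A
            * rhoMat (star (g : HMat n)) := by
          rw [sq]; simp only [Matrix.mul_assoc]
      _ = rhoMat (g : HMat n) * (A ^ 2) * rhoMat (star (g : HMat n)) := by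
          rw [hg, sq]; simp only [Matrix.mul_assoc, mul_one]
      _ = 0 := by rw [h3]; simp

theorem tauH_mapsTo (n : ℕ) : Set.MapsTo (tauH n) (EH n) (tildeEH n) := by
  rintro ⟨P, Q⟩ ⟨⟨p, hp, hP⟩, hQ, hPQ, hQ0⟩
  simp only at hP hQ hPQ hQ0
  set pm : Matrix (Fin (n + 1)) (Fin 1) ℍ[ℝ] := Matrix.of fun i _ => p i with hpm
  have hP' : P = pm * pmᴴ := by
    rw [hP]; ext1 i j; simp [hpm, Matrix.mul_apply]
  have hpp : pmᴴ * pm = 1 := by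
    ext1 i j
    have : i = j := Subsingleton.elim _ _
    subst this
    simpa [hpm, Matrix.mul_apply] using hp
  have hsum : P * Q + Q * P = Q := by
    have := congrArg (fun X => (2 : ℝ) • X) hPQ
    simpa [jordan, smul_smul] using this
  set q : Matrix (Fin (n + 1)) (Fin 1) ℍ[ℝ] := Q * pm with hq
  have hqH : qᴴ = pmᴴ * Q := by rw [hq, Matrix.conjTranspose_mul, hQ]
  have hQpq : Q = pm * qᴴ + q * pmᴴ := by
    rw [hqH, hq]
    conv_lhs => rw [← hsum, hP']
    simp only [Matrix.mul_assoc]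
  have hpq : pmᴴ * q = 0 := by
    have h1 : pmᴴ * (P * Q + Q * P) * pm = pmᴴ * Q * pm := by rw [hsum]
    have h2 : pmᴴ * (P * Q + Q * P) * pm = pmᴴ * Q * pm + pmᴴ * Q * pm := by
      rw [hP']
      calc pmᴴ * (pm * pmᴴ * Q + Q * (pm * pmᴴ)) * pm
          = (pmᴴ * pm) * (pmᴴ * Q * pm) + (pmᴴ * Q * pm) * (pmᴴ * pm) := by
            simp only [Matrix.mul_add, Matrix.add_mul, Matrix.mul_assoc]
        _ = _ := by rw [hpp]; simp
    rw [hq, ← Matrix.mul_assoc]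
    have h3 := h2.symm.trans h1
    simpa using h3
  have hqp : qᴴ * pm = 0 := by
    have := congrArg Matrix.conjTranspose hpq
    simpa [Matrix.conjTranspose_mul] using this
  set N : ℝ := ∑ i, ‖q i 0‖ ^ 2 with hN
  have hcs : ∀ x : ℍ[ℝ], star x * x = ((‖x‖ ^ 2 : ℝ) : ℍ[ℝ]) := fun x => by
    rw [Quaternion.star_mul_self, Quaternion.normSq_eq_norm_mul_self, sq]
  have hsc : ∀ x : ℍ[ℝ], x * star x = ((‖x‖ ^ 2 : ℝ) : ℍ[ℝ]) := fun x => by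
    rw [Quaternion.self_mul_star, Quaternion.normSq_eq_norm_mul_self, sq]
  have hcoe : ∀ f : Fin (n + 1) → ℝ, ∑ i, ((f i : ℝ) : ℍ[ℝ]) = ((∑ i, f i : ℝ) : ℍ[ℝ]) :=
    fun f => (map_sum (algebraMap ℝ ℍ[ℝ]) f Finset.univ).symm
  have hqq : qᴴ * q = N • 1 := by
    ext1 i j
    have h1 : i = 0 := Subsingleton.elim _ _
    have h2 : j = 0 := Subsingleton.elim _ _
    subst h1 h2
    simp only [Matrix.mul_apply, Matrix.conjTranspose_apply, hcs, hcoe, Matrix.smul_apply,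
      Matrix.one_apply_eq, ← hN]
    ext <;> simp
  have hQQ : Q * Q = N • P + q * qᴴ := by
    conv_lhs => rw [hQpq]
    calc (pm * qᴴ + q * pmᴴ) * (pm * qᴴ + q * pmᴴ)
        = pm * (qᴴ * pm) * qᴴ + pm * (qᴴ * q) * pmᴴ + q * (pmᴴ * pm) * qᴴ
            + q * (pmᴴ * q) * pmᴴ := by
          simp only [Matrix.mul_add, Matrix.add_mul, Matrix.mul_assoc]; abel
      _ = _ := by rw [hqp, hqq, hpp, hpq, hP']; simp
  have hp1 : ∑ i, ‖p i‖ ^ 2 = 1 := by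
    have : ((∑ i, ‖p i‖ ^ 2 : ℝ) : ℍ[ℝ]) = ((1 : ℝ) : ℍ[ℝ]) := by
      rw [← hcoe, Quaternion.coe_one, ← hp]; simp only [hcs]
    exact Quaternion.coe_injective this
  have hnorm : ∑ i, ∑ j, ‖Q i j‖ ^ 2 = 2 * N := by
    have h1 : ∀ i, ∑ j, ‖Q i j‖ ^ 2 = N * ‖p i‖ ^ 2 + ‖q i 0‖ ^ 2 := by
      intro i
      have e1 : (Q * Qᴴ) i i = (N • P + q * qᴴ) i i := by rw [hQ, hQQ]
      have e2 : (Q * Qᴴ) i i = ((∑ j, ‖Q i j‖ ^ 2 : ℝ) : ℍ[ℝ]) := by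
        simp only [Matrix.mul_apply, Matrix.conjTranspose_apply, hsc, hcoe]
      have e3 : (N • P + q * qᴴ) i i = ((N * ‖p i‖ ^ 2 + ‖q i 0‖ ^ 2 : ℝ) : ℍ[ℝ]) := by
        have : N • ((‖p i‖ ^ 2 : ℝ) : ℍ[ℝ]) = ((N * ‖p i‖ ^ 2 : ℝ) : ℍ[ℝ]) := by
          rw [Quaternion.smul_coe]
        rw [Quaternion.coe_add, ← this, ← hsc, ← hsc]
        simp [hP', hpm, Matrix.mul_apply]
      exact Quaternion.coe_injective (e2.symm.trans (e1.trans e3))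
    simp only [h1, Finset.sum_add_distrib, ← Finset.mul_sum, hp1, ← hN]
    ring
  have hN0 : N ≠ 0 := by
    intro h0
    apply hQ0
    rw [h0, mul_zero, Finset.sum_eq_zero_iff_of_nonneg (fun i _ => by positivity)] at hnorm
    ext1 i j
    have h2 := hnorm i (Finset.mem_univ i)
    rw [Finset.sum_eq_zero_iff_of_nonneg (fun i _ => by positivity)] at h2
    simpa using h2 j (Finset.mem_univ j)
  set h : ℝ := hNorm Q with hh
  have hNnn : 0 ≤ N := Finset.sum_nonneg fun i _ => by positivity
  have hh2 : h ^ 2 = 2 * N := by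
    rw [hh, hNorm, hnorm, Real.sq_sqrt (by positivity)]
  set s : ℂ := (h : ℂ) / (Real.sqrt 2 : ℂ) with hs
  have hs2 : s * s = N := by
    have h2 : (Real.sqrt 2 : ℂ) ^ 2 = 2 := by
      rw [← Complex.ofReal_pow, Real.sq_sqrt (by norm_num)]; simp
    rw [hs, div_mul_div_comm, ← sq, ← sq, h2, ← Complex.ofReal_pow, hh2]
    simp
  clear_value s
  have rpp : rhoMat pmᴴ * rhoMat pm = 1 := by rw [← rhoMat_mul, hpp, rhoMat_one]
  have rpq : rhoMat pmᴴ * rhoMat q = 0 := by rw [← rhoMat_mul, hpq, rhoMat_zero]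
  have rqp : rhoMat qᴴ * rhoMat pm = 0 := by rw [← rhoMat_mul, hqp, rhoMat_zero]
  have rqq : rhoMat qᴴ * rhoMat q = (N : ℂ) • 1 := by rw [← rhoMat_mul, hqq, rhoMat_real]
  set X := s • rhoMat pm + Complex.I • rhoMat q with hX
  set Y := s • rhoMat pmᴴ + Complex.I • rhoMat qᴴ with hY
  set X' := s • rhoMat pm - Complex.I • rhoMat q with hX'
  set Y' := s • rhoMat pmᴴ - Complex.I • rhoMat qᴴ with hY'
  have hA : tauH n (P, Q) = X * Y := by
    have e1 : rhoMat Q = rhoMat pm * rhoMat qᴴ + rhoMat q * rhoMat pmᴴ := by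
      rw [← rhoMat_mul, ← rhoMat_mul, ← rhoMat_add, ← hQpq]
    have e2 : rhoMat Q ^ 2 = (N : ℂ) • rhoMat P + rhoMat q * rhoMat qᴴ := by
      rw [sq, ← rhoMat_mul, hQQ, rhoMat_add, rhoMat_mul q]
      congr 1
      rw [show N • P = (N • (1 : HMat n)) * P by simp, rhoMat_mul, rhoMat_real]
      simp
    have e3 : rhoMat P = rhoMat pm * rhoMat pmᴴ := by rw [← rhoMat_mul, ← hP']
    have e4 : ((h : ℂ)) ^ 2 = 2 * N := by rw [← Complex.ofReal_pow, hh2]; simp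
    have e5 : Complex.I / (Real.sqrt 2 : ℂ) * (h : ℂ) = Complex.I * s := by rw [hs]; ring
    simp only [tauH, ← hh]
    rw [e2, e4, e5, e1, e3, hX, hY]
    simp only [Matrix.add_mul, Matrix.mul_add, Matrix.smul_mul, Matrix.mul_smul, smul_smul,
      hs2, Complex.I_mul_I, smul_add]
    module
  have hYX : Y * X = 0 := by
    rw [hX, hY]
    simp only [Matrix.add_mul, Matrix.mul_add, Matrix.smul_mul, Matrix.mul_smul,
      rpp, rpq, rqp, rqq]
    match_scalars
    linear_combination hs2 + (N : ℂ) * Complex.I_mul_I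
  have hY'X : Y' * X = (2 * N : ℂ) • 1 := by
    rw [hX, hY']
    simp only [Matrix.sub_mul, Matrix.mul_add, Matrix.smul_mul, Matrix.mul_smul,
      rpp, rpq, rqp, rqq]
    match_scalars
    linear_combination hs2 - (N : ℂ) * Complex.I_mul_I
  have hYX' : Y * X' = (2 * N : ℂ) • 1 := by
    rw [hX', hY]
    simp only [Matrix.add_mul, Matrix.mul_sub, Matrix.smul_mul, Matrix.mul_smul,
      rpp, rpq, rqp, rqq]
    match_scalars
    linear_combination hs2 - (N : ℂ) * Complex.I_mul_I
  refine ⟨?_, ?_, ?_⟩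
  · have hPH : Pᴴ = P := by
      rw [hP', Matrix.conjTranspose_mul, Matrix.conjTranspose_conjTranspose]
    have e1 : JJ n * rhoMat P = (rhoMat P)ᵀ * JJ n := by rw [JJ_mul_rhoMat, hPH]
    have e2 : JJ n * rhoMat Q = (rhoMat Q)ᵀ * JJ n := by rw [JJ_mul_rhoMat, hQ]
    have e3 : JJ n * rhoMat Q ^ 2 = (rhoMat Q ^ 2)ᵀ * JJ n := by
      rw [sq, ← Matrix.mul_assoc, e2, Matrix.mul_assoc, e2, Matrix.transpose_mul,
        Matrix.mul_assoc]
    simp only [tauH, Matrix.mul_add, Matrix.mul_sub, Matrix.mul_smul, e1, e2, e3,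
      Matrix.transpose_add, Matrix.transpose_sub, Matrix.transpose_smul, Matrix.add_mul,
      Matrix.sub_mul, Matrix.smul_mul]
  · refine rank_eq_two (by simp) X Y hA Y' X' ?_
    have : Y' * tauH n (P, Q) * X' = (2 * N : ℂ) • (2 * N : ℂ) • 1 := by
      rw [hA]
      calc Y' * (X * Y) * X' = (Y' * X) * (Y * X') := by simp only [Matrix.mul_assoc]
        _ = _ := by rw [hY'X, hYX']; simp
    rw [this, Matrix.isUnit_iff_isUnit_det, smul_smul, Matrix.det_smul]
    simp [hN0]
  · rw [hA, sq, Matrix.mul_assoc, ← Matrix.mul_assoc Y, hYX]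
    simp

/-! ## The forms `σ_S` and `σ` -/

/-- The order `z_0, …, z_{2n+1}, w_0, …, w_{2n+1}` of the `4n + 4` coordinates of `M(2,ℂ)^{n+1}`:
`(c, (i, a))` is the entry of `B_i` in row `a` and column `c`, and has position
`2i + a + (2n + 2)c`. -/
def coordIndex (n : ℕ) : Fin (4 * n + 4) ≃ Fin 2 × (Fin (n + 1) × Fin 2) :=
  (finCongr (by ring : 4 * n + 4 = 2 * ((n + 1) * 2))).trans
    (finProdFinEquiv.symm.trans (Equiv.prodCongr (Equiv.refl (Fin 2)) finProdFinEquiv.symm))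

/-- The coordinates `(z, w)` of `B`, in this order. -/
def coords (n : ℕ) : BSpace n →ₗ[ℂ] (Fin (4 * n + 4) → ℂ) where
  toFun B k := B (coordIndex n k).2.1 (coordIndex n k).2.2 (coordIndex n k).1
  map_add' _ _ := rfl
  map_smul' _ _ := rfl

/-- The form `dz_0 ∧ ⋯ ∧ dz_{2n+1} ∧ dw_0 ∧ ⋯ ∧ dw_{2n+1}`, that is the determinant of the
coordinates. -/
def volForm (n : ℕ) : BSpace n [⋀^Fin (4 * n + 4)]→ₗ[ℂ] ℂ :=
  (Matrix.detRowAlternating (n := Fin (4 * n + 4)) (R := ℂ)).compLinearMap (coords n)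

/-- The vector field `Z`: the components of `‖B‖² Z` are the complex conjugates of the partial
derivatives of `D`. -/
def Z (n : ℕ) (B : BSpace n) : BSpace n := fun i => Matrix.of fun a c =>
  ((∑ j, ∑ b, ∑ d, ‖B j b d‖ ^ 2 : ℝ) : ℂ)⁻¹ *
    (starRingEnd ℂ) (fderiv ℂ (D n) B (Pi.single i (Matrix.single a c 1)))

/-- `σ_S = (2√-1)^{-(2n+2)} i_Z (dz_0 ∧ ⋯ ∧ dw_{2n+1})`. -/
def sigmaS (n : ℕ) (B : BSpace n) : BSpace n [⋀^Fin (4 * n + 3)]→ₗ[ℂ] ℂ :=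
  (1 / (2 * Complex.I) ^ (2 * n + 2)) • (volForm n).curryLeft (Z n B)

/-- The vector field on `M(2,ℂ)^{n+1}` given by the element `Y` of the Lie algebra `sl(2,ℂ)`
through the right action of `SL(2,ℂ)`: the derivative of `B exp(tY)` at `t = 0`. It is tangent to
`Ẽ_S`. -/
def rightField {n : ℕ} (Y : Matrix (Fin 2) (Fin 2) ℂ) (B : BSpace n) : BSpace n :=
  fun i => B i * Y

/-- The three chosen elements of `su(2)`. -/
def Y1 : Matrix (Fin 2) (Fin 2) ℂ := !![Complex.I, 0; 0, -Complex.I]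

/-- See `Y1`. -/
def Y2 : Matrix (Fin 2) (Fin 2) ℂ := !![0, 1; -1, 0]

/-- See `Y1`. -/
def Y3 : Matrix (Fin 2) (Fin 2) ℂ := !![0, Complex.I; Complex.I, 0]

/-- The form `σ = i_{Y_3} i_{Y_2} i_{Y_1} σ_S` on `Ẽ_S`. -/
def sigma (n : ℕ) : DiffForm (tildeES n) (4 * n) := fun B =>
  ((((sigmaS n B).curryLeft (rightField Y1 B)).curryLeft (rightField Y2 B)).curryLeft
    (rightField Y3 B)).compLinearMap (tangentSpace ℂ (tildeES n) (B : BSpace n)).subtype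

end HopfForm

end

noncomputable section

namespace HopfForm

/-! ## Generalities -/

/-! Write `B` as the (2n+2)×2 matrix M with columns z and w. Then β(B) = -M J ᵗM 𝕁 and ᵗM 𝕁 M = D(B)
J. Hence β is constant on the orbits of SL(2,ℂ) acting by right multiplication. Conversely, its
fibres in Ẽ_S are single orbits (`exists_eq_act_of_beta_eq`) and the kernel of dβ is spanned by Y₁,
Y₂, Y₃ (`eq_rightField_of_dbeta_eq_zero`). So σ_ℍ can only be σ evaluated on lifts of the point and
of the tangent vectors, and the task is to show that the lift does not matter.

Three choices have to be eliminated. The field Z enters only through dD(Z) = 1: contracting the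
volume form with any normalized vector E gives the same form on ker dD, since 4n+4 vectors of that
hyperplane are dependent (`omega_congr_left`). This also repairs the non-holomorphy of Z, because a
rescaled constant vector serves as well. Vertical changes of the tangent vectors are absorbed by the
contractions with the Y_i (`omega_congr_dbeta`). Moving along the fibre changes nothing, because the
volume form is SL(2,ℂ)-invariant and the adjoint action on sl(2,ℂ) has determinant 1
(`omega_act_one`). `omega_eq_of_dbeta_eq` combines the three.

Lifts exist holomorphically. The matrix 𝕁A is antisymmetric of rank 2, and where its entry (k,l) is
nonzero the columns k and l of A, one of them rescaled, form a rational section of β (`colSection`).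
This makes β and its tangent maps surjective, which gives uniqueness, and it makes σ_ℍ holomorphic.
Nonvanishing is the count 4n+4 = 1 + 3 + 4n. Invariance holds because ρ(g) acts on lifts from the
left, is symplectic with determinant of square 1, and commutes with the right action.

For the canonical bundle, 𝒢 is the kernel of the complex linear extension of dτ
(`mem_polarization_iff`). If that extension is onto the tangent space of Ẽ_ℍ, forms annihilated by 𝒢
are top-degree forms on that tangent space, hence multiples of the pullback of σ_ℍ; a local
holomorphic frame shows that the coefficient is holomorphic exactly when the section is
(`exists_isHolomorphicTrivialization`). For τ_ℍ the surjectivity follows by differentiating an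
explicit inverse. That this inverse maps Ẽ_ℍ into E_ℍ rests on τ_ℍ being onto (`exists_tauH_eq`):
each A has a β-preimage with orthogonal columns of equal norm, whose quaternionic real and imaginary
parts yield the pair (P,Q). -/

theorem hasFDerivAt_quadratic {𝕜 V W : Type*} [NontriviallyNormedField 𝕜] [CompleteSpace 𝕜]
    [NormedAddCommGroup V] [NormedSpace 𝕜 V] [FiniteDimensional 𝕜 V]
    [NormedAddCommGroup W] [NormedSpace 𝕜 W] (b : V →ₗ[𝕜] V →ₗ[𝕜] W) (x : V) :
    HasFDerivAt (fun y => b y y) (LinearMap.toContinuousLinearMap (b x + b.flip x)) x := by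
  have h := (LinearMap.toContinuousLinearMap
    ((LinearMap.toContinuousLinearMap (𝕜 := 𝕜) (E := V) (F' := W)).toLinearMap ∘ₗ b)
    ).hasFDerivAt_of_bilinear (hasFDerivAt_id x) (hasFDerivAt_id x)
  refine h.congr_fderiv ?_
  ext v
  simp

/-- An alternating form killed by W descends to the quotient by W. Used with W the vertical space of
β, and with W the polarization. -/
theorem _root_.AlternatingMap.eq_of_sub_mem {R V N ι : Type*} [Ring R] [AddCommGroup V]
    [Module R V] [AddCommGroup N] [Module R N] [Fintype ι] (f : V [⋀^ι]→ₗ[R] N)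
    (W : Submodule R V) (hf : ∀ v : ι → V, (∃ i, v i ∈ W) → f v = 0) {u v : ι → V}
    (h : ∀ i, u i - v i ∈ W) : f u = f v := by
  classical
  have h1 := f.map_add_univ v (u - v)
  rw [add_sub_cancel] at h1
  -- In the multilinear expansion of f(v + (u - v)) only the term with every entry taken from v has
  -- no entry in W.
  rw [h1, Finset.sum_eq_single Finset.univ]
  · simp
  · intro s _ hs
    obtain ⟨i, hi⟩ : ∃ i, i ∉ s := by
      by_contra! hc
      exact hs (Finset.eq_univ_iff_forall.2 hc)
    exact hf _ ⟨i, by simpa [hi] using h i⟩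
  · simp

/-! ## The matrix of an element of `M(2,ℂ)^{n+1}` -/

variable {n : ℕ}

/-- The `(2n+2) × 2` matrix with columns `z` and `w`. -/
def mat (n : ℕ) : BSpace n ≃ₗ[ℂ] Matrix (Fin (n + 1) × Fin 2) (Fin 2) ℂ where
  toFun B := Matrix.of fun k c => B k.1 k.2 c
  invFun M := fun i => Matrix.of fun a c => M (i, a) c
  map_add' _ _ := rfl
  map_smul' _ _ := rfl
  left_inv _ := rfl
  right_inv _ := rfl

@[simp] theorem mat_apply (B : BSpace n) (k : Fin (n + 1) × Fin 2) (c : Fin 2) :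
    mat n B k c = B k.1 k.2 c := rfl

/-- The linear map `M ↦ H M G`. -/
def act (H : CMat n) (G : Matrix (Fin 2) (Fin 2) ℂ) : BSpace n →ₗ[ℂ] BSpace n where
  toFun B := (mat n).symm (H * mat n B * G)
  map_add' B C := by simp [Matrix.mul_add, Matrix.add_mul]
  map_smul' c B := by simp

@[simp] theorem mat_act (H : CMat n) (G : Matrix (Fin 2) (Fin 2) ℂ) (B : BSpace n) :
    mat n (act H G B) = H * mat n B * G := by simp [act]

theorem mat_rightField (Y : Matrix (Fin 2) (Fin 2) ℂ) (B : BSpace n) :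
    mat n (rightField Y B) = mat n B * Y := by
  ext k c
  simp [rightField, Matrix.mul_apply]

theorem coords_apply (B : BSpace n) (k : Fin (4 * n + 4)) :
    coords n B k = mat n B (coordIndex n k).2 (coordIndex n k).1 := rfl

theorem coords_act (H : CMat n) (G : Matrix (Fin 2) (Fin 2) ℂ) (B : BSpace n) :
    coords n (act H G B) =
      ((Gᵀ ⊗ₖ H).submatrix (coordIndex n) (coordIndex n)) *ᵥ coords n B := by
  ext k
  simp only [Matrix.mulVec, dotProduct, coords_apply, Matrix.submatrix_apply, mat_act]
  rw [(coordIndex n).sum_comp (fun p => (Gᵀ ⊗ₖ H) (coordIndex n k) p * mat n B p.2 p.1),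
    Fintype.sum_prod_type, Matrix.mul_apply]
  refine Finset.sum_congr rfl fun c _ => ?_
  rw [Matrix.mul_apply, Finset.sum_mul]
  refine Finset.sum_congr rfl fun l _ => ?_
  simp only [Matrix.kroneckerMap_apply, Matrix.transpose_apply]
  ring

/-- In coordinates M ↦ H M G is the Kronecker product of ᵗG and H, of sizes 2 and 2n+2, which
explains the two exponents. -/
theorem volForm_act (H : CMat n) (G : Matrix (Fin 2) (Fin 2) ℂ)
    (v : Fin (4 * n + 4) → BSpace n) :
    volForm n (fun i => act H G (v i)) = G.det ^ (2 * n + 2) * H.det ^ 2 * volForm n v := by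
  have h : ∀ v, volForm n v = (Matrix.of fun i => coords n (v i)).det := fun _ => rfl
  have h1 : (Matrix.of fun i => coords n (act H G (v i))) =
      (Matrix.of fun i => coords n (v i)) *
        ((Gᵀ ⊗ₖ H).submatrix (coordIndex n) (coordIndex n))ᵀ := by
    ext i k
    simp only [Matrix.of_apply, coords_act, Matrix.mul_apply, Matrix.mulVec, dotProduct,
      Matrix.transpose_apply]
    exact Finset.sum_congr rfl fun _ _ => mul_comm _ _
  rw [h, h, h1, Matrix.det_mul, Matrix.det_transpose, Matrix.det_submatrix_equiv_self,
    Matrix.det_kronecker, Matrix.det_transpose]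
  simp only [Fintype.card_prod, Fintype.card_fin]
  ring

/-! ### Dimension of the ambient space and nondegeneracy of the volume form -/

theorem coords_injective : Function.Injective (coords n) := by
  intro B C h
  ext i a c
  have := congrFun h ((coordIndex n).symm (c, (i, a)))
  simpa [coords_apply] using this

instance : FiniteDimensional ℂ (BSpace n) :=
  FiniteDimensional.of_injective (coords n) coords_injective

theorem finrank_bSpace : Module.finrank ℂ (BSpace n) = 4 * n + 4 := by
  rw [LinearEquiv.finrank_eq (mat n), Module.finrank_matrix]
  simp
  ring

theorem volForm_ne_zero : volForm n ≠ 0 := by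
  have hs : Function.Surjective (coords n) := by
    refine ((coords n).injective_iff_surjective_of_finrank_eq_finrank ?_).1 coords_injective
    rw [finrank_bSpace]; simp
  choose v hv using fun i : Fin (4 * n + 4) => hs (Pi.single i 1)
  intro h
  have h1 : volForm n v = (Matrix.of fun i => coords n (v i)).det := rfl
  have h2 : (Matrix.of fun i => coords n (v i)) = 1 := by
    ext i j
    simp [hv, Matrix.one_apply, Pi.single_apply, eq_comm]
  rw [h, h2] at h1
  simp at h1

theorem volForm_apply_ne_zero {v : Fin (4 * n + 4) → BSpace n}
    (hv : ⊤ ≤ Submodule.span ℂ (Set.range v)) : volForm n v ≠ 0 := by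
  let b := basisOfTopLeSpanOfCardEqFinrank v hv (by simp [finrank_bSpace])
  have hb : ⇑b = v := coe_basisOfTopLeSpanOfCardEqFinrank v hv _
  rw [← hb]
  exact ((volForm n).map_basis_ne_zero_iff b).2 volForm_ne_zero

/-! ## The function `D` and its polar form -/

/-- The bilinear form with `D(B) = detForm B B`. -/
def detForm (n : ℕ) : BSpace n →ₗ[ℂ] BSpace n →ₗ[ℂ] ℂ :=
  LinearMap.mk₂ ℂ (fun B V => ∑ i, (B i 0 0 * V i 1 1 - B i 0 1 * V i 1 0))
    (fun B C V => by
      rw [← Finset.sum_add_distrib]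
      exact Finset.sum_congr rfl fun i _ => by simp; ring)
    (fun c B V => by
      rw [smul_eq_mul, Finset.mul_sum]
      exact Finset.sum_congr rfl fun i _ => by simp; ring)
    (fun B C V => by
      rw [← Finset.sum_add_distrib]
      exact Finset.sum_congr rfl fun i _ => by simp; ring)
    (fun c B V => by
      rw [smul_eq_mul, Finset.mul_sum]
      exact Finset.sum_congr rfl fun i _ => by simp; ring)

theorem D_eq (B : BSpace n) : D n B = detForm n B B := by
  simp [D, detForm, Matrix.det_fin_two]

/-- The differential of `D` at `B`. -/
def polar (B : BSpace n) : BSpace n →ₗ[ℂ] ℂ := detForm n B + (detForm n).flip B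

theorem polar_apply (B V : BSpace n) : polar B V = detForm n B V + detForm n V B := rfl

theorem D_add (B V : BSpace n) : D n (B + V) = D n B + polar B V + D n V := by
  simp only [D_eq, polar_apply, map_add, LinearMap.add_apply]
  ring

theorem D_smul (c : ℂ) (B : BSpace n) : D n (c • B) = c ^ 2 * D n B := by
  simp only [D_eq, map_smul, LinearMap.smul_apply, smul_eq_mul]
  ring

theorem hasFDerivAt_D (B : BSpace n) :
    HasFDerivAt (D n) (LinearMap.toContinuousLinearMap (polar B)) B :=
  (hasFDerivAt_quadratic (detForm n) B).congr_of_eventuallyEq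
    (Filter.Eventually.of_forall D_eq)

/-- The form 𝕁 restricted to the two columns is an antisymmetric 2×2 matrix, so a multiple of J; its
coefficient is the symplectic product of z and w. Thus D(B) = 0 says that the columns span an
isotropic space. -/
theorem transpose_mat_mul_JJ_mul_mat (B : BSpace n) :
    (mat n B)ᵀ * JJ n * mat n B = D n B • J := by
  have h0 : D n B = ∑ i, (B i 0 0 * B i 1 1 - B i 0 1 * B i 1 0) := by
    simp [D, Matrix.det_fin_two]
  rw [h0]
  ext a b
  fin_cases a <;> fin_cases b <;>
    simp [Matrix.mul_apply, Fintype.sum_prod_type, JJ_apply, Fin.sum_univ_two, mul_ite, J]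
  · exact Finset.sum_eq_zero fun i _ => by ring
  · rw [← Finset.sum_sub_distrib]
    exact Finset.sum_congr rfl fun i _ => by ring
  · rw [← Finset.sum_sub_distrib]
    exact Finset.sum_congr rfl fun i _ => by ring
  · exact Finset.sum_eq_zero fun i _ => by ring

theorem transpose_mul_J_mul (G : Matrix (Fin 2) (Fin 2) ℂ) : Gᵀ * J * G = G.det • J := by
  ext a b
  fin_cases a <;> fin_cases b <;>
    simp [Matrix.mul_apply, Fin.sum_univ_two, J, Matrix.det_fin_two] <;> ring

theorem mul_J_mul_transpose (G : Matrix (Fin 2) (Fin 2) ℂ) : G * J * Gᵀ = G.det • J := by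
  have := transpose_mul_J_mul Gᵀ
  rwa [Matrix.transpose_transpose, Matrix.det_transpose] at this

theorem D_act {H : CMat n} (hH : Hᵀ * JJ n * H = JJ n) (G : Matrix (Fin 2) (Fin 2) ℂ)
    (B : BSpace n) : D n (act H G B) = G.det * D n B := by
  have h1 := transpose_mat_mul_JJ_mul_mat (act H G B)
  have h2 : (mat n (act H G B))ᵀ * JJ n * mat n (act H G B) = (G.det * D n B) • J := by
    calc (mat n (act H G B))ᵀ * JJ n * mat n (act H G B)
        = Gᵀ * ((mat n B)ᵀ * (Hᵀ * JJ n * H) * mat n B) * G := by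
          simp only [mat_act, Matrix.transpose_mul, Matrix.mul_assoc]
      _ = (G.det * D n B) • J := by
          rw [hH, transpose_mat_mul_JJ_mul_mat]
          simp [transpose_mul_J_mul, smul_smul, mul_comm]
  have h3 := congrFun (congrFun (h1.symm.trans h2) 0) 1
  simpa [J] using h3

/-- The polar form is the cross term of D(B + V), so it inherits the invariance of D. -/
theorem polar_act {H : CMat n} (hH : Hᵀ * JJ n * H = JJ n) {G : Matrix (Fin 2) (Fin 2) ℂ}
    (hG : G.det = 1) (B V : BSpace n) : polar (act H G B) (act H G V) = polar B V := by
  have h1 := D_add B V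
  have h2 := D_add (act H G B) (act H G V)
  rw [← map_add, D_act hH, D_act hH, D_act hH, hG] at h2
  linear_combination h1 - h2

/-- The infinitesimal form of D(BG) = det G · D(B): the value is tr Y · D(B), without any condition
on B. -/
theorem polar_rightField (B : BSpace n) {Y : Matrix (Fin 2) (Fin 2) ℂ} (hY : Y.trace = 0) :
    polar B (rightField Y B) = 0 := by
  rw [Matrix.trace_fin_two] at hY
  simp only [polar_apply, detForm, LinearMap.mk₂_apply, rightField, Matrix.mul_apply,
    Fin.sum_univ_two]
  rw [← Finset.sum_add_distrib]
  refine Finset.sum_eq_zero fun i _ => ?_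
  linear_combination (B i 0 0 * B i 1 1 - B i 0 1 * B i 1 0) * hY

theorem J_mul_J : J * J = -1 := by
  ext i j
  fin_cases i <;> fin_cases j <;> simp [J]

theorem mul_JJ_cancel {ι : Type*} {X Y : Matrix ι (Fin (n + 1) × Fin 2) ℂ}
    (h : X * JJ n = Y * JJ n) : X = Y := by
  have := congrArg (· * JJ n) h
  simpa [Matrix.mul_assoc, JJ_mul_JJ] using this

/-! ## The map `β` -/

/-- The bilinear map with `β(B) = betaForm B B`. -/
def betaForm (n : ℕ) : BSpace n →ₗ[ℂ] BSpace n →ₗ[ℂ] CMat n :=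
  LinearMap.mk₂ ℂ (fun B V => -(mat n B * J * (mat n V)ᵀ * JJ n))
    (fun B C V => by simp [Matrix.add_mul]; abel)
    (fun c B V => by simp)
    (fun B C V => by simp [Matrix.mul_add, Matrix.add_mul]; abel)
    (fun c B V => by simp)

theorem betaForm_apply (B V : BSpace n) :
    betaForm n B V = -(mat n B * J * (mat n V)ᵀ * JJ n) := rfl

theorem beta_eq (B : BSpace n) : beta n B = betaForm n B B := by
  ext ⟨i, a⟩ ⟨j, b⟩
  simp [beta, betaForm_apply, Matrix.mul_apply, Fintype.sum_prod_type, JJ_apply,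
    Fin.sum_univ_two, mul_ite]

/-- The differential of `β` at `B`. -/
def dbeta (B : BSpace n) : BSpace n →ₗ[ℂ] CMat n := betaForm n B + (betaForm n).flip B

theorem dbeta_apply (B V : BSpace n) : dbeta B V = betaForm n B V + betaForm n V B := rfl

theorem beta_add (B V : BSpace n) : beta n (B + V) = beta n B + dbeta B V + beta n V := by
  simp only [beta_eq, dbeta_apply, map_add, LinearMap.add_apply]
  abel

theorem hasFDerivAt_beta (B : BSpace n) :
    HasFDerivAt (beta n) (LinearMap.toContinuousLinearMap (dbeta B)) B :=
  (hasFDerivAt_quadratic (betaForm n) B).congr_of_eventuallyEq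
    (Filter.Eventually.of_forall beta_eq)

theorem beta_act_one (G : Matrix (Fin 2) (Fin 2) ℂ) (B : BSpace n) :
    beta n (act 1 G B) = G.det • beta n B := by
  simp only [beta_eq, betaForm_apply, mat_act, Matrix.one_mul, Matrix.transpose_mul]
  rw [show mat n B * G * J * (Gᵀ * (mat n B)ᵀ) * JJ n =
    mat n B * (G * J * Gᵀ) * (mat n B)ᵀ * JJ n by simp only [Matrix.mul_assoc],
    mul_J_mul_transpose]
  simp

/-- This only uses 𝕁 ρ(g*) = ᵗρ(g) 𝕁, so it holds for every quaternionic matrix g, unitary or not.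
-/
theorem beta_act_rhoMat (g : HMat n) (B : BSpace n) :
    beta n (act (rhoMat g) 1 B) = spAct n g (beta n B) := by
  have h := JJ_mul_rhoMat gᴴ
  rw [Matrix.conjTranspose_conjTranspose] at h
  simp only [beta_eq, betaForm_apply, mat_act, Matrix.mul_one, Matrix.transpose_mul, spAct,
    Matrix.mul_neg, Matrix.neg_mul, Matrix.mul_assoc]
  rw [← h, Matrix.star_eq_conjTranspose]

theorem dbeta_act_one {G : Matrix (Fin 2) (Fin 2) ℂ} (hG : G.det = 1) (B V : BSpace n) :
    dbeta (act 1 G B) (act 1 G V) = dbeta B V := by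
  have h1 := beta_add B V
  have h2 := beta_add (act 1 G B) (act 1 G V)
  rw [← map_add, beta_act_one, beta_act_one, beta_act_one, hG, one_smul, one_smul, one_smul,
    h1] at h2
  simpa using h2.symm

theorem spAct_add (g : HMat n) (A A' : CMat n) :
    spAct n g (A + A') = spAct n g A + spAct n g A' := by
  simp [spAct, Matrix.mul_add, Matrix.add_mul]

theorem dbeta_act_rhoMat (g : HMat n) (B V : BSpace n) :
    dbeta (act (rhoMat g) 1 B) (act (rhoMat g) 1 V) = spAct n g (dbeta B V) := by
  have h1 := beta_add B V
  have h2 := beta_add (act (rhoMat g) 1 B) (act (rhoMat g) 1 V)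
  rw [← map_add, beta_act_rhoMat, beta_act_rhoMat, beta_act_rhoMat, h1, spAct_add,
    spAct_add] at h2
  simpa using h2.symm

/-- Cramer's rule on the rows k and l of a nonvanishing minor. The left inverse is the form in which
z ∧ w ≠ 0 enters the matrix computations below. -/
theorem exists_mul_mat_eq_one {B : BSpace n} (hB : B ∈ tildeES n) :
    ∃ L : Matrix (Fin 2) (Fin (n + 1) × Fin 2) ℂ, L * mat n B = 1 := by
  obtain ⟨⟨k, l, hkl⟩, -⟩ := hB
  refine ⟨(zVec B k * wVec B l - zVec B l * wVec B k)⁻¹ • Matrix.of fun c i =>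
    (if i = k then ![wVec B l, -zVec B l] c else 0)
      + (if i = l then ![-wVec B k, zVec B k] c else 0), ?_⟩
  rw [Matrix.smul_mul, inv_smul_eq_iff₀ hkl]
  ext a b
  have hs : ∀ f : Fin (n + 1) × Fin 2 → ℂ, ∀ u v : ℂ,
      ∑ i, ((if i = k then u else 0) + (if i = l then v else 0)) * f i = u * f k + v * f l := by
    intro f u v
    simp [add_mul, ite_mul, Finset.sum_add_distrib]
  simp only [Matrix.mul_apply, Matrix.of_apply]
  rw [hs]
  fin_cases a <;> fin_cases b <;> simp [zVec, wVec] <;> ring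

/-- The hypothesis reads M J ᵗV + V J ᵗM = 0. Multiplying by ᵗL on the right solves for V = M Y;
sandwiching between L and ᵗL then gives J ᵗY + Y J = 0, which is tr Y = 0. -/
theorem eq_rightField_of_dbeta_eq_zero {B V : BSpace n} (hB : B ∈ tildeES n)
    (h : dbeta B V = 0) : ∃ Y : Matrix (Fin 2) (Fin 2) ℂ, Y.trace = 0 ∧ V = rightField Y B := by
  obtain ⟨L, hL⟩ := exists_mul_mat_eq_one hB
  have hL' : (mat n B)ᵀ * Lᵀ = 1 := by rw [← Matrix.transpose_mul, hL, Matrix.transpose_one]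
  have h1 : mat n B * J * (mat n V)ᵀ + mat n V * J * (mat n B)ᵀ = 0 := by
    apply mul_JJ_cancel
    rw [Matrix.zero_mul, Matrix.add_mul, ← neg_eq_zero, neg_add]
    exact h
  have h2 : mat n V * J = -(mat n B * (J * (mat n V)ᵀ * Lᵀ)) := by
    have := congrArg (· * Lᵀ) h1
    simp only [Matrix.add_mul, Matrix.mul_assoc, hL', Matrix.mul_one, Matrix.zero_mul] at this
    simpa only [Matrix.mul_assoc] using eq_neg_of_add_eq_zero_right this
  have h3 : mat n V = mat n B * (J * (mat n V)ᵀ * Lᵀ * J) := by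
    have := congrArg (fun X => -(X * J)) h2
    simpa [Matrix.mul_assoc, J_mul_J] using this
  set Y := J * (mat n V)ᵀ * Lᵀ * J with hY
  refine ⟨Y, ?_, ?_⟩
  · have h4 : J * Yᵀ + Y * J = 0 := by
      have := congrArg (fun X => L * X * Lᵀ) h1
      simp only [Matrix.mul_add, Matrix.add_mul, Matrix.mul_zero, Matrix.zero_mul] at this
      rw [← this]
      have e1 : L * (mat n B * J * (mat n V)ᵀ) * Lᵀ = (L * mat n B) * J * (L * mat n V)ᵀ := by
        simp only [Matrix.transpose_mul, Matrix.mul_assoc]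
      have e2 : L * (mat n V * J * (mat n B)ᵀ) * Lᵀ = (L * mat n V) * J * ((mat n B)ᵀ * Lᵀ) := by
        simp only [Matrix.mul_assoc]
      have e3 : L * mat n V = Y := by rw [h3, ← Matrix.mul_assoc, hL, Matrix.one_mul]
      rw [e1, e2, hL, hL', e3]
      simp
    have := congrFun (congrFun h4 0) 1
    rw [Matrix.trace_fin_two]
    simpa [J, Matrix.mul_apply, Matrix.vecMul, dotProduct, Fin.sum_univ_two, add_comm] using this
  · apply (mat n).injective
    rw [mat_rightField, ← h3]

/-- The global version of the previous argument: M J ᵗM = M' J ᵗM' gives M' = M G on multiplying by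
ᵗL', and sandwiching between L and ᵗL gives G J ᵗG = J, that is det G = 1. -/
theorem exists_eq_act_of_beta_eq {B B' : BSpace n} (hB : B ∈ tildeES n) (hB' : B' ∈ tildeES n)
    (h : beta n B = beta n B') :
    ∃ G : Matrix (Fin 2) (Fin 2) ℂ, G.det = 1 ∧ B' = act 1 G B := by
  obtain ⟨L, hL⟩ := exists_mul_mat_eq_one hB
  obtain ⟨L', hL'⟩ := exists_mul_mat_eq_one hB'
  have hLT : (mat n B)ᵀ * Lᵀ = 1 := by rw [← Matrix.transpose_mul, hL, Matrix.transpose_one]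
  have hLT' : (mat n B')ᵀ * L'ᵀ = 1 := by
    rw [← Matrix.transpose_mul, hL', Matrix.transpose_one]
  have h1 : mat n B * J * (mat n B)ᵀ = mat n B' * J * (mat n B')ᵀ := by
    apply mul_JJ_cancel
    rw [beta_eq, beta_eq] at h
    exact neg_injective h
  have h2 : mat n B' = mat n B * -(J * (mat n B)ᵀ * L'ᵀ * J) := by
    have := congrArg (fun X => -(X * L'ᵀ * J)) h1
    simp only [Matrix.mul_assoc, hLT', Matrix.mul_one] at this

    simpa [Matrix.mul_assoc, J_mul_J] using this.symm
  set G := -(J * (mat n B)ᵀ * L'ᵀ * J) with hG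
  have h3 : B' = act 1 G B := by
    apply (mat n).injective
    rw [mat_act, Matrix.one_mul, ← h2]
  refine ⟨G, ?_, h3⟩
  have h4 : G * J * Gᵀ = J := by
    have := congrArg (fun X => L * X * Lᵀ) h1
    have e1 : L * (mat n B * J * (mat n B)ᵀ) * Lᵀ = (L * mat n B) * J * ((mat n B)ᵀ * Lᵀ) := by
      simp only [Matrix.mul_assoc]
    have e2 : L * (mat n B' * J * (mat n B')ᵀ) * Lᵀ = (L * mat n B') * J * (L * mat n B')ᵀ := by
      simp only [Matrix.transpose_mul, Matrix.mul_assoc]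
    have e3 : L * mat n B' = G := by rw [h2, ← Matrix.mul_assoc, hL, Matrix.one_mul]
    rw [e1, e2, hL, hLT, e3] at this
    simpa using this.symm
  rw [mul_J_mul_transpose] at h4
  have := congrFun (congrFun h4 0) 1
  simpa [J] using this

/-! ## The contracted volume form -/

/-- The vectors `E, X₁, X₂, X₃, u_1, …, u_{4n}`. -/
def frame (E X₁ X₂ X₃ : BSpace n) (u : Fin (4 * n) → BSpace n) : Fin (4 * n + 4) → BSpace n :=
  Matrix.vecCons E (Matrix.vecCons X₁ (Matrix.vecCons X₂ (Matrix.vecCons X₃ u)))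

theorem map_frame (T : BSpace n → BSpace n) (E X₁ X₂ X₃ : BSpace n) (u : Fin (4 * n) → BSpace n) :
    (fun i => T (frame E X₁ X₂ X₃ u i)) =
      frame (T E) (T X₁) (T X₂) (T X₃) (fun i => T (u i)) := by
  funext i
  refine Fin.cases rfl (fun i => ?_) i
  refine Fin.cases rfl (fun i => ?_) i
  refine Fin.cases rfl (fun i => ?_) i
  refine Fin.cases rfl (fun i => ?_) i
  rfl

theorem frame_mem {W : Set (BSpace n)} {E X₁ X₂ X₃ : BSpace n} {u : Fin (4 * n) → BSpace n}
    (hE : E ∈ W) (h₁ : X₁ ∈ W) (h₂ : X₂ ∈ W) (h₃ : X₃ ∈ W) (hu : ∀ i, u i ∈ W)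
    (i : Fin (4 * n + 4)) : frame E X₁ X₂ X₃ u i ∈ W := by
  refine Fin.cases hE (fun i => ?_) i
  refine Fin.cases h₁ (fun i => ?_) i
  refine Fin.cases h₂ (fun i => ?_) i
  refine Fin.cases h₃ (fun i => ?_) i
  exact hu i

/-- The form `(2√-1)^{-(2n+2)} i_{Y₃} i_{Y₂} i_{Y₁} i_E (dz_0 ∧ ⋯ ∧ dw_{2n+1})` at `B`. -/
def omega (E B : BSpace n) : BSpace n [⋀^Fin (4 * n)]→ₗ[ℂ] ℂ :=
  (1 / (2 * Complex.I) ^ (2 * n + 2) : ℂ) •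
    ((((volForm n).curryLeft E).curryLeft (rightField Y1 B)).curryLeft (rightField Y2 B)).curryLeft
      (rightField Y3 B)

theorem omega_apply (E B : BSpace n) (u : Fin (4 * n) → BSpace n) :
    omega E B u = 1 / (2 * Complex.I) ^ (2 * n + 2) *
      volForm n (frame E (rightField Y1 B) (rightField Y2 B) (rightField Y3 B) u) := rfl

theorem trace_Y1 : Y1.trace = 0 := by simp [Y1, Matrix.trace_fin_two]
theorem trace_Y2 : Y2.trace = 0 := by simp [Y2, Matrix.trace_fin_two]
theorem trace_Y3 : Y3.trace = 0 := by simp [Y3, Matrix.trace_fin_two]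

theorem finrank_ker_polar {E B : BSpace n} (hE : polar B E = 1) :
    Module.finrank ℂ (LinearMap.ker (polar B)) = 4 * n + 3 := by
  have h := LinearMap.finrank_range_add_finrank_ker (polar B)
  have h1 : LinearMap.range (polar B) = ⊤ := by
    refine LinearMap.range_eq_top.2 fun c => ⟨c • E, ?_⟩
    rw [map_smul, hE, smul_eq_mul, mul_one]
  rw [h1, finrank_top, Module.finrank_self, finrank_bSpace] at h
  omega

/-- The normalized vector E serves only to show that dD ≠ 0, so that its kernel has dimension 4n+3,
one less than the number of vectors. -/
theorem volForm_eq_zero_of_mem_ker {E B : BSpace n} (hE : polar B E = 1)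
    {v : Fin (4 * n + 4) → BSpace n} (hv : ∀ i, v i ∈ LinearMap.ker (polar B)) :
    volForm n v = 0 := by
  apply AlternatingMap.map_linearDependent
  intro h
  have h1 : LinearIndependent ℂ (fun i => (⟨v i, hv i⟩ : LinearMap.ker (polar B))) :=
    LinearIndependent.of_comp (LinearMap.ker (polar B)).subtype h
  have h2 := h1.fintype_card_le_finrank
  rw [finrank_ker_polar hE, Fintype.card_fin] at h2
  exact Nat.not_succ_le_self _ h2

/-- E - E' lies in the hyperplane ker dD, as do the Y_i and the u_i. This is what allows the
non-holomorphic field Z to be traded for a vector depending holomorphically on the point. -/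
theorem omega_congr_left {E E' B : BSpace n} (hE : polar B E = 1) (hE' : polar B E' = 1)
    {u : Fin (4 * n) → BSpace n} (hu : ∀ i, polar B (u i) = 0) :
    omega E B u = omega E' B u := by
  rw [omega_apply, omega_apply]
  congr 1
  rw [← sub_eq_zero]
  have h0 : volForm n (frame (E - E') (rightField Y1 B) (rightField Y2 B) (rightField Y3 B) u)
      = 0 := by
    refine volForm_eq_zero_of_mem_ker hE fun i => ?_
    refine frame_mem (W := LinearMap.ker (polar B)) ?_ ?_ ?_ ?_ ?_ i
    · simp [hE, hE']
    · exact polar_rightField B trace_Y1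
    · exact polar_rightField B trace_Y2
    · exact polar_rightField B trace_Y3
    · exact hu
  have h1 := (volForm n).map_vecCons_add (Matrix.vecCons (rightField Y1 B)
    (Matrix.vecCons (rightField Y2 B) (Matrix.vecCons (rightField Y3 B) u))) (E - E') E'
  rw [sub_add_cancel] at h1
  rw [frame, frame, h1]
  exact (add_sub_cancel_right _ _).trans h0

/-- The tangent space of the fibre of `β`. -/
def vertical (B : BSpace n) : Submodule ℂ (BSpace n) :=
  Submodule.span ℂ {rightField Y1 B, rightField Y2 B, rightField Y3 B}

/-- The coefficients are the coordinates of Y in the basis Y₁, Y₂, Y₃ of sl(2,ℂ); they reappear as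
the matrix of the adjoint action in `volForm_frame_conj`. -/
theorem rightField_eq (B : BSpace n) {Y : Matrix (Fin 2) (Fin 2) ℂ} (hY : Y.trace = 0) :
    rightField Y B = (-Complex.I * Y 0 0) • rightField Y1 B +
      ((Y 0 1 - Y 1 0) / 2) • rightField Y2 B +
      (-Complex.I * (Y 0 1 + Y 1 0) / 2) • rightField Y3 B := by
  have h : (-Complex.I * Y 0 0) • Y1 + ((Y 0 1 - Y 1 0) / 2) • Y2 +
      (-Complex.I * (Y 0 1 + Y 1 0) / 2) • Y3 = Y := by
    rw [Matrix.trace_fin_two] at hY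
    ext i j
    fin_cases i <;> fin_cases j <;> simp [Y1, Y2, Y3]
    · linear_combination (-Y 0 0) * Complex.I_mul_I
    · linear_combination (-(Y 0 1 + Y 1 0) / 2) * Complex.I_mul_I
    · linear_combination (-(Y 0 1 + Y 1 0) / 2) * Complex.I_mul_I
    · linear_combination (Y 0 0) * Complex.I_mul_I - hY
  conv_lhs => rw [← h]
  funext i
  simp [rightField, Matrix.mul_add]

theorem rightField_mem_vertical (B : BSpace n) {Y : Matrix (Fin 2) (Fin 2) ℂ} (hY : Y.trace = 0) :
    rightField Y B ∈ vertical B := by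
  rw [vertical, Submodule.mem_span_triple]
  exact ⟨_, _, _, (rightField_eq B hY).symm⟩

theorem vertical_le_ker (B : BSpace n) : vertical B ≤ LinearMap.ker (polar B) := by
  rw [vertical, Submodule.span_le]
  rintro v (rfl | rfl | rfl)
  exacts [polar_rightField B trace_Y1, polar_rightField B trace_Y2, polar_rightField B trace_Y3]

theorem omega_eq_zero_of_mem_vertical (E B : BSpace n) (u : Fin (4 * n) → BSpace n)
    (hu : ∃ i, u i ∈ vertical B) : omega E B u = 0 := by
  obtain ⟨i, hi⟩ := hu
  rw [omega_apply, AlternatingMap.map_linearDependent, mul_zero]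
  intro h
  -- The fields Y₁, Y₂, Y₃ occupy the positions 1, 2, 3 of the frame, and `u i` the position i + 4.
  have h1 := h.notMem_span_image (s := {(1 : Fin (4 * n + 4)), 2, 3})
    (x := i.succ.succ.succ.succ) ?_
  · apply h1
    have h2 : frame E (rightField Y1 B) (rightField Y2 B) (rightField Y3 B) u
        i.succ.succ.succ.succ = u i := rfl
    rw [h2]
    refine Submodule.span_mono ?_ hi
    rintro v (rfl | rfl | rfl)
    exacts [⟨1, by simp, rfl⟩, ⟨2, by simp, rfl⟩, ⟨3, by simp, rfl⟩]
  · simp only [Set.mem_insert_iff, Set.mem_singleton_iff, Fin.ext_iff]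
    -- Numerals in `Fin (4 * n + 4)` are taken modulo 4n+4; none of 1, 2, 3 wraps around.
    have e1 : ((1 : Fin (4 * n + 4)) : ℕ) = 1 := rfl
    have e2 : ((2 : Fin (4 * n + 4)) : ℕ) = 2 := rfl
    have e3 : ((3 : Fin (4 * n + 4)) : ℕ) = 3 := rfl
    rw [e1, e2, e3]
    simp

theorem omega_congr_vertical (E B : BSpace n) {u u' : Fin (4 * n) → BSpace n}
    (h : ∀ i, u i - u' i ∈ vertical B) : omega E B u = omega E B u' :=
  (omega E B).eq_of_sub_mem (vertical B) (omega_eq_zero_of_mem_vertical E B) h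

theorem omega_congr_dbeta {B : BSpace n} (hB : B ∈ tildeES n) (E : BSpace n)
    {u u' : Fin (4 * n) → BSpace n} (h : ∀ i, dbeta B (u i) = dbeta B (u' i)) :
    omega E B u = omega E B u' := by
  refine omega_congr_vertical E B fun i => ?_
  obtain ⟨Y, hY, h1⟩ := eq_rightField_of_dbeta_eq_zero hB (V := u i - u' i)
    (by rw [map_sub, h, sub_self])
  rw [h1]
  exact rightField_mem_vertical B hY

/-! ### Invariance -/

/-- Vanishing on equal neighbours already yields all sign rules, and what remains is the Leibniz
expansion of a 3×3 determinant. -/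
theorem trilinear_apply_of_alternating {V : Type*} [AddCommGroup V] [Module ℂ V]
    (F : V →ₗ[ℂ] V →ₗ[ℂ] V →ₗ[ℂ] ℂ) (h12 : ∀ x y, F x x y = 0) (h23 : ∀ x y, F y x x = 0)
    (A : Matrix (Fin 3) (Fin 3) ℂ) (x y z : V) :
    F (A 0 0 • x + A 0 1 • y + A 0 2 • z) (A 1 0 • x + A 1 1 • y + A 1 2 • z)
      (A 2 0 • x + A 2 1 • y + A 2 2 • z) = A.det * F x y z := by
  have s12 : ∀ x y z, F y x z = -F x y z := fun x y z => by
    have := h12 (x + y) z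
    simp only [map_add, LinearMap.add_apply, h12] at this
    linear_combination this
  have s23 : ∀ x y z, F x z y = -F x y z := fun x y z => by
    have := h23 (y + z) x
    simp only [map_add, LinearMap.add_apply, h23] at this
    linear_combination this
  have h13 : ∀ x y, F x y x = 0 := fun x y => by rw [s23, h12, neg_zero]
  have e1 : F y x z = -F x y z := s12 x y z
  have e2 : F x z y = -F x y z := s23 x y z
  have e3 : F y z x = F x y z := by rw [s23, e1, neg_neg]
  have e4 : F z x y = F x y z := by rw [s12, e2, neg_neg]
  have e5 : F z y x = -F x y z := by rw [s12, e3]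
  simp only [map_add, map_smul, LinearMap.add_apply, LinearMap.smul_apply, h12, h23, h13, e1, e2,
    e3, e4, e5, smul_eq_mul, Matrix.det_fin_three]
  ring

/-- The contraction of the volume form with `E` and `u`, as a trilinear map. -/
def volTrilinear (E : BSpace n) (u : Fin (4 * n) → BSpace n) :
    BSpace n →ₗ[ℂ] BSpace n →ₗ[ℂ] BSpace n →ₗ[ℂ] ℂ :=
  LinearMap.mk₂ ℂ
    (fun X₁ X₂ =>
      { toFun := fun X₃ => (((((volForm n).curryLeft E).curryLeft X₁).curryLeft X₂).curryLeft X₃) u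
        map_add' := fun X Y => by rw [map_add]; rfl
        map_smul' := fun c X => by rw [map_smul]; rfl })
    (fun X X' Y => by
      refine LinearMap.ext fun W => ?_
      change (((((volForm n).curryLeft E :
        BSpace n [⋀^Fin (4 * n + 2 + 1)]→ₗ[ℂ] ℂ).curryLeft (X + X')).curryLeft Y).curryLeft
        W) u = _
      rw [map_add, AlternatingMap.curryLeft_add]
      rfl)
    (fun c X Y => by
      refine LinearMap.ext fun W => ?_
      change (((((volForm n).curryLeft E :
        BSpace n [⋀^Fin (4 * n + 2 + 1)]→ₗ[ℂ] ℂ).curryLeft (c • X)).curryLeft Y).curryLeft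
        W) u = _
      rw [map_smul, AlternatingMap.curryLeft_smul]
      rfl)
    (fun X Y Y' => by
      refine LinearMap.ext fun W => ?_
      change (((((volForm n).curryLeft E :
        BSpace n [⋀^Fin (4 * n + 2 + 1)]→ₗ[ℂ] ℂ).curryLeft X).curryLeft (Y + Y')).curryLeft
        W) u = _
      rw [map_add]
      rfl)
    (fun c X Y => by
      refine LinearMap.ext fun W => ?_
      change (((((volForm n).curryLeft E :
        BSpace n [⋀^Fin (4 * n + 2 + 1)]→ₗ[ℂ] ℂ).curryLeft X).curryLeft (c • Y)).curryLeft
        W) u = _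
      rw [map_smul]
      rfl)

/-- Ad(G) acts on the three-dimensional space sl(2,ℂ) with determinant 1, so it fixes the trivector
Y₁ ∧ Y₂ ∧ Y₃ with which the volume form is contracted. The adjugate stands for the inverse of G. -/
theorem volForm_frame_conj (E B : BSpace n) (u : Fin (4 * n) → BSpace n)
    {G : Matrix (Fin 2) (Fin 2) ℂ} (hG : G.det = 1) :
    volForm n (frame E (rightField (G * Y1 * G.adjugate) B) (rightField (G * Y2 * G.adjugate) B)
      (rightField (G * Y3 * G.adjugate) B) u) =
    volForm n (frame E (rightField Y1 B) (rightField Y2 B) (rightField Y3 B) u) := by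
  have ht : ∀ Y : Matrix (Fin 2) (Fin 2) ℂ, Y.trace = 0 → (G * Y * G.adjugate).trace = 0 := by
    intro Y hY
    rw [Matrix.trace_mul_comm, ← Matrix.mul_assoc, Matrix.adjugate_mul, hG, one_smul,
      Matrix.one_mul, hY]
  set A : Matrix (Fin 3) (Fin 3) ℂ := Matrix.of fun i =>
    let Y := G * ![Y1, Y2, Y3] i * G.adjugate
    ![-Complex.I * Y 0 0, (Y 0 1 - Y 1 0) / 2, -Complex.I * (Y 0 1 + Y 1 0) / 2] with hA
  have hdet : A.det = 1 := by
    -- With the adjugate instead of the inverse this is a polynomial identity, of degree 6 in the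
    -- entries of G, valid without using det G = 1.
    have h3 : A.det = G.det ^ 3 := by
      rw [Matrix.det_fin_three]
      simp only [hA, Matrix.of_apply, Matrix.mul_apply, Fin.sum_univ_two, Matrix.det_fin_two,
        Matrix.adjugate_fin_two, Y1, Y2, Y3]
      simp
      generalize G 0 0 = a
      generalize G 0 1 = b
      generalize G 1 0 = c
      generalize G 1 1 = d
      ring_nf
      simp only [Complex.I_pow_four]
      ring
    rw [h3, hG, one_pow]
  rw [rightField_eq B (ht _ trace_Y1), rightField_eq B (ht _ trace_Y2),
    rightField_eq B (ht _ trace_Y3)]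
  have h := trilinear_apply_of_alternating (volTrilinear E u)
    (fun x y => by
      change (((((volForm n).curryLeft E :
        BSpace n [⋀^Fin (4 * n + 2 + 1)]→ₗ[ℂ] ℂ).curryLeft x).curryLeft x).curryLeft y) u = 0
      rw [AlternatingMap.curryLeft_same]
      rfl)
    (fun x y => by
      change (((((volForm n).curryLeft E :
        BSpace n [⋀^Fin (4 * n + 2 + 1)]→ₗ[ℂ] ℂ).curryLeft y).curryLeft x).curryLeft x) u = 0
      rw [AlternatingMap.curryLeft_same]
      rfl) A (rightField Y1 B) (rightField Y2 B) (rightField Y3 B)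
  rw [hdet, one_mul] at h
  exact h

theorem act_one_rightField (G Y : Matrix (Fin 2) (Fin 2) ℂ) (hG : G.det = 1) (B : BSpace n) :
    act 1 G (rightField (G * Y * G.adjugate) B) = rightField Y (act 1 G B) := by
  apply (mat n).injective
  have h : G.adjugate * G = 1 := by rw [Matrix.adjugate_mul, hG, one_smul]
  simp only [mat_act, mat_rightField, Matrix.one_mul, Matrix.mul_assoc, h, Matrix.mul_one]

theorem act_rightField (H : CMat n) (Y : Matrix (Fin 2) (Fin 2) ℂ) (B : BSpace n) :
    act H 1 (rightField Y B) = rightField Y (act H 1 B) := by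
  apply (mat n).injective
  simp only [mat_act, mat_rightField, Matrix.mul_one, Matrix.mul_assoc]

/-- Right translation by G carries the field of G Y G⁻¹ to the field of Y, so invariance combines
that of the volume form with `volForm_frame_conj`. -/
theorem omega_act_one {G : Matrix (Fin 2) (Fin 2) ℂ} (hG : G.det = 1) (E B : BSpace n)
    (u : Fin (4 * n) → BSpace n) :
    omega (act 1 G E) (act 1 G B) (fun i => act 1 G (u i)) = omega E B u := by
  rw [omega_apply, omega_apply, ← volForm_frame_conj E B u hG,
    ← act_one_rightField G Y1 hG, ← act_one_rightField G Y2 hG, ← act_one_rightField G Y3 hG,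
    ← map_frame (act 1 G), volForm_act, hG]
  simp

theorem omega_act {H : CMat n} (hH : H.det ^ 2 = 1) (E B : BSpace n)
    (u : Fin (4 * n) → BSpace n) :
    omega (act H 1 E) (act H 1 B) (fun i => act H 1 (u i)) = omega E B u := by
  rw [omega_apply, omega_apply, ← act_rightField, ← act_rightField, ← act_rightField,
    ← map_frame (act H 1), volForm_act, hH]
  simp

/-- The value of `omega` depends only on the point and the tangent vectors of `Ẽ_ℍ`. -/
theorem omega_eq_of_dbeta_eq {B B' E E' : BSpace n} (hB : B ∈ tildeES n) (hB' : B' ∈ tildeES n)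
    (h : beta n B = beta n B') (hE : polar B E = 1) (hE' : polar B' E' = 1)
    {u u' : Fin (4 * n) → BSpace n} (hu : ∀ i, polar B (u i) = 0) (hu' : ∀ i, polar B' (u' i) = 0)
    (huu : ∀ i, dbeta B (u i) = dbeta B' (u' i)) : omega E B u = omega E' B' u' := by
  obtain ⟨G, hG, rfl⟩ := exists_eq_act_of_beta_eq hB hB' h
  have hp : ∀ V, polar (act 1 G B) (act 1 G V) = polar B V := fun V =>
    polar_act (by simp) hG B V
  rw [← omega_act_one hG E B u, omega_congr_left (E := act 1 G E) (E' := E') (by rw [hp, hE]) hE'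
    (fun i => by rw [hp, hu])]
  exact omega_congr_dbeta hB' E' fun i => by rw [dbeta_act_one hG, huu]

theorem rhoMat_symplectic (g : Sp n) :
    (rhoMat (g : HMat n))ᵀ * JJ n * rhoMat (g : HMat n) = JJ n := by
  have h := JJ_mul_rhoMat (g : HMat n)ᴴ
  rw [Matrix.conjTranspose_conjTranspose] at h
  rw [← h, Matrix.mul_assoc, ← rhoMat_mul, ← Matrix.star_eq_conjTranspose,
    Unitary.star_mul_self_of_mem g.2, rhoMat_one, Matrix.mul_one]

/-- The square is enough: H acts on both columns, so the volume form scales by (det H)². -/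
theorem det_rhoMat_sq (g : Sp n) : (rhoMat (g : HMat n)).det ^ 2 = 1 := by
  have h := congrArg Matrix.det (rhoMat_symplectic g)
  rw [Matrix.det_mul, Matrix.det_mul, Matrix.det_transpose] at h
  have h1 : (JJ n).det ≠ 0 := by
    intro h0
    have := congrArg Matrix.det (JJ_mul_JJ n)
    rw [Matrix.det_mul, h0, Matrix.det_neg] at this
    simp at this
  exact mul_left_cancel₀ h1 (by linear_combination h)

/-! ## The tangent spaces -/

theorem tangentSpace_singleton {𝕜 V : Type*} [NontriviallyNormedField 𝕜] [NormedAddCommGroup V]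
    [NormedSpace 𝕜 V] (x : V) : tangentSpace 𝕜 {x} x = ⊥ := by
  rw [tangentSpace, Submodule.span_eq_bot]
  intro v hv
  have : ¬ AccPt x (Filter.principal {x}) := by
    rw [accPt_iff_frequently]
    simp
  exact tangentConeAt_subset_zero this hv

/-- Needed for maps that send X into Y only near the point, such as the local sections of β. -/
theorem mem_tangentSpace_of_eventually {𝕜 : Type*} [NontriviallyNormedField 𝕜]
    {V W : Type*} [NormedAddCommGroup V] [NormedSpace 𝕜 V]
    [NormedAddCommGroup W] [NormedSpace 𝕜 W] {X : Set V} {Y : Set W} {f : V → W}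
    {f' : V →L[𝕜] W} {x : V} (hf : HasFDerivAt f f' x) (h : ∀ᶠ y in nhdsWithin x X, f y ∈ Y)
    {v : V} (hv : v ∈ tangentSpace 𝕜 X x) : f' v ∈ tangentSpace 𝕜 Y (f x) := by
  have h1 : tangentSpace 𝕜 X x ≤ (tangentSpace 𝕜 Y (f x)).comap f'.toLinearMap := by
    refine Submodule.span_le.2 fun w hw => Submodule.subset_span ?_
    obtain ⟨U, hU, hxU, hUX⟩ := mem_nhdsWithin.1 h
    rw [← tangentConeAt_inter_nhds (hU.mem_nhds hxU)] at hw
    refine tangentConeAt_mono ?_ ((hf.hasFDerivWithinAt (s := X ∩ U)).mapsTo_tangent_cone hw)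
    rintro _ ⟨y, hy, rfl⟩
    exact hUX hy.symm
  exact h1 hv

/-- On the tangent space of X a derivative depends only on the values along X. This permits
differentiating identities such as β ∘ section = id, which hold on the manifold but not in the
ambient space. -/
theorem eq_of_mem_tangentSpace_of_eventuallyEq {𝕜 : Type*} [NontriviallyNormedField 𝕜]
    {V W : Type*} [NormedAddCommGroup V] [NormedSpace 𝕜 V]
    [NormedAddCommGroup W] [NormedSpace 𝕜 W] {X : Set V} {f g : V → W}
    {f' g' : V →L[𝕜] W} {x : V} (hf : HasFDerivAt f f' x) (hg : HasFDerivAt g g' x) (hx : x ∈ X)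
    (h : f =ᶠ[nhdsWithin x X] g) {v : V} (hv : v ∈ tangentSpace 𝕜 X x) : f' v = g' v := by
  have h1 : HasFDerivWithinAt f g' X x :=
    hg.hasFDerivWithinAt.congr_of_eventuallyEq h (h.self_of_nhdsWithin hx)
  exact LinearMap.eqOn_span (f := f'.toLinearMap) (g := g'.toLinearMap)
    ((hf.hasFDerivWithinAt (s := X)).unique_on h1) hv

/-! ### The tangent space of Ẽ_S is the kernel of dD -/

theorem polar_eq_zero_of_mem_tangentSpace {B v : BSpace n} (hB : B ∈ tildeES n)
    (hv : v ∈ tangentSpace ℂ (tildeES n) B) : polar B v = 0 := by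
  have h1 : polar B v ∈ tangentSpace ℂ {0} (D n B) :=
    mem_tangentSpace_of_eventually (hasFDerivAt_D B)
      (eventually_nhdsWithin_of_forall fun C hC => hC.2) hv
  rw [hB.2, tangentSpace_singleton] at h1
  exact h1

theorem polar_single (B : BSpace n) (i : Fin (n + 1)) (a c : Fin 2) (x : ℂ) :
    polar B (Pi.single i (Matrix.single a c x)) = x * (B i).adjugate c a := by
  simp only [polar_apply, detForm, LinearMap.mk₂_apply]
  rw [← Finset.sum_add_distrib, Finset.sum_eq_single i]
  · fin_cases a <;> fin_cases c <;> simp [Matrix.adjugate_fin_two, mul_comm]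
  · intro j _ hj
    simp [Pi.single_eq_of_ne hj]
  · simp

theorem D_single (i : Fin (n + 1)) (a c : Fin 2) (x : ℂ) :
    D n (Pi.single i (Matrix.single a c x)) = 0 := by
  rw [D]
  refine Finset.sum_eq_zero fun j _ => ?_
  by_cases h : j = i
  · subst h
    rw [Pi.single_eq_same]
    fin_cases a <;> fin_cases c <;> simp [Matrix.det_fin_two]
  · rw [Pi.single_eq_of_ne h]
    simp

theorem ne_zero_of_mem_tildeES {B : BSpace n} (hB : B ∈ tildeES n) : B ≠ 0 := by
  rintro rfl
  obtain ⟨⟨k, l, h⟩, -⟩ := hB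
  simp [zVec, wVec] at h

/-- A matrix unit in a nonzero block, scaled. The condition D(E) = 0 makes D affine along the
direction E, which is used to solve D = 0 explicitly below. -/
theorem exists_polar_eq_one {B : BSpace n} (hB : B ∈ tildeES n) :
    ∃ E, polar B E = 1 ∧ D n E = 0 := by
  obtain ⟨i, hi⟩ : ∃ i, B i ≠ 0 := by
    by_contra! h
    exact ne_zero_of_mem_tildeES hB (funext h)
  have hi' : (B i).adjugate ≠ 0 := by
    intro h
    apply hi
    rw [Matrix.adjugate_fin_two] at h
    ext a c
    have h1 := congrFun (congrFun h (1 - c)) (1 - a)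
    fin_cases a <;> fin_cases c <;> simpa using h1
  obtain ⟨c, a, h⟩ : ∃ c a, (B i).adjugate c a ≠ 0 := by
    by_contra! h
    exact hi' (Matrix.ext h)
  exact ⟨Pi.single i (Matrix.single a c ((B i).adjugate c a)⁻¹), by
    rw [polar_single, inv_mul_cancel₀ h], D_single ..⟩

/-- Up to sign, the partial derivatives of D are the entries of B, so the sum of their squared
absolute values is ‖B‖²; the factor 1/‖B‖² in Z is the normalization. -/
theorem polar_Z {B : BSpace n} (hB : B ∈ tildeES n) : polar B (Z n B) = 1 := by
  set N : ℝ := ∑ j, ∑ b, ∑ d, ‖B j b d‖ ^ 2 with hN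
  have hN0 : (N : ℂ) ≠ 0 := by
    intro h
    apply ne_zero_of_mem_tildeES hB
    rw [Complex.ofReal_eq_zero, hN,
      Finset.sum_eq_zero_iff_of_nonneg (fun _ _ => by positivity)] at h
    funext j
    ext b d
    have h1 := h j (Finset.mem_univ j)
    rw [Finset.sum_eq_zero_iff_of_nonneg (fun _ _ => by positivity)] at h1
    have h2 := h1 b (Finset.mem_univ b)
    rw [Finset.sum_eq_zero_iff_of_nonneg (fun _ _ => by positivity)] at h2
    simpa using h2 d (Finset.mem_univ d)
  have hZ : ∀ i a c, Z n B i a c = (N : ℂ)⁻¹ * (starRingEnd ℂ) ((B i).adjugate c a) := by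
    intro i a c
    have h : fderiv ℂ (D n) B (Pi.single i (Matrix.single a c 1)) = (B i).adjugate c a := by
      have h1 : polar B (Pi.single i (Matrix.single a c 1)) = _ := polar_single B i a c 1
      rw [one_mul] at h1
      rw [← h1, (hasFDerivAt_D B).fderiv]
      rfl
    rw [Z, Matrix.of_apply, h]
  have hc : ∀ z : ℂ, z * (starRingEnd ℂ) z = ((‖z‖ ^ 2 : ℝ) : ℂ) := fun z => by
    rw [Complex.mul_conj, Complex.normSq_eq_norm_sq]
  have h : polar B (Z n B) = (N : ℂ)⁻¹ * N := by
    simp only [polar_apply, detForm, LinearMap.mk₂_apply, hZ, Matrix.adjugate_fin_two, hN]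
    rw [← Finset.sum_add_distrib, Complex.ofReal_sum, Finset.mul_sum]
    refine Finset.sum_congr rfl fun i _ => ?_
    simp only [Fin.sum_univ_two, Complex.ofReal_add, ← hc]
    simp
    ring
  rw [h, inv_mul_cancel₀ hN0]

/-- The line B + tv is corrected in the direction E to an explicit curve in Ẽ_S with the same
velocity; t is real, so v is even a real tangent vector. -/
theorem mem_tangentSpace_of_polar_eq_zero {B v : BSpace n} (hB : B ∈ tildeES n)
    (hv : polar B v = 0) : v ∈ tangentSpace ℝ (tildeES n) B := by
  obtain ⟨E, hE, hE0⟩ := exists_polar_eq_one hB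
  refine Submodule.subset_span ?_
  -- Since dD(v) = 0, dD(E) = 1 and D(E) = 0, one has D(B + t(v + yE)) = t(y(1 + t·polar v E) +
  -- t·D(v)); this is the root y.
  set y : ℝ → ℂ := fun t => -(t * D n v) / (1 + t * polar v E) with hy
  have hyc : Filter.Tendsto y (nhds 0) (nhds 0) := by
    have : ContinuousAt y 0 := by
      refine ContinuousAt.div (by fun_prop) (by fun_prop) (by simp)
    simpa [hy] using this.tendsto
  have hv1 : Filter.Tendsto (fun t : ℝ => v + y t • E) (nhds 0) (nhds v) := by
    have h := (tendsto_const_nhds (x := v)).add (hyc.smul (tendsto_const_nhds (x := E)))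
    rwa [zero_smul, add_zero] at h
  have hd : Filter.Tendsto (fun t : ℝ => (t : ℂ) • (v + y t • E)) (nhds 0) (nhds 0) := by
    have h1 : Filter.Tendsto (fun t : ℝ => (t : ℂ)) (nhds 0) (nhds 0) := by
      simpa using (Complex.continuous_ofReal.tendsto 0)
    simpa using h1.smul hv1
  refine mem_tangentConeAt_of_seq (nhdsWithin (0 : ℝ) {0}ᶜ) (fun t => t⁻¹)
    (fun t => (t : ℂ) • (v + y t • E)) (hd.mono_left nhdsWithin_le_nhds) ?_ ?_
  · have hne : ∀ᶠ t : ℝ in nhds 0, 1 + (t : ℂ) * polar v E ≠ 0 := by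
      have : ContinuousAt (fun t : ℝ => 1 + (t : ℂ) * polar v E) 0 := by fun_prop
      exact this.eventually_ne (by simp)
    have hopen : ∀ᶠ t : ℝ in nhds 0, ∃ k l, zVec (B + (t : ℂ) • (v + y t • E)) k *
        wVec (B + (t : ℂ) • (v + y t • E)) l - zVec (B + (t : ℂ) • (v + y t • E)) l *
        wVec (B + (t : ℂ) • (v + y t • E)) k ≠ 0 := by
      obtain ⟨⟨k, l, hkl⟩, -⟩ := hB
      have hc : Continuous (fun C : BSpace n => zVec C k * wVec C l - zVec C l * wVec C k) := by
        unfold zVec wVec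
        fun_prop
      have h1 : Filter.Tendsto (fun t : ℝ => B + (t : ℂ) • (v + y t • E)) (nhds 0) (nhds B) := by
        simpa using tendsto_const_nhds.add hd
      filter_upwards [(hc.continuousAt.tendsto.comp h1).eventually_ne hkl] with t ht
      exact ⟨k, l, ht⟩
    filter_upwards [nhdsWithin_le_nhds hne, nhdsWithin_le_nhds hopen] with t h1 h2
    refine ⟨h2, ?_⟩
    rw [D_add, hB.2, map_smul, map_add, map_smul, hv, hE, D_smul, D_add, D_smul, hE0, map_smul]
    simp only [hy, smul_eq_mul]
    field_simp
    ring
  · refine (hv1.mono_left nhdsWithin_le_nhds).congr' ?_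
    filter_upwards [self_mem_nhdsWithin] with t ht
    have ht' : (t : ℂ) ≠ 0 := by simpa using ht
    have h1 : t⁻¹ • (t : ℂ) • (v + y t • E) = ((t⁻¹ : ℝ) : ℂ) • (t : ℂ) • (v + y t • E) := rfl
    rw [h1, smul_smul, Complex.ofReal_inv, inv_mul_cancel₀ ht', one_smul]

/-! ## Local holomorphic sections of `β` -/

/-- The entry `(k, l)` of `𝕁 A`. -/
def pivot (k l : Fin (n + 1) × Fin 2) : CMat n →ₗ[ℂ] ℂ where
  toFun A := (JJ n * A) k l
  map_add' A A' := by simp [Matrix.mul_add]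
  map_smul' c A := by simp

theorem pivot_apply (k l : Fin (n + 1) × Fin 2) (A : CMat n) : pivot k l A = (JJ n * A) k l := rfl

/-- The element of `M(2,ℂ)^{n+1}` whose column `c` is the column `k` of `A`, and whose other
column vanishes. -/
def colMap (k : Fin (n + 1) × Fin 2) (c : Fin 2) : CMat n →ₗ[ℂ] BSpace n where
  toFun A := (mat n).symm (A * Matrix.single k c (1 : ℂ))
  map_add' A A' := by simp [Matrix.add_mul]
  map_smul' c A := by simp

theorem mat_colMap (k : Fin (n + 1) × Fin 2) (c : Fin 2) (A : CMat n) :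
    mat n (colMap k c A) = A * Matrix.single k c (1 : ℂ) := by
  simp [colMap]

/-- A local section of `β`, defined where the entry `(k, l)` of `𝕁 A` does not vanish. -/
def colSection (k l : Fin (n + 1) × Fin 2) (A : CMat n) : BSpace n :=
  (pivot k l A)⁻¹ • colMap k 0 A + colMap l 1 A

theorem mat_colSection (k l : Fin (n + 1) × Fin 2) (A : CMat n) :
    mat n (colSection k l A) =
      Matrix.of fun p => ![(pivot k l A)⁻¹ * A p k, A p l] := by
  rw [colSection, map_add, map_smul, mat_colMap, mat_colMap]
  ext p c
  rw [Matrix.add_apply, Matrix.smul_apply]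
  fin_cases c
  · simp [Matrix.mul_single_apply_same, Matrix.mul_single_apply_of_ne]
  · simp [Matrix.mul_single_apply_same, Matrix.mul_single_apply_of_ne]

theorem exists_pivot_ne_zero {A : CMat n} (hA : A ∈ tildeEH n) : ∃ k l, pivot k l A ≠ 0 := by
  by_contra! h
  have h1 : JJ n * A = 0 := Matrix.ext h
  have h2 : A = 0 := by
    have := congrArg (JJ n * ·) h1
    simpa [← Matrix.mul_assoc, JJ_mul_JJ] using this
  have h3 := hA.2.1
  rw [h2, Matrix.rank_zero] at h3
  omega

/-- The condition 𝕁A = ᵗA𝕁 says exactly that 𝕁A is antisymmetric, because 𝕁 is. -/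
theorem pivot_swap {A : CMat n} (hA : A ∈ tildeEH n) (k l : Fin (n + 1) × Fin 2) :
    pivot l k A = -pivot k l A := by
  rw [pivot_apply, pivot_apply, ← Matrix.transpose_apply (JJ n * A), Matrix.transpose_mul,
    JJ_transpose, Matrix.mul_neg, ← hA.1, Matrix.neg_apply]

theorem pivot_eq_mul_JJ {A : CMat n} (hA : A ∈ tildeEH n) (k l : Fin (n + 1) × Fin 2) :
    pivot k l A = ∑ q, A q k * JJ n q l := by
  rw [pivot_apply, hA.1, Matrix.mul_apply]
  rfl

/-- A nonzero entry (k,l) of the antisymmetric 𝕁A makes the columns k and l of A independent, and by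
rank 2 they span all columns. Pairing column q = x·(column k) + y·(column l) with the rows k and l
of 𝕁 determines x and y. -/
theorem pivot_mul_apply {A : CMat n} (hA : A ∈ tildeEH n) {k l : Fin (n + 1) × Fin 2}
    (h : pivot k l A ≠ 0) (p q : Fin (n + 1) × Fin 2) :
    pivot k l A * A p q = A p l * pivot k q A - A p k * pivot l q A := by
  have hself : ∀ k, pivot k k A = 0 := fun k => by
    have := pivot_swap hA k k
    linear_combination this / 2
  have hcol : ∀ (x y : ℂ) (q : Fin (n + 1) × Fin 2), x • A.col k + y • A.col l = A.col q →
      ∀ r, pivot r q A = x * pivot r k A + y * pivot r l A := by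
    intro x y q hq r
    simp only [pivot_apply, Matrix.mul_apply, Finset.mul_sum]
    rw [← Finset.sum_add_distrib]
    refine Finset.sum_congr rfl fun t _ => ?_
    have := congrFun hq t
    simp only [Pi.add_apply, Pi.smul_apply, Matrix.col_apply, smul_eq_mul] at this
    rw [← this]
    ring
  have hli : LinearIndependent ℂ ![A.col k, A.col l] := by
    rw [LinearIndependent.pair_iff]
    intro x y hxy
    have h1 : ∀ r, x * pivot r k A + y * pivot r l A = 0 := by
      intro r
      simp only [pivot_apply, Matrix.mul_apply, Finset.mul_sum]
      rw [← Finset.sum_add_distrib]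
      refine Finset.sum_eq_zero fun t _ => ?_
      have := congrFun hxy t
      simp only [Pi.add_apply, Pi.smul_apply, Matrix.col_apply, smul_eq_mul, Pi.zero_apply] at this
      linear_combination JJ n r t * this
    have h2 := h1 k
    have h3 := h1 l
    rw [hself] at h2 h3
    rw [pivot_swap hA] at h3
    constructor
    · simpa [h] using h3
    · simpa [h] using h2
  have hspan : Submodule.span ℂ {A.col k, A.col l} = Submodule.span ℂ (Set.range A.col) := by
    refine Submodule.eq_of_le_of_finrank_eq (Submodule.span_mono ?_) ?_
    · rintro _ (rfl | rfl)
      exacts [⟨k, rfl⟩, ⟨l, rfl⟩]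
    · rw [← Matrix.rank_eq_finrank_span_cols, hA.2.1]
      have := finrank_span_eq_card hli
      rw [Matrix.range_cons, Matrix.range_cons, Matrix.range_empty, Set.union_empty,
        Set.singleton_union] at this
      simpa using this
  have hq : A.col q ∈ Submodule.span ℂ {A.col k, A.col l} := by
    rw [hspan]
    exact Submodule.subset_span ⟨q, rfl⟩
  obtain ⟨x, y, hxy⟩ := Submodule.mem_span_pair.1 hq
  have h1 := hcol x y q hxy k
  have h2 := hcol x y q hxy l
  rw [hself] at h1 h2
  rw [pivot_swap hA k l] at h2
  have h3 := congrFun hxy p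
  simp only [Pi.add_apply, Pi.smul_apply, Matrix.col_apply, smul_eq_mul] at h3
  rw [h1, h2, ← h3]
  ring

/-- The Cramer relation `pivot_mul_apply`, rewritten as -M J ᵗM 𝕁 for the chosen columns; the
scaling of the first column accounts for the division by the pivot. -/
theorem beta_colSection {A : CMat n} (hA : A ∈ tildeEH n) {k l : Fin (n + 1) × Fin 2}
    (h : pivot k l A ≠ 0) : beta n (colSection k l A) = A := by
  ext p q
  have h1 := pivot_mul_apply hA h p q
  rw [pivot_eq_mul_JJ hA k q, pivot_eq_mul_JJ hA l q] at h1
  have h2 : beta n (colSection k l A) p q = (pivot k l A)⁻¹ *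
      (A p l * ∑ r, A r k * JJ n r q - A p k * ∑ r, A r l * JJ n r q) := by
    rw [beta_eq, betaForm_apply, mat_colSection, Matrix.mul_assoc, Matrix.mul_assoc]
    simp only [Matrix.neg_apply, Matrix.mul_apply, Fin.sum_univ_two, Matrix.of_apply,
      Matrix.transpose_apply, J]
    simp only [Finset.mul_sum, mul_sub, ← Finset.sum_sub_distrib]
    simp
    simp only [Finset.mul_sum, ← Finset.sum_add_distrib, ← Finset.sum_neg_distrib,
      ← Finset.sum_sub_distrib]
    refine Finset.sum_congr rfl fun r _ => ?_
    ring
  rw [h2, ← h1, inv_mul_cancel_left₀ h]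

theorem colSection_mem {A : CMat n} (hA : A ∈ tildeEH n) {k l : Fin (n + 1) × Fin 2}
    (h : pivot k l A ≠ 0) : colSection k l A ∈ tildeES n := by
  have hz : ∀ p, zVec (colSection k l A) p = (pivot k l A)⁻¹ * A p k := fun p => by
    have := congrFun (congrFun (mat_colSection k l A) p) 0
    simpa [zVec] using this
  have hw : ∀ p, wVec (colSection k l A) p = A p l := fun p => by
    have := congrFun (congrFun (mat_colSection k l A) p) 1
    simpa [wVec] using this
  constructor
  · by_contra! h1
    simp only [hz, hw] at h1
    -- If all minors of the columns k and l vanish, contracting with row k of 𝕁, for which the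
    -- diagonal pivot is zero, forces column k to vanish, contradicting the pivot.
    have h2 : ∀ p q, A p k * A q l = A q k * A p l := fun p q => by
      have h4 := congrArg (pivot k l A * ·) (h1 p q)
      simp only [mul_sub, mul_zero, ← mul_assoc, mul_inv_cancel₀ h, one_mul] at h4
      linear_combination h4
    have h3 : ∀ q, A q k = 0 := by
      intro q
      have e1 : pivot k k A = 0 := by
        have := pivot_swap hA k k
        linear_combination this / 2
      have e2 : pivot k k A * A q l = A q k * pivot k l A := by
        simp only [pivot_apply, Matrix.mul_apply, Finset.mul_sum, Finset.sum_mul]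
        refine Finset.sum_congr rfl fun p _ => ?_
        linear_combination JJ n k p * h2 p q
      rw [e1, zero_mul] at e2
      exact (mul_eq_zero.1 e2.symm).resolve_right h
    apply h
    rw [pivot_eq_mul_JJ hA]
    exact Finset.sum_eq_zero fun q _ => by rw [h3, zero_mul]
  · have h1 := congrFun (congrFun (transpose_mat_mul_JJ_mul_mat (colSection k l A)) 0) 1
    have h2 : D n (colSection k l A) = (pivot k l A)⁻¹ * (Aᵀ * JJ n * A) k l := by
      rw [Matrix.smul_apply, smul_eq_mul] at h1
      rw [show J 0 1 = 1 from rfl, mul_one] at h1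
      rw [← h1, mat_colSection]
      simp only [Matrix.mul_apply, Matrix.transpose_apply, Matrix.of_apply, Finset.mul_sum,
        Finset.sum_mul]
      refine Finset.sum_congr rfl fun r _ => Finset.sum_congr rfl fun t _ => ?_
      simp [mul_assoc]
    -- The isotropy of the columns is where A² = 0 enters: ᵗA𝕁A = 𝕁A² = 0.
    rw [h2, ← hA.1, Matrix.mul_assoc, ← sq, hA.2.2]
    simp

theorem contDiffAt_colSection {k l : Fin (n + 1) × Fin 2} {A : CMat n} (h : pivot k l A ≠ 0)
    (m : WithTop ℕ∞) : ContDiffAt ℂ m (colSection k l) A := by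
  have h1 : ContDiffAt ℂ m (fun A => pivot k l A) A :=
    (LinearMap.toContinuousLinearMap (pivot (n := n) k l)).contDiff.contDiffAt
  have h2 : ∀ k c, ContDiffAt ℂ m (fun A => colMap (n := n) k c A) A := fun k c =>
    (LinearMap.toContinuousLinearMap (colMap (n := n) k c)).contDiff.contDiffAt
  exact ((h1.inv h).smul (h2 k 0)).add (h2 l 1)

theorem continuous_pivot (k l : Fin (n + 1) × Fin 2) : Continuous (pivot (n := n) k l) :=
  (LinearMap.toContinuousLinearMap (pivot (n := n) k l)).continuous

theorem eventually_pivot_ne_zero {k l : Fin (n + 1) × Fin 2} {A : CMat n} (h : pivot k l A ≠ 0) :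
    ∀ᶠ A' in nhds A, pivot k l A' ≠ 0 :=
  (continuous_pivot k l).continuousAt.eventually_ne h

theorem hasFDerivAt_colSection {k l : Fin (n + 1) × Fin 2} {A : CMat n} (h : pivot k l A ≠ 0) :
    HasFDerivAt (colSection k l) (fderiv ℂ (colSection k l) A) A :=
  ((contDiffAt_colSection h 1).differentiableAt (by simp)).hasFDerivAt

theorem polar_fderiv_colSection {A v : CMat n} (hA : A ∈ tildeEH n) {k l : Fin (n + 1) × Fin 2}
    (h : pivot k l A ≠ 0) (hv : v ∈ tangentSpace ℂ (tildeEH n) A) :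
    polar (colSection k l A) (fderiv ℂ (colSection k l) A v) = 0 := by
  refine polar_eq_zero_of_mem_tangentSpace (colSection_mem hA h)
    (mem_tangentSpace_of_eventually (hasFDerivAt_colSection h) ?_ hv)
  filter_upwards [nhdsWithin_le_nhds (eventually_pivot_ne_zero h), self_mem_nhdsWithin]
    with A' h1 h2
  exact colSection_mem h2 h1

theorem dbeta_fderiv_colSection {A v : CMat n} (hA : A ∈ tildeEH n) {k l : Fin (n + 1) × Fin 2}
    (h : pivot k l A ≠ 0) (hv : v ∈ tangentSpace ℂ (tildeEH n) A) :
    dbeta (colSection k l A) (fderiv ℂ (colSection k l) A v) = v := by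
  refine eq_of_mem_tangentSpace_of_eventuallyEq
    ((hasFDerivAt_beta (colSection k l A)).comp A (hasFDerivAt_colSection h)) (hasFDerivAt_id A)
    hA ?_ hv
  filter_upwards [nhdsWithin_le_nhds (eventually_pivot_ne_zero h), self_mem_nhdsWithin]
    with A' h1 h2
  exact beta_colSection h2 h1

/-! ## Tangent vectors of `Ẽ_ℍ` -/

/-- The section gives a lift at one point of the fibre; the element of SL(2,ℂ) joining that point to
`B` transports it. -/
theorem exists_dbeta_eq {B : BSpace n} (hB : B ∈ tildeES n) {v : CMat n}
    (hv : v ∈ tangentSpace ℂ (tildeEH n) (beta n B)) :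
    ∃ u, polar B u = 0 ∧ dbeta B u = v := by
  have hA := beta_mapsTo n hB
  obtain ⟨k, l, h⟩ := exists_pivot_ne_zero hA
  obtain ⟨G, hG, hBG⟩ := exists_eq_act_of_beta_eq (colSection_mem hA h) hB (beta_colSection hA h)
  refine ⟨act 1 G (fderiv ℂ (colSection k l) (beta n B) v), ?_, ?_⟩
  · have h1 := polar_fderiv_colSection hA h hv
    rw [← polar_act (H := 1) (by simp) hG, ← hBG] at h1
    exact h1
  · have h1 := dbeta_fderiv_colSection hA h hv
    rw [← dbeta_act_one hG, ← hBG] at h1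
    exact h1

theorem dbeta_mem_tangentSpace_real {B : BSpace n} (hB : B ∈ tildeES n) {u : BSpace n}
    (hu : polar B u = 0) : dbeta B u ∈ tangentSpace ℝ (tildeEH n) (beta n B) :=
  mem_tangentSpace_of_eventually ((hasFDerivAt_beta B).restrictScalars ℝ)
    (eventually_nhdsWithin_of_forall fun _ hC => beta_mapsTo n hC)
    (mem_tangentSpace_of_polar_eq_zero hB hu)

theorem tangentSpace_real_le {V : Type*} [NormedAddCommGroup V] [NormedSpace ℂ V] (X : Set V)
    (x : V) : tangentSpace ℝ X x ≤ (tangentSpace ℂ X x).restrictScalars ℝ :=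
  Submodule.span_le.2 fun _ hw => Submodule.subset_span (tangentConeAt_mono_field hw)

theorem dbeta_mem_tangentSpace {B : BSpace n} (hB : B ∈ tildeES n) {u : BSpace n}
    (hu : polar B u = 0) : dbeta B u ∈ tangentSpace ℂ (tildeEH n) (beta n B) :=
  tangentSpace_real_le _ _ (dbeta_mem_tangentSpace_real hB hu)

theorem exists_beta_eq {A : CMat n} (hA : A ∈ tildeEH n) : ∃ B ∈ tildeES n, beta n B = A := by
  obtain ⟨k, l, h⟩ := exists_pivot_ne_zero hA
  exact ⟨_, colSection_mem hA h, beta_colSection hA h⟩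

/-- Complex tangent vectors lift to ker dD, whose elements are velocities of real curves in Ẽ_S. The
polarization is built on real tangent spaces and forms on complex ones, so the two must agree. -/
theorem mem_tangentSpace_real {A v : CMat n} (hA : A ∈ tildeEH n)
    (hv : v ∈ tangentSpace ℂ (tildeEH n) A) : v ∈ tangentSpace ℝ (tildeEH n) A := by
  obtain ⟨B, hB, rfl⟩ := exists_beta_eq hA
  obtain ⟨u, hu, rfl⟩ := exists_dbeta_eq hB hv
  exact dbeta_mem_tangentSpace_real hB hu

/-! ## The form `σ_ℍ` -/

/-- The form `σ_ℍ`: the form `σ` evaluated on the lifts under a local section of `β`. -/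
def sigmaH (n : ℕ) : DiffForm (tildeEH n) (4 * n) := fun A =>
  let k := (exists_pivot_ne_zero A.2).choose
  let l := (exists_pivot_ne_zero A.2).choose_spec.choose
  (omega (Z n (colSection k l A)) (colSection k l A)).compLinearMap
    ((fderiv ℂ (colSection k l) (A : CMat n)).toLinearMap ∘ₗ
      (tangentSpace ℂ (tildeEH n) (A : CMat n)).subtype)

/-- The definition chooses a pivot at each point arbitrarily; by this lemma any lift and any
normalized E compute σ_ℍ. The later properties are obtained by choosing suitable lifts. -/
theorem sigmaH_apply {B E : BSpace n} (hB : B ∈ tildeES n) (hE : polar B E = 1)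
    {u : Fin (4 * n) → BSpace n} (hu : ∀ i, polar B (u i) = 0) (A : tildeEH n)
    (hA : beta n B = A) (v : Fin (4 * n) → tangentSpace ℂ (tildeEH n) (A : CMat n))
    (huv : ∀ i, dbeta B (u i) = v i) : sigmaH n A v = omega E B u := by
  obtain ⟨A, hA'⟩ := A
  have h := (exists_pivot_ne_zero hA').choose_spec.choose_spec
  set k := (exists_pivot_ne_zero hA').choose
  set l := (exists_pivot_ne_zero hA').choose_spec.choose
  refine omega_eq_of_dbeta_eq (colSection_mem hA' h) hB ?_ (polar_Z (colSection_mem hA' h)) hE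
    (fun i => polar_fderiv_colSection hA' h (v i).2) hu fun i => ?_
  · rw [beta_colSection hA' h, hA]
  · exact (dbeta_fderiv_colSection hA' h (v i).2).trans (huv i).symm

theorem pullback_beta_sigmaH : pullback (beta_mapsTo n) (sigmaH n) = sigma n := by
  funext B
  ext v
  refine (sigmaH_apply B.2 (polar_Z B.2) (u := fun i => (v i : BSpace n))
    (fun i => polar_eq_zero_of_mem_tangentSpace B.2 (v i).2) _ rfl _ fun i => ?_).trans rfl
  change _ = fderiv ℂ (beta n) B (v i)
  rw [(hasFDerivAt_beta (B : BSpace n)).fderiv]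
  rfl

/-- β is onto and every tangent vector of Ẽ_ℍ is the image of one of Ẽ_S, so pullback by β is
injective on forms, pointwise and without regularity. -/
theorem eq_sigmaH_of_pullback_eq (η : DiffForm (tildeEH n) (4 * n))
    (h : pullback (beta_mapsTo n) η = sigma n) : η = sigmaH n := by
  funext A
  ext v
  obtain ⟨A, hA⟩ := A
  obtain ⟨B, hB, rfl⟩ := exists_beta_eq hA
  choose u hu huv using fun i => exists_dbeta_eq hB (v i).2
  have hu' : ∀ i, u i ∈ tangentSpace ℂ (tildeES n) B := fun i =>
    tangentSpace_real_le _ _ (mem_tangentSpace_of_polar_eq_zero hB (hu i))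
  have h1 : ∀ ω : DiffForm (tildeEH n) (4 * n),
      pullback (beta_mapsTo n) ω ⟨B, hB⟩ (fun i => ⟨u i, hu' i⟩) = ω ⟨beta n B, hA⟩ v := by
    intro ω
    refine congrArg (ω ⟨beta n B, hA⟩) (funext fun i => Subtype.ext ?_)
    rw [← huv i]
    change fderiv ℂ (beta n) B (u i) = _
    rw [(hasFDerivAt_beta B).fderiv]
    rfl
  rw [← h1, ← h1, h, pullback_beta_sigmaH]

theorem hasFDerivAt_spAct (g : HMat n) (A : CMat n) :
    HasFDerivAt (spAct n g) (LinearMap.toContinuousLinearMap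
      ({ toFun := spAct n g, map_add' := spAct_add g, map_smul' := by simp [spAct] } :
        CMat n →ₗ[ℂ] CMat n)) A :=
  (LinearMap.toContinuousLinearMap
      ({ toFun := spAct n g, map_add' := spAct_add g, map_smul' := by simp [spAct] } :
        CMat n →ₗ[ℂ] CMat n)).hasFDerivAt

theorem mem_tildeES_of_mul_mat_eq_one {B : BSpace n}
    {L : Matrix (Fin 2) (Fin (n + 1) × Fin 2) ℂ} (hL : L * mat n B = 1) (hD : D n B = 0) :
    B ∈ tildeES n := by
  refine ⟨?_, hD⟩
  by_contra! h
  have h1 : mat n B * J * (mat n B)ᵀ = 0 := by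
    ext p q
    have := h p q
    simp only [zVec, wVec] at this
    simp [Matrix.mul_apply, Fin.sum_univ_two, J]
    linear_combination this
  have h2 : L * (mat n B * J * (mat n B)ᵀ) * Lᵀ = J := by
    calc L * (mat n B * J * (mat n B)ᵀ) * Lᵀ
        = (L * mat n B) * J * (L * mat n B)ᵀ := by
          simp only [Matrix.transpose_mul, Matrix.mul_assoc]
      _ = J := by rw [hL]; simp
  rw [h1] at h2
  have := congrFun (congrFun h2 0) 1
  simp [J] at this

theorem act_rhoMat_mem (g : Sp n) {B : BSpace n} (hB : B ∈ tildeES n) :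
    act (rhoMat (g : HMat n)) 1 B ∈ tildeES n := by
  obtain ⟨L, hL⟩ := exists_mul_mat_eq_one hB
  refine mem_tildeES_of_mul_mat_eq_one (L := L * rhoMat (star (g : HMat n))) ?_ ?_
  · rw [mat_act, Matrix.mul_one, Matrix.mul_assoc, ← Matrix.mul_assoc (rhoMat (star (g : HMat n))),
      ← rhoMat_mul, Unitary.star_mul_self_of_mem g.2, rhoMat_one, Matrix.one_mul, hL]
  · rw [D_act (rhoMat_symplectic g), hB.2, mul_zero]

/-- If B and the u_i lift a point and tangent vectors, ρ(g)B and the ρ(g)u_i lift their images under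
g, and `omega` takes the same value on both. -/
theorem pullback_spAct_sigmaH (g : Sp n) :
    pullback (spAct_mapsTo n g) (sigmaH n) = sigmaH n := by
  funext A
  ext v
  obtain ⟨A, hA⟩ := A
  obtain ⟨B, hB, rfl⟩ := exists_beta_eq hA
  choose u hu huv using fun i => exists_dbeta_eq hB (v i).2
  have hp : ∀ V, polar (act (rhoMat (g : HMat n)) 1 B) (act (rhoMat (g : HMat n)) 1 V)
      = polar B V := fun V => polar_act (rhoMat_symplectic g) (by simp) B V
  have hd : ∀ i, dbeta (act (rhoMat (g : HMat n)) 1 B) (act (rhoMat (g : HMat n)) 1 (u i)) =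
      fderiv ℂ (spAct n g) (beta n B) (v i) := fun i => by
    rw [dbeta_act_rhoMat, huv, (hasFDerivAt_spAct (g : HMat n) (beta n B)).fderiv]
    rfl
  rw [sigmaH_apply hB (polar_Z hB) hu ⟨beta n B, hA⟩ rfl v huv, ← omega_act (det_rhoMat_sq g)]
  exact sigmaH_apply (act_rhoMat_mem g hB) ((hp _).trans (polar_Z hB))
    (fun i => (hp _).trans (hu i))
    ⟨spAct n g (beta n B), spAct_mapsTo n g hA⟩ (beta_act_rhoMat _ _)
    (fun i => tangentMap ℂ (spAct_mapsTo n g) (beta n B) (v i)) hd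

/-! ### `σ_ℍ` does not vanish -/

theorem linearIndependent_rightField {B : BSpace n} (hB : B ∈ tildeES n) :
    LinearIndependent ℂ ![rightField Y1 B, rightField Y2 B, rightField Y3 B] := by
  rw [Fintype.linearIndependent_iff]
  intro c hc
  obtain ⟨L, hL⟩ := exists_mul_mat_eq_one hB
  have h0 : c 0 • Y1 + c 1 • Y2 + c 2 • Y3 = 0 := by
    have h1 := congrArg (fun V => L * mat n V) hc
    simp only [Fin.sum_univ_three, map_add, map_smul, map_zero, Matrix.mul_zero] at h1
    simpa [mat_rightField, Matrix.mul_add, ← Matrix.mul_assoc, hL] using h1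
  have e00 := congrFun (congrFun h0 0) 0
  have e01 := congrFun (congrFun h0 0) 1
  have e10 := congrFun (congrFun h0 1) 0
  simp [Y1, Y2, Y3] at e00 e01 e10
  have h1 : c 1 = 0 := by linear_combination (e01 - e10) / 2
  have h2 : c 2 = 0 := by
    rw [h1] at e01
    simpa using e01
  intro i
  fin_cases i
  exacts [e00, h1, h2]

theorem finrank_vertical {B : BSpace n} (hB : B ∈ tildeES n) :
    Module.finrank ℂ (vertical B) = 3 := by
  have h := finrank_span_eq_card (linearIndependent_rightField hB)
  rw [Matrix.range_cons, Matrix.range_cons, Matrix.range_cons, Matrix.range_empty,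
    Set.union_empty, Set.singleton_union, Set.singleton_union] at h
  exact h

/-- Take u a basis of a complement of the vertical space in ker dD, of dimension (4n+3) - 3.
Together with the Y_i and the transverse vector E it spans the ambient space. -/
theorem exists_omega_ne_zero {B E : BSpace n} (hB : B ∈ tildeES n) (hE : polar B E = 1) :
    ∃ u : Fin (4 * n) → BSpace n, (∀ i, polar B (u i) = 0) ∧
      LinearMap.ker (polar B) ≤ vertical B ⊔ Submodule.span ℂ (Set.range u) ∧
      omega E B u ≠ 0 := by
  obtain ⟨C', hC'⟩ := exists_isCompl (vertical B)
  set K := LinearMap.ker (polar B) with hK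
  have hsup : vertical B ⊔ C' ⊓ K = K := by
    -- The modular law turns a complement in the ambient space into one inside ker dD.
    rw [← sup_inf_assoc_of_le C' (vertical_le_ker B), hC'.sup_eq_top, top_inf_eq]
  have hinf : vertical B ⊓ (C' ⊓ K) = ⊥ := by
    rw [← inf_assoc, hC'.inf_eq_bot, bot_inf_eq]
  have hdim : Module.finrank ℂ (C' ⊓ K : Submodule ℂ (BSpace n)) = 4 * n := by
    have h := Submodule.finrank_sup_add_finrank_inf_eq (vertical B) (C' ⊓ K)
    rw [hsup, hinf, finrank_bot, finrank_vertical hB, finrank_ker_polar hE] at h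
    omega
  let b := Module.finBasisOfFinrankEq ℂ (C' ⊓ K : Submodule ℂ (BSpace n)) hdim
  have hspan : Submodule.span ℂ (Set.range fun i => (b i : BSpace n)) = C' ⊓ K := by
    have h := congrArg (Submodule.map (C' ⊓ K).subtype) b.span_eq
    rwa [Submodule.map_span, Submodule.map_top, Submodule.range_subtype, ← Set.range_comp] at h
  refine ⟨fun i => b i, fun i => (b i).2.2, ?_, ?_⟩
  · rw [hspan, hsup]
  · rw [omega_apply]
    refine mul_ne_zero (by simp) (volForm_apply_ne_zero ?_)
    set F := frame E (rightField Y1 B) (rightField Y2 B) (rightField Y3 B)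
      (fun i => (b i : BSpace n)) with hF
    have hKF : K ≤ Submodule.span ℂ (Set.range F) := by
      rw [← hsup, ← hspan, vertical, ← Submodule.span_union]
      refine Submodule.span_mono ?_
      rintro _ ((rfl | rfl | rfl) | ⟨i, rfl⟩)
      exacts [⟨1, rfl⟩, ⟨2, rfl⟩, ⟨3, rfl⟩, ⟨i.succ.succ.succ.succ, rfl⟩]
    intro v _
    have h1 : v - polar B v • E ∈ K := by simp [hK, hE]
    have h2 : E ∈ Submodule.span ℂ (Set.range F) := Submodule.subset_span ⟨0, rfl⟩
    have h3 := Submodule.add_mem _ (hKF h1) (Submodule.smul_mem _ (polar B v) h2)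
    rwa [sub_add_cancel] at h3

/-! ### `σ_ℍ` is holomorphic -/

/-- The values on tuples of basis vectors embed the space of forms linearly in a coordinate space; a
linear left inverse recovers the form from its coefficients. -/
theorem differentiableAt_of_forall_apply {V G : Type*} [NormedAddCommGroup V] [NormedSpace ℂ V]
    [NormedAddCommGroup G] [NormedSpace ℂ G] [FiniteDimensional ℂ V] {k : ℕ}
    {Ω : G → V [⋀^Fin k]→L[ℂ] ℂ} {x : G}
    (h : ∀ v, DifferentiableAt ℂ (fun y => Ω y v) x) : DifferentiableAt ℂ Ω x := by
  let b := Module.finBasis ℂ V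
  let e : (V [⋀^Fin k]→L[ℂ] ℂ) →ₗ[ℂ] ((Fin k → Fin (Module.finrank ℂ V)) → ℂ) :=
    { toFun := fun f j => f fun i => b (j i)
      map_add' := fun _ _ => rfl
      map_smul' := fun _ _ => rfl }
  have he : LinearMap.ker e = ⊥ := by
    refine LinearMap.ker_eq_bot.2 fun f g hfg => ?_
    refine ContinuousAlternatingMap.toAlternatingMap_injective ?_
    exact Module.Basis.ext_alternating b fun j _ => congrFun hfg j
  obtain ⟨g, hg⟩ := e.exists_leftInverse_of_injective he
  have h1 : Ω = fun y => (LinearMap.toContinuousLinearMap g) (e (Ω y)) := by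
    funext y
    exact (LinearMap.congr_fun hg (Ω y)).symm
  rw [h1]
  refine (LinearMap.toContinuousLinearMap g).differentiableAt.comp x ?_
  exact differentiableAt_pi.2 fun j => h _

/-- The volume form as a continuous alternating map. -/
def volFormL (n : ℕ) : BSpace n [⋀^Fin (4 * n + 4)]→L[ℂ] ℂ where
  toMultilinearMap := (volForm n).toMultilinearMap
  map_eq_zero_of_eq' := (volForm n).map_eq_zero_of_eq'
  cont := by
    have h : Continuous fun v : Fin (4 * n + 4) → BSpace n =>
        (Matrix.of fun i => coords n (v i)).det := by
      refine Continuous.matrix_det (continuous_matrix fun i j => ?_)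
      simp only [Matrix.of_apply, coords_apply, mat_apply]
      fun_prop
    exact h

section Differentiable

variable {G : Type*} [NormedAddCommGroup G] [NormedSpace ℂ G] {x : G}

theorem differentiableAt_linearMap {V W : Type*} [NormedAddCommGroup V] [NormedSpace ℂ V]
    [FiniteDimensional ℂ V] [NormedAddCommGroup W] [NormedSpace ℂ W] (L : V →ₗ[ℂ] W) {f : G → V}
    (hf : DifferentiableAt ℂ f x) : DifferentiableAt ℂ (fun y => L (f y)) x :=
  (LinearMap.toContinuousLinearMap L).differentiableAt.comp x hf

theorem differentiableAt_omega {E B : G → BSpace n} {u : Fin (4 * n) → G → BSpace n}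
    (hE : DifferentiableAt ℂ E x) (hB : DifferentiableAt ℂ B x)
    (hu : ∀ i, DifferentiableAt ℂ (u i) x) :
    DifferentiableAt ℂ (fun y => omega (E y) (B y) (fun i => u i y)) x := by
  have hr : ∀ Y, DifferentiableAt ℂ (fun y => rightField Y (B y)) x := by
    intro Y
    have h : ∀ C : BSpace n, rightField Y C = act 1 Y C := fun C => by
      apply (mat n).injective
      rw [mat_rightField, mat_act, Matrix.one_mul]
    simp only [h]
    exact differentiableAt_linearMap _ hB
  have hF : DifferentiableAt ℂ (fun y => frame (E y) (rightField Y1 (B y)) (rightField Y2 (B y))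
      (rightField Y3 (B y)) (fun i => u i y)) x := by
    refine differentiableAt_pi.2 fun i => ?_
    refine Fin.cases hE (fun i => ?_) i
    refine Fin.cases (hr Y1) (fun i => ?_) i
    refine Fin.cases (hr Y2) (fun i => ?_) i
    refine Fin.cases (hr Y3) (fun i => ?_) i
    exact hu i
  have h := (volFormL n).differentiable.differentiableAt.comp x hF
  simp only [omega_apply]
  exact h.const_mul _

theorem differentiableAt_polar {B V : G → BSpace n} (hB : DifferentiableAt ℂ B x)
    (hV : DifferentiableAt ℂ V x) : DifferentiableAt ℂ (fun y => polar (B y) (V y)) x := by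
  have h : ∀ y, polar (B y) (V y) = D n (B y + V y) - D n (B y) - D n (V y) := fun y => by
    rw [D_add]; ring
  have hD : ∀ {C : G → BSpace n}, DifferentiableAt ℂ C x →
      DifferentiableAt ℂ (fun y => D n (C y)) x :=
    fun hC => (hasFDerivAt_D _).differentiableAt.comp x hC
  simp only [h]
  exact ((hD (hB.add hV)).sub (hD hB)).sub (hD hV)

theorem differentiableAt_dbeta {B V : G → BSpace n} (hB : DifferentiableAt ℂ B x)
    (hV : DifferentiableAt ℂ V x) : DifferentiableAt ℂ (fun y => dbeta (B y) (V y)) x := by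
  have h : ∀ y, dbeta (B y) (V y) = beta n (B y + V y) - beta n (B y) - beta n (V y) := fun y => by
    rw [beta_add]; abel
  have hD : ∀ {C : G → BSpace n}, DifferentiableAt ℂ C x →
      DifferentiableAt ℂ (fun y => beta n (C y)) x :=
    fun hC => (hasFDerivAt_beta _).differentiableAt.comp x hC
  simp only [h]
  exact ((hD (hB.add hV)).sub (hD hB)).sub (hD hV)

end Differentiable

theorem continuous_omega (E B : BSpace n) : Continuous (omega E B) := by
  refine continuous_iff_continuousAt.2 fun u => DifferentiableAt.continuousAt (𝕜 := ℂ) ?_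
  exact differentiableAt_omega (differentiableAt_const E) (differentiableAt_const B)
    fun i => differentiableAt_apply i u

theorem differentiableAt_colSection {k l : Fin (n + 1) × Fin 2} {A : CMat n}
    (h : pivot k l A ≠ 0) : DifferentiableAt ℂ (colSection k l) A :=
  (hasFDerivAt_colSection h).differentiableAt

/-- A multiple of `E` that is normalized at the point `B`. -/
def normalize (E B : BSpace n) : BSpace n := (polar B E)⁻¹ • E

theorem polar_normalize {E B : BSpace n} (h : polar B E ≠ 0) : polar B (normalize E B) = 1 := by
  rw [normalize, map_smul, smul_eq_mul, inv_mul_cancel₀ h]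

theorem differentiableAt_normalize {k l : Fin (n + 1) × Fin 2} {A : CMat n}
    (h : pivot k l A ≠ 0) {E : BSpace n} (hE : polar (colSection k l A) E ≠ 0) :
    DifferentiableAt ℂ (fun A => normalize E (colSection k l A)) A :=
  ((differentiableAt_polar (differentiableAt_colSection h) (differentiableAt_const E)).inv
    hE).smul (differentiableAt_const E)

theorem exists_isOpen_normalize {k l : Fin (n + 1) × Fin 2} {A : CMat n} (h : pivot k l A ≠ 0)
    {E : BSpace n} (hE : polar (colSection k l A) E ≠ 0) :
    ∃ O : Set (CMat n), IsOpen O ∧ A ∈ O ∧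
      ∀ A' ∈ O, pivot k l A' ≠ 0 ∧ polar (colSection k l A') E ≠ 0 := by
  have h1 := (differentiableAt_polar (differentiableAt_colSection h)
    (differentiableAt_const E)).continuousAt.eventually_ne hE
  obtain ⟨O, hO, hO', hA⟩ := eventually_nhds_iff.1 ((eventually_pivot_ne_zero h).and h1)
  exact ⟨O, hO', hA, hO⟩

theorem differentiableAt_fderiv_apply {V W : Type*} [NormedAddCommGroup V] [NormedSpace ℂ V]
    [NormedAddCommGroup W] [NormedSpace ℂ W] {f : V → W} {x : V} (hf : ContDiffAt ℂ 2 f x) (v : V) :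
    DifferentiableAt ℂ (fun y => fderiv ℂ f y v) x := by
  have h1 : ContDiffAt ℂ 1 (fderiv ℂ f) x := hf.fderiv_right (by norm_num)
  exact (h1.differentiableAt (by simp)).clm_apply (differentiableAt_const _)

theorem isHolomorphic_sigmaH : IsHolomorphic (sigmaH n) := by
  rintro ⟨A, hA⟩
  obtain ⟨k, l, h⟩ := exists_pivot_ne_zero hA
  -- E is fixed at the base point and only rescaled nearby, so it varies holomorphically, unlike Z.
  obtain ⟨E, hE, -⟩ := exists_polar_eq_one (colSection_mem hA h)
  obtain ⟨O, hO, hAO, hO'⟩ := exists_isOpen_normalize h (hE.trans_ne one_ne_zero)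
  refine ⟨O, fun A' =>
    { toMultilinearMap := ((omega (normalize E (colSection k l A'))
        (colSection k l A')).compLinearMap
        (fderiv ℂ (colSection k l) A').toLinearMap).toMultilinearMap
      map_eq_zero_of_eq' := ((omega (normalize E (colSection k l A'))
        (colSection k l A')).compLinearMap
        (fderiv ℂ (colSection k l) A').toLinearMap).map_eq_zero_of_eq'
      cont := (continuous_omega (normalize E (colSection k l A')) (colSection k l A')).comp
        (continuous_pi fun i => (fderiv ℂ (colSection k l) A').continuous.comp
          (continuous_apply i)) }, hO, hAO, ?_, ?_⟩
  · intro A' hA'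
    refine (differentiableAt_of_forall_apply fun v => ?_).differentiableWithinAt
    refine differentiableAt_omega (differentiableAt_normalize (hO' A' hA').1 (hO' A' hA').2)
      (differentiableAt_colSection (hO' A' hA').1) fun i => ?_
    exact differentiableAt_fderiv_apply (contDiffAt_colSection (hO' A' hA').1 2) (v i)
  · intro A' hA' v
    exact sigmaH_apply (colSection_mem A'.2 (hO' _ hA').1) (polar_normalize (hO' _ hA').2)
      (fun i => polar_fderiv_colSection A'.2 (hO' _ hA').1 (v i).2) A'
      (beta_colSection A'.2 (hO' _ hA').1) v
      fun i => dbeta_fderiv_colSection A'.2 (hO' _ hA').1 (v i).2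

/-! ### Nonvanishing of σ_ℍ and holomorphic frames on Ẽ_ℍ -/

theorem dbeta_eq_zero_of_mem_vertical {B V : BSpace n} (h : V ∈ vertical B) : dbeta B V = 0 := by
  have hY : ∀ Y : Matrix (Fin 2) (Fin 2) ℂ, Y.trace = 0 → dbeta B (rightField Y B) = 0 := by
    intro Y hY
    have h1 : J * Yᵀ + Y * J = 0 := by
      rw [Matrix.trace_fin_two] at hY
      ext a b
      fin_cases a <;> fin_cases b <;>
        simp [J, Matrix.mul_apply, Matrix.vecMul, dotProduct, Fin.sum_univ_two]
      · linear_combination hY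
      · linear_combination -hY
    have h2 : dbeta B (rightField Y B) =
        -(mat n B * (J * Yᵀ + Y * J) * (mat n B)ᵀ * JJ n) := by
      simp only [dbeta_apply, betaForm_apply, mat_rightField, Matrix.transpose_mul, Matrix.mul_add,
        Matrix.add_mul, Matrix.mul_assoc, neg_add]
    rw [h2, h1]
    simp
  have h1 : vertical B ≤ LinearMap.ker (dbeta B) := by
    rw [vertical, Submodule.span_le]
    rintro v (rfl | rfl | rfl)
    exacts [hY _ trace_Y1, hY _ trace_Y2, hY _ trace_Y3]
  exact h1 h

theorem exists_span_sigmaH_ne_zero (A : tildeEH n) :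
    ∃ v : Fin (4 * n) → tangentSpace ℂ (tildeEH n) (A : CMat n),
      ⊤ ≤ Submodule.span ℂ (Set.range v) ∧ sigmaH n A v ≠ 0 := by
  obtain ⟨A, hA⟩ := A
  obtain ⟨B, hB, rfl⟩ := exists_beta_eq hA
  obtain ⟨u, hu, hspan, hne⟩ := exists_omega_ne_zero hB (polar_Z hB)
  refine ⟨fun i => ⟨dbeta B (u i), dbeta_mem_tangentSpace hB (hu i)⟩, ?_, ?_⟩
  · rintro ⟨v, hv⟩ -
    obtain ⟨w, hw, rfl⟩ := exists_dbeta_eq hB hv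
    obtain ⟨a, ha, c, hc, rfl⟩ := Submodule.mem_sup.1 (hspan hw)
    have h1 : dbeta B (a + c) ∈ Submodule.map (dbeta B) (Submodule.span ℂ (Set.range u)) :=
      ⟨c, hc, by rw [map_add, dbeta_eq_zero_of_mem_vertical ha, zero_add]⟩
    rw [Submodule.map_span, ← Set.range_comp] at h1
    obtain ⟨y, hy, hyv⟩ : dbeta B (a + c) ∈ Submodule.map
        (tangentSpace ℂ (tildeEH n) (beta n B)).subtype (Submodule.span ℂ (Set.range fun i =>
          (⟨dbeta B (u i), dbeta_mem_tangentSpace hB (hu i)⟩ :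
            tangentSpace ℂ (tildeEH n) (beta n B)))) := by
      rw [Submodule.map_span, ← Set.range_comp]
      exact h1
    have h2 : y = ⟨dbeta B (a + c), hv⟩ := Subtype.ext hyv
    rwa [← h2]
  · rw [sigmaH_apply hB (polar_Z hB) hu _ rfl _ fun i => rfl]
    exact hne

/-- Gives holomorphic tangent fields on which σ_ℍ is a nonvanishing holomorphic function, so that f
can be recovered from f·σ_ℍ by a holomorphic formula. -/
theorem exists_local_frame (A : tildeEH n) :
    ∃ (O : Set (CMat n)) (h : CMat n → ℂ) (e : Fin (4 * n) → CMat n → CMat n),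
      IsOpen O ∧ (A : CMat n) ∈ O ∧ DifferentiableOn ℂ h O ∧ (∀ i, DifferentiableOn ℂ (e i) O) ∧
      (∀ A' ∈ O, h A' ≠ 0) ∧ ∀ A' : tildeEH n, (A' : CMat n) ∈ O →
        ∃ he : ∀ i, e i A' ∈ tangentSpace ℂ (tildeEH n) (A' : CMat n),
          sigmaH n A' (fun i => ⟨e i A', he i⟩) = h A' := by
  obtain ⟨A, hA⟩ := A
  obtain ⟨k, l, hkl⟩ := exists_pivot_ne_zero hA
  obtain ⟨E, hE, -⟩ := exists_polar_eq_one (colSection_mem hA hkl)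
  obtain ⟨u, hu, -, hne⟩ := exists_omega_ne_zero (colSection_mem hA hkl) hE
  obtain ⟨O, hO, hAO, hO'⟩ := exists_isOpen_normalize hkl (hE.trans_ne one_ne_zero)
  set N : CMat n → BSpace n := fun A' => normalize E (colSection k l A') with hN
  -- Constant vectors leave ker dD as the point moves; they are projected back along the normalized
  -- E.
  set w : Fin (4 * n) → CMat n → BSpace n :=
    fun i A' => u i - polar (colSection k l A') (u i) • N A' with hw
  have hNd : ∀ A' ∈ O, DifferentiableAt ℂ N A' := fun A' hA' =>
    differentiableAt_normalize (hO' A' hA').1 (hO' A' hA').2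
  have hwd : ∀ i, ∀ A' ∈ O, DifferentiableAt ℂ (w i) A' := fun i A' hA' =>
    (differentiableAt_const _).sub ((differentiableAt_polar
      (differentiableAt_colSection (hO' A' hA').1) (differentiableAt_const _)).smul (hNd A' hA'))
  have hwp : ∀ i, ∀ A' ∈ O, polar (colSection k l A') (w i A') = 0 := fun i A' hA' => by
    rw [hw, map_sub, map_smul, polar_normalize (hO' A' hA').2, smul_eq_mul, mul_one, sub_self]
  set h : CMat n → ℂ := fun A' => omega (N A') (colSection k l A') (fun i => w i A') with hh
  have hhd : ∀ A' ∈ O, DifferentiableAt ℂ h A' := fun A' hA' =>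
    differentiableAt_omega (hNd A' hA') (differentiableAt_colSection (hO' A' hA').1)
      fun i => hwd i A' hA'
  have hhA : h A ≠ 0 := by
    have h1 : N A = E := by simp only [hN, normalize, hE, inv_one, one_smul]
    have h2 : (fun i => w i A) = u := by
      funext i
      simp only [hw, hu, zero_smul, sub_zero]
    simp only [hh, h1, h2]
    exact hne
  obtain ⟨O', hO1, hO2, hO3⟩ := eventually_nhds_iff.1
    (((hhd A hAO).continuousAt.eventually_ne hhA).and (hO.mem_nhds hAO))
  refine ⟨O', h, fun i A' => dbeta (colSection k l A') (w i A'), hO2, hO3,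
    fun A' hA' => (hhd A' (hO1 A' hA').2).differentiableWithinAt,
    fun i A' hA' => (differentiableAt_dbeta (differentiableAt_colSection
      (hO' A' (hO1 A' hA').2).1) (hwd i A' (hO1 A' hA').2)).differentiableWithinAt,
    fun A' hA' => (hO1 A' hA').1, fun A' hA' => ?_⟩
  have hA'O := (hO1 A' hA').2
  have hp := (hO' A' hA'O).1
  have he : ∀ i, dbeta (colSection k l A') (w i A') ∈
      tangentSpace ℂ (tildeEH n) (A' : CMat n) := fun i => by
    have h1 := dbeta_mem_tangentSpace (colSection_mem A'.2 hp) (hwp i A' hA'O)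
    rwa [beta_colSection A'.2 hp] at h1
  exact ⟨he, sigmaH_apply (colSection_mem A'.2 hp) (polar_normalize (hO' A' hA'O).2)
    (fun i => hwp i A' hA'O) A' (beta_colSection A'.2 hp) _ fun i => rfl⟩

/-! ## Trivializations of the canonical line bundle -/

section Trivialization

variable {E : Type*} [NormedAddCommGroup E] [NormedSpace ℝ E]
  {F : Type*} [NormedAddCommGroup F] [NormedSpace ℂ F]

/-- Write the image of ξ in ℂ ⊗ F as 1 ⊗ a + i ⊗ b. Both conditions amount to a + ib = 0, since J +
i sends this tensor to 1 ⊗ i(a + ib) + i ⊗ (a + ib). -/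
theorem mem_polarization_iff (X : Set E) (τ : E → F) (x : E) (ξ : ComplexTangent X x) :
    ξ ∈ polarization X τ x ↔ complexDifferential X τ x ξ = 0 := by
  set d := realDifferential X τ x with hd
  obtain ⟨a, b, hab⟩ : ∃ a b : F, d.baseChange ℂ ξ = (1 : ℂ) ⊗ₜ[ℝ] a + Complex.I ⊗ₜ[ℝ] b := by
    generalize d.baseChange ℂ ξ = ζ
    induction ζ using TensorProduct.induction_on with
    | zero => exact ⟨0, 0, by simp⟩
    | tmul c f =>
      refine ⟨c.re • f, c.im • f, ?_⟩
      rw [← TensorProduct.smul_tmul, ← TensorProduct.smul_tmul, ← TensorProduct.add_tmul]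
      congr 1
      apply Complex.ext <;> simp
    | add ζ ζ' h h' =>
      obtain ⟨a, b, h⟩ := h
      obtain ⟨a', b', h'⟩ := h'
      refine ⟨a + a', b + b', ?_⟩
      rw [h, h', TensorProduct.tmul_add, TensorProduct.tmul_add]
      abel
  set m : ℂ ⊗[ℝ] F →ₗ[ℂ] F := (LinearMap.id (R := ℝ) (M := F)).liftBaseChange ℂ with hm
  have hD : ∀ ξ, complexDifferential X τ x ξ = m (d.baseChange ℂ ξ) := by
    intro ξ
    induction ξ using TensorProduct.induction_on with
    | zero => simp
    | tmul c f => simp [complexDifferential, hm, hd]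
    | add ζ ζ' h h' => rw [map_add, map_add, map_add, h, h']
  have hJ : (complexStructure F ∘ₗ d).baseChange ℂ ξ =
      (complexStructure F).baseChange ℂ (d.baseChange ℂ ξ) := by
    rw [LinearMap.baseChange_comp]; rfl
  have hma : m ((1 : ℂ) ⊗ₜ[ℝ] a + Complex.I ⊗ₜ[ℝ] b) = a + Complex.I • b := by simp [hm]
  have key : ((complexStructure F ∘ₗ d).baseChange ℂ + Complex.I • d.baseChange ℂ) ξ =
      (1 : ℂ) ⊗ₜ[ℝ] (Complex.I • (a + Complex.I • b)) + Complex.I ⊗ₜ[ℝ] (a + Complex.I • b) := by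
    rw [LinearMap.add_apply, LinearMap.smul_apply, hJ, hab]
    simp only [map_add, LinearMap.baseChange_tmul, complexStructure,
      LinearMap.restrictScalars_apply,
      LinearMap.lsmul_apply, smul_add, TensorProduct.smul_tmul', smul_eq_mul, mul_one,
      Complex.I_mul_I, smul_smul, TensorProduct.tmul_add, neg_smul, one_smul,
      TensorProduct.tmul_neg, TensorProduct.neg_tmul]
    abel
  rw [polarization, LinearMap.mem_ker, key, hD, hab, hma]
  constructor
  · intro h
    -- Contracting the tensor identity to F gives 2i(a + ib) = 0.
    have h1 := congrArg m h
    simp only [map_add, map_zero] at h1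
    simp only [hm, LinearMap.liftBaseChange_tmul, LinearMap.id_apply, one_smul] at h1
    rw [← two_smul ℂ, smul_smul] at h1
    exact (smul_eq_zero.1 h1).resolve_left (by simp)
  · intro h
    rw [h]
    simp

/-- A spanning family on which ω does not vanish is automatically a basis, and forms of top degree
are proportional. -/
theorem eq_smul_of_span {V : Type*} [AddCommGroup V] [Module ℂ V] {k : ℕ}
    (ω η : V [⋀^Fin k]→ₗ[ℂ] ℂ) {u : Fin k → V} (hu : ⊤ ≤ Submodule.span ℂ (Set.range u))
    (hω : ω u ≠ 0) : η = (η u / ω u) • ω := by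
  have hli : LinearIndependent ℂ u := by
    by_contra h
    exact hω (ω.map_linearDependent u h)
  let b := Module.Basis.mk hli hu
  have hb : ⇑b = u := Module.Basis.coe_mk hli hu
  rw [η.eq_smul_basis_det b, hb]
  conv_rhs => rw [ω.eq_smul_basis_det b, hb]
  have h1 : b.det u = 1 := by rw [← hb, b.det_self]
  simp only [AlternatingMap.smul_apply, h1, smul_eq_mul, mul_one, smul_smul]
  rw [div_mul_cancel₀ _ hω]

variable {X : Set E} {Y : Set F} {τ : E → F} {k : ℕ}

theorem complexPullback_mem (hτ : Set.MapsTo τ X Y) (ω : DiffForm Y k) (x : X) :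
    complexPullback hτ ω x ∈ canonicalFiber X τ k x := by
  rintro v ⟨i, hi⟩
  rw [mem_polarization_iff] at hi
  exact (ω ⟨τ x, hτ x.2⟩).map_coord_zero i (Subtype.ext hi)

/-- Stated for an arbitrary τ with differential onto the complex tangent space, to cover both the
identity of Ẽ_ℍ and τ_ℍ. -/
theorem exists_isHolomorphicTrivialization (ω : DiffForm Y k) (hω : IsHolomorphic ω)
    (hspan : ∀ A : Y, ∃ v : Fin k → tangentSpace ℂ Y (A : F),
      ⊤ ≤ Submodule.span ℂ (Set.range v) ∧ ω A v ≠ 0)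
    (hframe : ∀ A : Y, ∃ (O : Set F) (h : F → ℂ) (e : Fin k → F → F),
      IsOpen O ∧ (A : F) ∈ O ∧ DifferentiableOn ℂ h O ∧ (∀ i, DifferentiableOn ℂ (e i) O) ∧
      (∀ A' ∈ O, h A' ≠ 0) ∧ ∀ A' : Y, (A' : F) ∈ O →
        ∃ he : ∀ i, e i A' ∈ tangentSpace ℂ Y (A' : F), ω A' (fun i => ⟨e i A', he i⟩) = h A')
    (hτ : Set.MapsTo τ X Y)
    (hsurj : ∀ x ∈ X, ∀ v ∈ tangentSpace ℂ Y (τ x), ∃ ξ, complexDifferential X τ x ξ = v) :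
    ∃ φ : ∀ x : X, ℂ ≃ₗ[ℂ] canonicalFiber X τ k (x : E),
      IsHolomorphicTrivialization X τ k φ ∧ ∀ x, (φ x 1).1 = complexPullback hτ ω x := by
  have hne : ∀ x : X, complexPullback hτ ω x ≠ 0 := by
    intro x h
    obtain ⟨v, -, hv⟩ := hspan ⟨τ x, hτ x.2⟩
    choose ξ hξ using fun i => hsurj x x.2 (v i) (v i).2
    apply hv
    have h1 := congrArg (fun η => η ξ) h
    have h2 : v = fun i => ⟨complexDifferential X τ x (ξ i), complexDifferential_mem hτ x _⟩ :=
      funext fun i => Subtype.ext (hξ i).symm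
    rw [h2]
    exact h1
  have hex : ∀ x : X, ∀ η ∈ canonicalFiber X τ k (x : E),
      ∃ c : ℂ, c • complexPullback hτ ω x = η := by
    intro x η hη
    set P := LinearMap.codRestrict (tangentSpace ℂ Y (τ (x : E)))
      (complexDifferential X τ (x : E)) (complexDifferential_mem hτ (x : E)) with hP
    have hPs : LinearMap.range P = ⊤ := by
      refine LinearMap.range_eq_top.2 fun v => ?_
      obtain ⟨ξ, hξ⟩ := hsurj x x.2 v v.2
      exact ⟨ξ, Subtype.ext hξ⟩
    -- The form η kills ker P = 𝒢, so it is recovered from its pullback by a linear section s of P;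
    -- that pullback is a top-degree form, hence a multiple of ω.
    obtain ⟨s, hs⟩ := P.exists_rightInverse_of_surjective hPs
    have hs' : ∀ w, P (s w) = w := fun w => LinearMap.congr_fun hs w
    obtain ⟨v, hv, hv0⟩ := hspan ⟨τ x, hτ x.2⟩
    refine ⟨η.compLinearMap s v / ω ⟨τ x, hτ x.2⟩ v, ?_⟩
    ext ξ
    have h1 := eq_smul_of_span (ω ⟨τ x, hτ x.2⟩) (η.compLinearMap s) hv hv0
    have h2 := congrArg (fun θ => θ fun i => P (ξ i)) h1
    refine h2.symm.trans ?_
    refine η.eq_of_sub_mem (polarization X τ x) hη fun i => ?_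
    rw [mem_polarization_iff]
    have h3 : P (s (P (ξ i)) - ξ i) = 0 := by rw [map_sub, hs', sub_self]
    exact congrArg Subtype.val h3
  let φ : ∀ x : X, ℂ ≃ₗ[ℂ] canonicalFiber X τ k (x : E) := fun x =>
    LinearEquiv.ofBijective (LinearMap.toSpanSingleton ℂ (canonicalFiber X τ k (x : E))
      ⟨complexPullback hτ ω x, complexPullback_mem hτ ω x⟩) (by
        constructor
        · rw [← LinearMap.ker_eq_bot, LinearMap.ker_toSpanSingleton]
          exact fun h => hne x (congrArg Subtype.val h)
        · rintro ⟨η, hη⟩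
          obtain ⟨c, hc⟩ := hex x η hη
          exact ⟨c, Subtype.ext hc⟩)
  have hφ : ∀ x c, (φ x c).1 = c • complexPullback hτ ω x := fun _ _ => rfl
  refine ⟨φ, ?_, fun x => by rw [hφ, one_smul]⟩
  intro U _ f
  constructor
  · intro hf x hx
    obtain ⟨O, g, hO, hxO, hg, hfg⟩ := hf x hx
    obtain ⟨O', Ω, hO', hxO', hΩ, hΩω⟩ := hω ⟨τ x, hτ x.2⟩
    refine ⟨O ∩ O', fun a => g a • Ω a, hO.inter hO', ⟨hxO, hxO'⟩,
      (hg.mono Set.inter_subset_left).smul (hΩ.mono Set.inter_subset_right), ?_⟩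
    intro y hy hyO v
    rw [hφ, hfg y hy hyO.1]
    refine congrArg (g (τ y) * ·) ?_
    exact hΩω ⟨τ y, hτ y.2⟩ hyO.2 _
  · intro hs x hx
    obtain ⟨O, Ω, hO, hxO, hΩ, hsΩ⟩ := hs x hx
    obtain ⟨O', h, e, hO', hxO', hh, he, hne', hhe⟩ := hframe ⟨τ x, hτ x.2⟩
    -- Evaluating s = f·ω on the frame e gives Ω(e) = f·h.
    refine ⟨O ∩ O', fun a => Ω a (fun i => e i a) * (h a)⁻¹, hO.inter hO', ⟨hxO, hxO'⟩, ?_, ?_⟩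
    · refine DifferentiableOn.mul ?_ ((hh.mono Set.inter_subset_right).inv fun a ha => hne' a ha.2)
      exact (hΩ.mono Set.inter_subset_left).continuousAlternatingMap_apply
        fun i => (he i).mono Set.inter_subset_right
    · intro y hy hyO
      obtain ⟨hev, heq⟩ := hhe ⟨τ y, hτ y.2⟩ hyO.2
      choose ξ hξ using fun i => hsurj y y.2 _ (hev i)
      have h1 := hsΩ y hy hyO.1 ξ
      rw [hφ] at h1
      have h2 : complexPullback hτ ω y ξ = h (τ y) := by
        rw [← heq]
        exact congrArg (ω ⟨τ y, hτ y.2⟩) (funext fun i => Subtype.ext (hξ i))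
      rw [AlternatingMap.smul_apply, h2, smul_eq_mul] at h1
      simp only [hξ] at h1
      exact (eq_mul_inv_iff_mul_eq₀ (hne' _ hyO.2)).2 h1

end Trivialization

/-! ## Quaternionic real and imaginary parts -/

section Parts

variable {l m k : Type*}

/-- The quaternion `x` in the decomposition `M = ρ(x) + √-1 ρ(y)` of a `2 × 2` matrix, given the
entries of `M`. -/
def entryRe (a b c d : ℂ) : ℍ[ℝ] :=
  ⟨(a.re + d.re) / 2, (a.im - d.im) / 2, (b.re - c.re) / 2, (b.im + c.im) / 2⟩

@[simp] theorem entryRe_re (a b c d : ℂ) : (entryRe a b c d).re = (a.re + d.re) / 2 := rfl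
@[simp] theorem entryRe_imI (a b c d : ℂ) : (entryRe a b c d).imI = (a.im - d.im) / 2 := rfl
@[simp] theorem entryRe_imJ (a b c d : ℂ) : (entryRe a b c d).imJ = (b.re - c.re) / 2 := rfl
@[simp] theorem entryRe_imK (a b c d : ℂ) : (entryRe a b c d).imK = (b.im + c.im) / 2 := rfl

/-- The matrix `X` in the decomposition `M = ρ(X) + √-1 ρ(Y)`. -/
def quatRe (l m : Type*) : Matrix (l × Fin 2) (m × Fin 2) ℂ →ₗ[ℝ] Matrix l m ℍ[ℝ] where
  toFun M := Matrix.of fun i j =>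
    entryRe (M (i, 0) (j, 0)) (M (i, 0) (j, 1)) (M (i, 1) (j, 0)) (M (i, 1) (j, 1))
  map_add' M N := by
    ext i j <;> simp <;> ring
  map_smul' c M := by
    ext i j <;> simp <;> ring

@[simp] theorem quatRe_apply (M : Matrix (l × Fin 2) (m × Fin 2) ℂ) (i : l) (j : m) :
    quatRe l m M i j =
      entryRe (M (i, 0) (j, 0)) (M (i, 0) (j, 1)) (M (i, 1) (j, 0)) (M (i, 1) (j, 1)) := rfl

theorem quatRe_rhoMat (X : Matrix l m ℍ[ℝ]) : quatRe l m (rhoMat X) = X := by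
  ext i j <;> simp [rhoMat, rho]

theorem quatRe_I_smul_rhoMat (X : Matrix l m ℍ[ℝ]) :
    quatRe l m (Complex.I • rhoMat X) = 0 := by
  ext i j <;> simp [rhoMat, rho]

/-- The matrix `Y` in the decomposition `M = ρ(X) + √-1 ρ(Y)`. -/
def quatIm (l m : Type*) : Matrix (l × Fin 2) (m × Fin 2) ℂ →ₗ[ℝ] Matrix l m ℍ[ℝ] where
  toFun M := quatRe l m (-Complex.I • M)
  map_add' M N := by rw [smul_add, map_add]
  map_smul' c M := by rw [smul_comm, map_smul]; rfl

theorem quatIm_apply (M : Matrix (l × Fin 2) (m × Fin 2) ℂ) :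
    quatIm l m M = quatRe l m (-Complex.I • M) := rfl

theorem rhoMat_neg (X : Matrix l m ℍ[ℝ]) : rhoMat (-X) = -rhoMat X := by
  rw [eq_neg_iff_add_eq_zero, ← rhoMat_add, neg_add_cancel, rhoMat_zero]

theorem rhoMat_sub (X Y : Matrix l m ℍ[ℝ]) : rhoMat (X - Y) = rhoMat X - rhoMat Y := by
  rw [sub_eq_add_neg, rhoMat_add, rhoMat_neg, sub_eq_add_neg]

theorem rhoMat_smul (c : ℝ) (X : Matrix l m ℍ[ℝ]) : rhoMat (c • X) = (c : ℂ) • rhoMat X := by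
  ext ⟨i, a⟩ ⟨j, b⟩
  fin_cases a <;> fin_cases b <;> simp [rhoMat, rho] <;> ring

theorem quatRe_add (X Y : Matrix l m ℍ[ℝ]) :
    quatRe l m (rhoMat X + Complex.I • rhoMat Y) = X := by
  rw [map_add, quatRe_rhoMat, quatRe_I_smul_rhoMat, add_zero]

theorem quatIm_add (X Y : Matrix l m ℍ[ℝ]) :
    quatIm l m (rhoMat X + Complex.I • rhoMat Y) = Y := by
  have h : -Complex.I • (rhoMat X + Complex.I • rhoMat Y) =
      rhoMat Y + Complex.I • rhoMat (-X) := by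
    rw [smul_add, smul_smul, rhoMat_neg]
    simp [add_comm]
  rw [quatIm_apply, h, quatRe_add]

theorem rhoMat_quatRe_add (M : Matrix (l × Fin 2) (m × Fin 2) ℂ) :
    rhoMat (quatRe l m M) + Complex.I • rhoMat (quatIm l m M) = M := by
  ext ⟨i, a⟩ ⟨j, b⟩
  fin_cases a <;> fin_cases b <;> apply Complex.ext <;>
    simp [quatIm_apply, rhoMat, rho] <;> ring

theorem rhoMat_add_I_smul_inj {X Y X' Y' : Matrix l m ℍ[ℝ]}
    (h : rhoMat X + Complex.I • rhoMat Y = rhoMat X' + Complex.I • rhoMat Y') :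
    X = X' ∧ Y = Y' :=
  ⟨by rw [← quatRe_add X Y, h, quatRe_add], by rw [← quatIm_add X Y, h, quatIm_add]⟩

theorem conjTranspose_rhoMat (X : Matrix l m ℍ[ℝ]) : (rhoMat X)ᴴ = rhoMat Xᴴ := by
  ext ⟨i, a⟩ ⟨j, b⟩
  fin_cases a <;> fin_cases b <;> simp [rhoMat, rho, Matrix.conjTranspose_apply]

theorem rhoMat_mul_add [Fintype m] (X Y : Matrix l m ℍ[ℝ]) (X' Y' : Matrix m k ℍ[ℝ]) :
    (rhoMat X + Complex.I • rhoMat Y) * (rhoMat X' + Complex.I • rhoMat Y') =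
      rhoMat (X * X' - Y * Y') + Complex.I • rhoMat (X * Y' + Y * X') := by
  simp only [rhoMat_sub, rhoMat_add, rhoMat_mul, Matrix.add_mul, Matrix.mul_add, Matrix.smul_mul,
    Matrix.mul_smul, smul_smul, Complex.I_mul_I, smul_add, neg_smul, one_smul]
  abel

/-- Expresses the quaternionic adjoint by transposition, so that it extends complex linearly to ρ(X)
+ iρ(Y); the conjugate transpose extends antilinearly. `exists_tauH_eq` plays the two extensions
against each other. -/
theorem rhoMat_conjTranspose_eq {n m : ℕ} (X : Matrix (Fin (n + 1)) (Fin (m + 1)) ℍ[ℝ]) :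
    rhoMat Xᴴ = -(JJ m * (rhoMat X)ᵀ * JJ n) := by
  have h : JJ m * rhoMat Xᴴ = (rhoMat X)ᵀ * JJ n := by
    ext ⟨i, a⟩ ⟨j, b⟩
    have := congrFun (congrFun (J_mul_rho (Xᴴ i j)) a) b
    simpa [Matrix.mul_apply, Fintype.sum_prod_type, JJ_apply, rhoMat, Fin.sum_univ_two,
      ite_mul, mul_ite, Finset.sum_add_distrib] using this
  rw [Matrix.mul_assoc, ← h, ← Matrix.mul_assoc, JJ_mul_JJ]
  simp

end Parts

/-! ## Normalized bases -/

open scoped ComplexOrder in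
theorem exists_conjTranspose_mul_mul_eq_smul_one {H : Matrix (Fin 2) (Fin 2) ℂ}
    (hH : H.PosDef) : ∃ (G : Matrix (Fin 2) (Fin 2) ℂ) (c : ℝ), G.det = 1 ∧ 0 < c ∧
      Gᴴ * H * G = (c : ℂ) • 1 := by
  obtain ⟨a, ha, hHa⟩ := RCLike.pos_iff_exists_ofReal.1 (hH.diag_pos (i := 0))
  obtain ⟨δ, hδ, hHδ⟩ := RCLike.pos_iff_exists_ofReal.1 hH.det_pos
  have h10 : H 1 0 = (starRingEnd ℂ) (H 0 1) := (hH.isHermitian.apply 1 0).symm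
  rw [Matrix.det_fin_two, h10] at hHδ
  set γ := H 0 1
  -- G is triangular as in Gram–Schmidt. With det G = 1 the two diagonal entries become t²a and
  -- δ/(t²a), where δ = det H; they agree when t⁴a² = δ.
  set t : ℝ := Real.sqrt (Real.sqrt δ / a)
  have ha' : (a : ℂ) ≠ 0 := by exact_mod_cast ha.ne'
  have ht : 0 < t := Real.sqrt_pos.2 (div_pos (Real.sqrt_pos.2 hδ) ha)
  have ht' : (t : ℂ) ≠ 0 := by exact_mod_cast ht.ne'
  have ht2 : t ^ 2 * a = Real.sqrt δ := by
    rw [Real.sq_sqrt (div_nonneg (Real.sqrt_nonneg δ) ha.le), div_mul_cancel₀ _ ha.ne']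
  have ht4 : (t : ℂ) ^ 4 * a ^ 2 = δ := by
    have : t ^ 4 * a ^ 2 = δ := by
      rw [← Real.sq_sqrt hδ.le, ← ht2]
      ring
    exact_mod_cast this
  refine ⟨!![(t : ℂ), -γ / (a * t); 0, 1 / t], t ^ 2 * a, ?_, by positivity, ?_⟩
  · simp [Matrix.det_fin_two, ht']
  · have hδ' : (a : ℂ) * H 1 1 - γ * (starRingEnd ℂ) γ = (t : ℂ) ^ 4 * a ^ 2 := by
      rw [ht4]
      exact (congrArg (fun x => x * H 1 1 - γ * (starRingEnd ℂ) γ) hHa).trans hHδ.symm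
    have hHa' : H 0 0 = a := hHa.symm
    have hγ : H 0 1 = γ := rfl
    ext i j
    fin_cases i <;> fin_cases j <;>
      simp [Matrix.mul_apply, Fin.sum_univ_two, Matrix.conjTranspose_apply, h10, hHa', hγ] <;>
      field_simp
    · ring
    · left
      ring
    · linear_combination hδ'

/-! ## The map `τ_ℍ` is onto -/

theorem sq_hNorm (Q : HMat n) : hNorm Q ^ 2 = ∑ i, ∑ j, ‖Q i j‖ ^ 2 :=
  Real.sq_sqrt (Finset.sum_nonneg fun _ _ => Finset.sum_nonneg fun _ _ => by positivity)

theorem re_sum {ι : Type*} (s : Finset ι) (f : ι → ℍ[ℝ]) :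
    (∑ i ∈ s, f i).re = ∑ i ∈ s, (f i).re :=
  map_sum (AddMonoidHom.mk' (fun x : ℍ[ℝ] => x.re) fun _ _ => rfl) f s

theorem conjTranspose_real_smul {l m : Type*} (c : ℝ) (X : Matrix l m ℍ[ℝ]) :
    (c • X)ᴴ = c • Xᴴ := by
  ext i j <;> simp

theorem sum_norm_sq_eq_re_trace {l m : Type*} [Fintype l] [Fintype m] (X : Matrix l m ℍ[ℝ]) :
    ∑ i, ∑ j, ‖X i j‖ ^ 2 = (X * Xᴴ).trace.re := by
  have h : ∀ x : ℍ[ℝ], (x * star x).re = ‖x‖ ^ 2 := fun x => by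
    rw [Quaternion.self_mul_star, Quaternion.re_coe, Quaternion.normSq_eq_norm_mul_self, sq]
  simp only [Matrix.trace, Matrix.diag, Matrix.mul_apply, Matrix.conjTranspose_apply, re_sum, h]

theorem hNorm_nonneg (Q : HMat n) : 0 ≤ hNorm Q := Real.sqrt_nonneg _

theorem tauH_eq (P Q : HMat n) : tauH n (P, Q) =
    rhoMat (hNorm Q ^ 2 • P - Q * Q) + Complex.I • rhoMat ((hNorm Q / Real.sqrt 2) • Q) := by
  rw [rhoMat_sub, rhoMat_smul, rhoMat_smul, rhoMat_mul, smul_smul, tauH, sq (rhoMat Q)]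
  push_cast
  congr 2
  ring

theorem hNorm_pos {Q : HMat n} (hQ : Q ≠ 0) : 0 < hNorm Q := by
  refine Real.sqrt_pos.2 ?_
  obtain ⟨i, j, hij⟩ : ∃ i j, Q i j ≠ 0 := by
    by_contra! h
    exact hQ (Matrix.ext h)
  refine Finset.sum_pos' (fun _ _ => by positivity) ⟨i, Finset.mem_univ i, ?_⟩
  exact Finset.sum_pos' (fun _ _ => by positivity) ⟨j, Finset.mem_univ j, by positivity⟩

theorem hNorm_smul {c : ℝ} (hc : 0 ≤ c) (Q : HMat n) : hNorm (c • Q) = c * hNorm Q := by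
  have h : ∑ i, ∑ j, ‖(c • Q) i j‖ ^ 2 = c ^ 2 * ∑ i, ∑ j, ‖Q i j‖ ^ 2 := by
    simp only [Finset.mul_sum, Matrix.smul_apply, norm_smul, mul_pow, Real.norm_eq_abs, sq_abs]
  rw [hNorm, h, Real.sqrt_mul (sq_nonneg c), Real.sqrt_sq hc, hNorm]

/-- The pair attached to a column `p` of norm `1` and an orthogonal column `q`. -/
theorem exists_tauH_eq_of_columns (a b : Matrix (Fin (n + 1)) (Fin 1) ℍ[ℝ]) {s : ℝ} (hs : 0 < s)
    (haa : aᴴ * a = (s ^ 2) • 1) (hbb : bᴴ * b = (s ^ 2) • 1) (hab : aᴴ * b = 0) :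
    ∃ x ∈ EH n, tauH n x =
      (rhoMat a + Complex.I • rhoMat b) * (rhoMat aᴴ + Complex.I • rhoMat bᴴ) := by
  have hba : bᴴ * a = 0 := by
    have := congrArg Matrix.conjTranspose hab
    simpa [Matrix.conjTranspose_mul] using this
  have hs' : s ≠ 0 := hs.ne'
  set p := s⁻¹ • a with hp
  have hap : a = s • p := by rw [hp, smul_smul, mul_inv_cancel₀ hs', one_smul]
  have hpp : pᴴ * p = 1 := by
    rw [hp, conjTranspose_real_smul, Matrix.smul_mul, Matrix.mul_smul, haa, smul_smul, smul_smul,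
      show s⁻¹ * s⁻¹ * s ^ 2 = 1 by field_simp, one_smul]
  have hpb : pᴴ * b = 0 := by
    rw [hp, conjTranspose_real_smul, Matrix.smul_mul, hab, smul_zero]
  have hbp : bᴴ * p = 0 := by rw [hp, Matrix.mul_smul, hba, smul_zero]
  set P : HMat n := p * pᴴ with hP
  set Q : HMat n := p * bᴴ + b * pᴴ with hQ
  have hQH : Qᴴ = Q := by
    rw [hQ, Matrix.conjTranspose_add, Matrix.conjTranspose_mul, Matrix.conjTranspose_mul,
      Matrix.conjTranspose_conjTranspose, Matrix.conjTranspose_conjTranspose]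
    exact add_comm _ _
  have hQQ : Q * Q = s ^ 2 • P + b * bᴴ := by
    calc (p * bᴴ + b * pᴴ) * (p * bᴴ + b * pᴴ)
        = p * (bᴴ * p) * bᴴ + p * (bᴴ * b) * pᴴ + b * (pᴴ * p) * bᴴ + b * (pᴴ * b) * pᴴ := by
          simp only [Matrix.mul_add, Matrix.add_mul, Matrix.mul_assoc]; abel
      _ = _ := by rw [hbp, hbb, hpp, hpb, hP]; simp
  have hPQ : P * Q = p * bᴴ := by
    calc p * pᴴ * (p * bᴴ + b * pᴴ) = p * (pᴴ * p) * bᴴ + p * (pᴴ * b) * pᴴ := by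
          simp only [Matrix.mul_add, Matrix.mul_assoc]
      _ = _ := by rw [hpp, hpb]; simp
  have hQP : Q * P = b * pᴴ := by
    calc (p * bᴴ + b * pᴴ) * (p * pᴴ) = p * (bᴴ * p) * pᴴ + b * (pᴴ * p) * pᴴ := by
          simp only [Matrix.add_mul, Matrix.mul_assoc]
      _ = _ := by rw [hpp, hbp]; simp
  have hQp : Q * p = b := by
    calc (p * bᴴ + b * pᴴ) * p = p * (bᴴ * p) + b * (pᴴ * p) := by
          simp only [Matrix.add_mul, Matrix.mul_assoc]
      _ = _ := by rw [hpp, hbp]; simp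
  have hnorm : ∀ c : Matrix (Fin (n + 1)) (Fin 1) ℍ[ℝ], ∀ r : ℝ, cᴴ * c = r • 1 →
      (c * cᴴ).trace.re = r := by
    intro c r hc
    rw [← sum_norm_sq_eq_re_trace, Finset.sum_comm]
    have h1 := sum_norm_sq_eq_re_trace cᴴ
    rw [Matrix.conjTranspose_conjTranspose, hc] at h1
    simpa [Matrix.trace] using h1
  -- Both terms of Q contribute s² to ‖Q‖², which is the origin of the factor 1/√2 in τ_ℍ.
  have hh : hNorm Q ^ 2 = 2 * s ^ 2 := by
    rw [sq_hNorm, sum_norm_sq_eq_re_trace, hQH, hQQ, Matrix.trace_add, Matrix.trace_smul,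
      Quaternion.re_add, Quaternion.re_smul, hnorm b _ hbb, hnorm p 1 (by rw [hpp, one_smul])]
    simp
    ring
  have hh' : hNorm Q / Real.sqrt 2 = s := by
    have h1 : hNorm Q = Real.sqrt 2 * s := by
      refine (pow_left_inj₀ (hNorm_nonneg Q) (by positivity) two_ne_zero).1 ?_
      rw [hh, mul_pow, Real.sq_sqrt zero_le_two]
    rw [h1, mul_div_cancel_left₀ _ (by positivity)]
  refine ⟨(P, Q), ⟨⟨fun i => p i 0, ?_, ?_⟩, hQH, ?_, ?_⟩, ?_⟩
  · have h1 := congrFun (congrFun hpp 0) 0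
    simpa [Matrix.mul_apply] using h1
  · ext1 i j
    simp [hP, Matrix.mul_apply]
  · change jordan P Q = (1 / 2 : ℝ) • Q
    rw [jordan, hPQ, hQP]
  · intro h0
    change Q = 0 at h0
    rw [← hQp, h0, Matrix.zero_mul, Matrix.mul_zero] at hbb
    have h1 := congrArg (fun x : ℍ[ℝ] => x.re) (congrFun (congrFun hbb 0) 0)
    simp at h1
    exact (pow_pos hs 2).ne h1
  · have h1 : a * aᴴ = s ^ 2 • P := by
      rw [hap, conjTranspose_real_smul, Matrix.smul_mul, Matrix.mul_smul, smul_smul, ← sq]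
    have h2 : a * bᴴ + b * aᴴ = s • Q := by
      rw [hap, conjTranspose_real_smul, Matrix.smul_mul, Matrix.mul_smul, ← smul_add]
    have h3 : (2 * s ^ 2) • P - (s ^ 2 • P + b * bᴴ) = s ^ 2 • P - b * bᴴ := by
      rw [two_mul, add_smul]
      abel
    rw [tauH_eq, hh, hh', rhoMat_mul_add, hQQ, h1, h2, h3]

open scoped ComplexOrder in
/-- Every point of `Ẽ_ℍ` has a preimage under `β` whose columns are orthogonal, of equal norm. -/
theorem exists_beta_eq_conjTranspose_mul_self {A : CMat n} (hA : A ∈ tildeEH n) :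
    ∃ (B : BSpace n) (c : ℝ), D n B = 0 ∧ beta n B = A ∧ 0 < c ∧
      (mat n B)ᴴ * mat n B = (c : ℂ) • 1 := by
  obtain ⟨B, hB, rfl⟩ := exists_beta_eq hA
  obtain ⟨L, hL⟩ := exists_mul_mat_eq_one hB
  have hpos : ((mat n B)ᴴ * mat n B).PosDef := by
    refine Matrix.PosDef.conjTranspose_mul_self _ fun u v huv => ?_
    have := congrArg (L.mulVec ·) huv
    simpa [Matrix.mulVec_mulVec, hL] using this
  obtain ⟨G, c, hG, hc, h⟩ := exists_conjTranspose_mul_mul_eq_smul_one hpos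
  refine ⟨act 1 G B, c, ?_, by rw [beta_act_one, hG, one_smul], hc, ?_⟩
  · rw [D_act (by simp), hB.2, mul_zero]
  · rw [← h, mat_act, Matrix.one_mul, Matrix.conjTranspose_mul]
    simp only [Matrix.mul_assoc]

/-- Write the normalized preimage as M = ρ(a) + iρ(b) with quaternionic columns a and b. Isotropy
gives a*a = b*b and a*b + b*a = 0; orthonormality up to scale gives a*a + b*b = c and a*b = b*a.
Hence a and b are orthogonal of equal norm, and β(B) is the product reached by
`exists_tauH_eq_of_columns`. -/
theorem exists_tauH_eq {A : CMat n} (hA : A ∈ tildeEH n) : ∃ x ∈ EH n, tauH n x = A := by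
  obtain ⟨B, c, hD, rfl, hc, hBc⟩ := exists_beta_eq_conjTranspose_mul_self hA
  -- The two complex columns form one quaternionic column, so the column index must be written as a
  -- 2×2 block.
  let e : Fin 1 × Fin 2 ≃ Fin 2 := Equiv.uniqueProd (Fin 2) (Fin 1)
  set M : Matrix (Fin (n + 1) × Fin 2) (Fin 1 × Fin 2) ℂ := (mat n B).submatrix id e with hM
  have hJ : JJ 0 = J.submatrix e e := by
    ext ⟨i, a⟩ ⟨j, b⟩
    rw [JJ_apply, if_pos (Subsingleton.elim (α := Fin 1) _ _)]
    rfl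
  set a := quatRe _ _ M with ha
  set b := quatIm _ _ M with hb
  have hab : rhoMat a + Complex.I • rhoMat b = M := rhoMat_quatRe_add M
  have hN : rhoMat aᴴ + Complex.I • rhoMat bᴴ = -(JJ 0 * Mᵀ * JJ n) := by
    rw [rhoMat_conjTranspose_eq (m := 0), rhoMat_conjTranspose_eq (m := 0), ← hab]
    simp only [Matrix.transpose_add, Matrix.transpose_smul, Matrix.mul_add, Matrix.add_mul,
      Matrix.mul_smul, Matrix.smul_mul, neg_add, smul_neg]
  have hM' : Mᴴ = rhoMat aᴴ + Complex.I • rhoMat (-bᴴ) := by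
    rw [← hab, Matrix.conjTranspose_add, Matrix.conjTranspose_smul, conjTranspose_rhoMat,
      conjTranspose_rhoMat, rhoMat_neg, smul_neg, ← neg_smul]
    simp
  have h1 : rhoMat (aᴴ * a - bᴴ * b) + Complex.I • rhoMat (aᴴ * b + bᴴ * a) =
      rhoMat 0 + Complex.I • rhoMat 0 := by
    rw [← rhoMat_mul_add, hN, hab, rhoMat_zero, smul_zero, add_zero]
    have : Mᵀ * JJ n * M = 0 := by
      have h0 : (mat n B)ᵀ * JJ n * mat n B = 0 := by
        rw [transpose_mat_mul_JJ_mul_mat, hD, zero_smul]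
      ext i j
      exact congrFun (congrFun h0 (e i)) (e j)
    rw [Matrix.neg_mul, Matrix.mul_assoc, Matrix.mul_assoc, ← Matrix.mul_assoc Mᵀ, this,
      Matrix.mul_zero, neg_zero]
  have h2 : rhoMat (aᴴ * a - (-bᴴ) * b) + Complex.I • rhoMat (aᴴ * b + (-bᴴ) * a) =
      rhoMat (c • 1) + Complex.I • rhoMat 0 := by
    rw [← rhoMat_mul_add, ← hM', hab, rhoMat_zero, smul_zero, add_zero, rhoMat_real]
    ext i j
    refine (congrFun (congrFun hBc (e i)) (e j)).trans ?_
    simp [Matrix.one_apply]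
  obtain ⟨h3, h4⟩ := rhoMat_add_I_smul_inj h1
  obtain ⟨h5, h6⟩ := rhoMat_add_I_smul_inj h2
  rw [Matrix.neg_mul, sub_neg_eq_add] at h5
  rw [Matrix.neg_mul, ← sub_eq_add_neg] at h6
  have hsq : Real.sqrt (c / 2) ^ 2 = c / 2 := Real.sq_sqrt (by positivity)
  have haa : aᴴ * a = (c / 2) • (1 : Matrix (Fin 1) (Fin 1) ℍ[ℝ]) := by
    have : (2 : ℝ) • (aᴴ * a) = c • 1 := by
      rw [← h5, two_smul]
      exact congrArg _ (sub_eq_zero.1 h3)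
    rw [div_eq_inv_mul, mul_smul, ← this, smul_smul, inv_mul_cancel₀ two_ne_zero, one_smul]
  have hba : aᴴ * b = 0 := by
    have : (2 : ℝ) • (aᴴ * b) = 0 := by
      rw [two_smul, ← h4]
      exact congrArg _ (sub_eq_zero.1 h6)
    exact (smul_eq_zero.1 this).resolve_left two_ne_zero
  obtain ⟨x, hx, hxe⟩ := exists_tauH_eq_of_columns a b (Real.sqrt_pos.2 (half_pos hc))
    (by rw [hsq, haa]) (by rw [hsq, ← haa, sub_eq_zero.1 h3]) hba
  refine ⟨x, hx, ?_⟩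
  rw [hxe, hab, hN, beta_eq, betaForm_apply, hJ, hM]
  simp [Matrix.transpose_submatrix, Matrix.submatrix_mul_equiv, ← Matrix.mul_assoc]

/-! ## The inverse of `τ_ℍ` -/

/-- The inverse of `τ_ℍ` on `Ẽ_ℍ`. -/
def tauInv (n : ℕ) (A : CMat n) : HMat n × HMat n :=
  ((Real.sqrt 2 * hNorm (quatIm _ _ A))⁻¹ •
      ((2 * (Real.sqrt 2 * hNorm (quatIm _ _ A))⁻¹) • (quatIm _ _ A * quatIm _ _ A) +
        quatRe _ _ A),
    (Real.sqrt 2 * (Real.sqrt (Real.sqrt 2 * hNorm (quatIm _ _ A)))⁻¹) • quatIm _ _ A)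

/-- The imaginary part of τ_ℍ(P,Q) is (‖Q‖/√2) Q, so √2 times its norm is ‖Q‖². This recovers ‖Q‖
and Q, and then P from the real part ‖Q‖²P - Q². -/
theorem tauInv_tauH {P Q : HMat n} (hQ : Q ≠ 0) : tauInv n (tauH n (P, Q)) = (P, Q) := by
  have hpos := hNorm_pos hQ
  have h2 : Real.sqrt 2 ^ 2 = 2 := Real.sq_sqrt zero_le_two
  have h2' : Real.sqrt 2 ≠ 0 := by positivity
  have hr : Real.sqrt 2 * hNorm ((hNorm Q / Real.sqrt 2) • Q) = hNorm Q ^ 2 := by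
    rw [hNorm_smul (by positivity)]
    field_simp
  rw [tauInv, tauH_eq, quatRe_add, quatIm_add, hr, Real.sqrt_sq hpos.le, Matrix.smul_mul,
    Matrix.mul_smul, smul_smul, smul_smul, smul_smul]
  have e1 : 2 * (hNorm Q ^ 2)⁻¹ * (hNorm Q / Real.sqrt 2) * (hNorm Q / Real.sqrt 2) = 1 := by
    field_simp
    exact h2.symm
  have e2 : Real.sqrt 2 * (hNorm Q)⁻¹ * (hNorm Q / Real.sqrt 2) = 1 := by
    field_simp
  rw [e1, e2, one_smul, one_smul, add_sub_cancel, smul_smul, inv_mul_cancel₀ (by positivity),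
    one_smul]

theorem tauInv_mem {A : CMat n} (hA : A ∈ tildeEH n) : tauInv n A ∈ EH n := by
  obtain ⟨x, hx, rfl⟩ := exists_tauH_eq hA
  rwa [tauInv_tauH hx.2.2.2]

theorem tauH_tauInv {A : CMat n} (hA : A ∈ tildeEH n) : tauH n (tauInv n A) = A := by
  obtain ⟨x, hx, rfl⟩ := exists_tauH_eq hA
  rw [tauInv_tauH hx.2.2.2]

theorem quatIm_tauH_ne_zero {P Q : HMat n} (hQ : Q ≠ 0) : quatIm _ _ (tauH n (P, Q)) ≠ 0 := by
  rw [tauH_eq, quatIm_add]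
  exact smul_ne_zero (div_pos (hNorm_pos hQ) (by positivity)).ne' hQ

/-! ### Differentiability of τ_ℍ and its inverse, and surjectivity of the complexified differential
-/

theorem _root_.DifferentiableAt.hNorm {E : Type*} [NormedAddCommGroup E] [NormedSpace ℝ E]
    {f : E → HMat n} {x : E} (hf : DifferentiableAt ℝ f x) (h0 : f x ≠ 0) :
    DifferentiableAt ℝ (fun y => HopfForm.hNorm (f y)) x := by
  refine DifferentiableAt.sqrt ?_ (Real.sqrt_pos.1 (hNorm_pos h0)).ne'
  refine DifferentiableAt.fun_sum fun i _ => DifferentiableAt.fun_sum fun j _ => ?_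
  exact (differentiableAt_pi.1 (differentiableAt_pi.1 hf i) j).norm_sq ℝ

theorem differentiableAt_matrix_mul {E : Type*} [NormedAddCommGroup E] [NormedSpace ℝ E]
    {f g : E → HMat n} {x : E} (hf : DifferentiableAt ℝ f x) (hg : DifferentiableAt ℝ g x) :
    DifferentiableAt ℝ (fun y => f y * g y) x := by
  refine differentiableAt_pi.2 fun i => differentiableAt_pi.2 fun j => ?_
  simp only [Matrix.mul_apply]
  exact DifferentiableAt.fun_sum fun k _ =>
    (differentiableAt_pi.1 (differentiableAt_pi.1 hf i) k).mul
      (differentiableAt_pi.1 (differentiableAt_pi.1 hg k) j)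

theorem _root_.LinearMap.differentiableAt_of_finiteDimensional {E F : Type*}
    [NormedAddCommGroup E] [NormedSpace ℝ E] [FiniteDimensional ℝ E] [NormedAddCommGroup F]
    [NormedSpace ℝ F] (f : E →ₗ[ℝ] F) (x : E) : DifferentiableAt ℝ f x :=
  (LinearMap.toContinuousLinearMap f).differentiableAt

instance : FiniteDimensional ℝ (CMat n) := FiniteDimensional.trans ℝ ℂ (CMat n)

theorem differentiableAt_tauInv {A : CMat n} (hA : quatIm _ _ A ≠ 0) :
    DifferentiableAt ℝ (tauInv n) A := by
  have hS : DifferentiableAt ℝ (fun A : CMat n => quatIm (Fin (n + 1)) (Fin (n + 1)) A) A :=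
    (quatIm (Fin (n + 1)) (Fin (n + 1))).differentiableAt_of_finiteDimensional A
  have hR : DifferentiableAt ℝ (fun A : CMat n => quatRe (Fin (n + 1)) (Fin (n + 1)) A) A :=
    (quatRe (Fin (n + 1)) (Fin (n + 1))).differentiableAt_of_finiteDimensional A
  have hr := (hS.hNorm hA).const_mul (Real.sqrt 2)
  have hr0 : Real.sqrt 2 * hNorm (quatIm _ _ A) ≠ 0 :=
    (mul_pos (by positivity) (hNorm_pos hA)).ne'
  have hr1 : Real.sqrt (Real.sqrt 2 * hNorm (quatIm _ _ A)) ≠ 0 :=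
    (Real.sqrt_pos.2 (mul_pos (by positivity) (hNorm_pos hA))).ne'
  exact ((hr.inv hr0).smul ((((hr.inv hr0).const_mul 2).smul
    (differentiableAt_matrix_mul hS hS)).add hR)).prodMk
    ((((hr.sqrt hr0).inv hr1).const_mul (Real.sqrt 2)).smul hS)

/-- `ρ` as a real linear map. -/
def rhoMatLinear (l m : Type*) : Matrix l m ℍ[ℝ] →ₗ[ℝ] Matrix (l × Fin 2) (m × Fin 2) ℂ where
  toFun := rhoMat
  map_add' := rhoMat_add
  map_smul' := rhoMat_smul

instance : FiniteDimensional ℝ (HMat n) :=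
  inferInstanceAs (FiniteDimensional ℝ (Fin (n + 1) → Fin (n + 1) → ℍ[ℝ]))

theorem differentiableAt_rhoMat (X : HMat n) : DifferentiableAt ℝ (fun X : HMat n => rhoMat X) X :=
  (rhoMatLinear (Fin (n + 1)) (Fin (n + 1))).differentiableAt_of_finiteDimensional X

theorem differentiableAt_tauH {x : HMat n × HMat n} (hx : x.2 ≠ 0) :
    DifferentiableAt ℝ (tauH n) x := by
  have hP : DifferentiableAt ℝ (fun y : HMat n × HMat n => y.1) x := differentiableAt_fst
  have hQ : DifferentiableAt ℝ (fun y : HMat n × HMat n => y.2) x := differentiableAt_snd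
  have hh := hQ.hNorm hx
  have h1 := ((hh.pow 2).smul hP).sub (differentiableAt_matrix_mul hQ hQ)
  have h2 := (hh.mul_const (Real.sqrt 2)⁻¹).smul hQ
  have h3 := ((differentiableAt_rhoMat _).comp x h1).add
    (((differentiableAt_rhoMat _).comp x h2).const_smul Complex.I)
  refine h3.congr_of_eventuallyEq (Filter.Eventually.of_forall fun y => ?_)
  exact tauH_eq y.1 y.2

theorem complexDifferential_one_tmul {E F : Type*} [NormedAddCommGroup E] [NormedSpace ℝ E]
    [NormedAddCommGroup F] [NormedSpace ℂ F] {X : Set E} {τ : E → F} {τ' : E →L[ℝ] F} {x : E}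
    (hτ : HasFDerivAt τ τ' x) (w : tangentSpace ℝ X x) :
    complexDifferential X τ x (1 ⊗ₜ w) = τ' w := by
  simp [complexDifferential, realDifferential, hτ.fderiv]

/-- Differentiate τ_ℍ ∘ τ_ℍ⁻¹ = id along Ẽ_ℍ: the derivative of the inverse sends v to a real
tangent vector of E_ℍ whose image is v. -/
theorem exists_complexDifferential_tauH_eq {x : HMat n × HMat n} (hx : x ∈ EH n) {v : CMat n}
    (hv : v ∈ tangentSpace ℂ (tildeEH n) (tauH n x)) :
    ∃ ξ, complexDifferential (EH n) (tauH n) x ξ = v := by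
  have hA := tauH_mapsTo n hx
  have hv' := mem_tangentSpace_real hA hv
  have hinv : tauInv n (tauH n x) = x := tauInv_tauH hx.2.2.2
  have hd := (differentiableAt_tauInv (quatIm_tauH_ne_zero (P := x.1) hx.2.2.2)).hasFDerivAt
  obtain ⟨τ', hd'⟩ : ∃ τ', HasFDerivAt (tauH n) τ' x := differentiableAt_tauH hx.2.2.2
  have hw := mem_tangentSpace_of_eventually (Y := EH n) hd
    (Filter.mem_of_superset self_mem_nhdsWithin fun A hA => tauInv_mem hA) hv'
  change _ ∈ tangentSpace ℝ (EH n) (tauInv n (tauH n x)) at hw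
  rw [hinv] at hw
  refine ⟨1 ⊗ₜ ⟨_, hw⟩, (complexDifferential_one_tmul hd' _).trans ?_⟩
  rw [← hinv] at hd'
  exact eq_of_mem_tangentSpace_of_eventuallyEq (hd'.comp _ hd) (hasFDerivAt_id _) hA
    (Filter.mem_of_superset self_mem_nhdsWithin fun A hA => tauH_tauInv hA) hv'

theorem exists_complexDifferential_id_eq {A : CMat n} (hA : A ∈ tildeEH n) {v : CMat n}
    (hv : v ∈ tangentSpace ℂ (tildeEH n) A) :
    ∃ ξ, complexDifferential (tildeEH n) id A ξ = v :=
  ⟨1 ⊗ₜ ⟨v, mem_tangentSpace_real hA hv⟩, complexDifferential_one_tmul (hasFDerivAt_id A) _⟩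

end HopfForm

end

/-! ### The theorem -/

theorem mainTheorem6 (n : ℕ) :
    ∃ σH : HopfForm.DiffForm (HopfForm.tildeEH n) (4 * n),
      -- `σ_ℍ` is a nowhere vanishing, `Sp(n+1)`-invariant holomorphic form with `β^* σ_ℍ = σ`
      HopfForm.IsHolomorphic σH ∧
      (∀ A, σH A ≠ 0) ∧
      (∀ g : HopfForm.Sp n, HopfForm.pullback (HopfForm.spAct_mapsTo n g) σH = σH) ∧
      HopfForm.pullback (HopfForm.beta_mapsTo n) σH = HopfForm.sigma n ∧
      -- it is unique
      (∀ η : HopfForm.DiffForm (HopfForm.tildeEH n) (4 * n),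
        HopfForm.pullback (HopfForm.beta_mapsTo n) η = HopfForm.sigma n → η = σH) ∧
      -- `σ_ℍ` trivializes the canonical line bundle over `Ẽ_ℍ`
      (∃ φ : ∀ A : HopfForm.tildeEH n,
          ℂ ≃ₗ[ℂ] HopfForm.canonicalFiber (HopfForm.tildeEH n) id (4 * n) (A : HopfForm.CMat n),
        HopfForm.IsHolomorphicTrivialization (HopfForm.tildeEH n) id (4 * n) φ ∧
        ∀ A, (φ A 1).1 = HopfForm.complexPullback (Set.mapsTo_id (HopfForm.tildeEH n)) σH A) ∧
      -- `τ_ℍ^* σ_ℍ` trivializes the canonical line bundle over the punctured (co)tangent bundle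
      ∃ φ : ∀ x : HopfForm.EH n,
          ℂ ≃ₗ[ℂ] HopfForm.canonicalFiber (HopfForm.EH n) (HopfForm.tauH n) (4 * n)
            (x : HopfForm.HMat n × HopfForm.HMat n),
        HopfForm.IsHolomorphicTrivialization (HopfForm.EH n) (HopfForm.tauH n) (4 * n) φ ∧
        ∀ x, (φ x 1).1 = HopfForm.complexPullback (HopfForm.tauH_mapsTo n) σH x := by
  refine ⟨HopfForm.sigmaH n, HopfForm.isHolomorphic_sigmaH, fun A h => ?_,
    HopfForm.pullback_spAct_sigmaH, HopfForm.pullback_beta_sigmaH,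
    HopfForm.eq_sigmaH_of_pullback_eq, ?_, ?_⟩
  · obtain ⟨v, -, hv⟩ := HopfForm.exists_span_sigmaH_ne_zero A
    exact hv (by rw [h]; rfl)
  · exact HopfForm.exists_isHolomorphicTrivialization _ HopfForm.isHolomorphic_sigmaH
      HopfForm.exists_span_sigmaH_ne_zero HopfForm.exists_local_frame _
      fun A hA v hv => HopfForm.exists_complexDifferential_id_eq hA hv
  · exact HopfForm.exists_isHolomorphicTrivialization _ HopfForm.isHolomorphic_sigmaH
      HopfForm.exists_span_sigmaH_ne_zero HopfForm.exists_local_frame _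
      fun x hx v hv => HopfForm.exists_complexDifferential_tauH_eq hx hv
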